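/- Let $k=\mathbb{Q}$ or $k=\mathbb{Z}/p\mathbb{Z}$ for some prime $p$, and let $n\ge 1$ and $i\ge 1$ be integers. Regard $\mathbb{R}^n$ as a poset with the product order ($a\le b$ iff $a_j\le b_j$ for all $j$). An $n$-module is a functor $M$ from the poset category $\mathbb{R}^n$ to the category of $k$-vector spaces; we write $\varphi_M(a,b):M_a\to M_b$ for its transition maps, $a\le b$. For $\epsilon\ge 0$ let $M(\epsilon)$ be the $n$-module with $M(\epsilon)_a=M_{a+\epsilon\vec 1}$ and the transition maps of $M$, where $\vec 1=(1,\dots,1)$. The $n$-modules $M$ and $N$ are $\epsilon$-interleaved if there are morphisms $f:M\to N(\epsilon)$ and $g:N\to M(\epsilon)$ such that, for all $a\in\mathbb{R}^n$, $g_{a+\epsilon\vec 1}\circ f_a=\varphi_M(a,a+2\epsilon\vec 1)$ and $f_{a+\epsilon\vec 1}\circ g_a=\varphi_N(a,a+2\epsilon\vec 1)$. For a topological space $X$ and a function $\gamma:X\to\mathbb{R}^n$, the $i$-th sublevelset persistent homology module of $(X,\gamma)$ is the $n$-module $a\mapsto H_i(\{x\in X:\gamma(x)\le a\};k)$ (singular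 homology of the subspace), with transition maps induced by the inclusions. Let $\epsilon\ge 0$, and let $M$ and $N$ be $\epsilon$-interleaved $n$-modules. Then there exist a CW-complex $X$ and continuous functions $\gamma_M,\gamma_N:X\to\mathbb{R}^n$ such that the $i$-th sublevelset persistent homology module of $(X,\gamma_M)$ is isomorphic to $M$, that of $(X,\gamma_N)$ is isomorphic to $N$, and $$\|\gamma_M-\gamma_N\|_\infty=\sup_{x\in X}\ \max_{1\le j\le n}|\gamma_M(x)_j-\gamma_N(x)_j|=\epsilon.$$ -/

import Mathlib

open CategoryTheory

universe u

noncomputable section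

/-- `ℝⁿ` as a poset with the product order: `a ≤ b` iff `a j ≤ b j` for every `j`.
A separate type name is used so that the category structure on it is the one coming from this
order, and not the product of the category structures of the factors. -/
def Grade (n : ℕ) : Type := Fin n → ℝ

instance (n : ℕ) : PartialOrder (Grade n) := inferInstanceAs (PartialOrder (Fin n → ℝ))

/-- The diagonal translate `a + (ε, …, ε)` of `a`. -/
def Grade.add {n : ℕ} (a : Grade n) (ε : ℝ) : Grade n := fun j => a j + ε

theorem Grade.add_mono {n : ℕ} (ε : ℝ) : Monotone (fun a : Grade n => a.add ε) :=
  fun _ _ h j => add_le_add_left (h j) ε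

theorem Grade.le_add {n : ℕ} (a : Grade n) {ε : ℝ} (hε : 0 ≤ ε) : a ≤ a.add ε :=
  fun _ => le_add_of_nonneg_right hε

theorem Grade.le_add_add {n : ℕ} (a : Grade n) {ε : ℝ} (hε : 0 ≤ ε) : a ≤ (a.add ε).add ε :=
  (a.le_add hε).trans ((a.add ε).le_add hε)

/-- `n`-modules over `k`: functors from the poset category `ℝⁿ` to `k`-vector spaces. -/
abbrev NModule (k : Type u) [Field k] (n : ℕ) := Grade n ⥤ ModuleCat.{u} k

/-- The `ε`-shift `M(ε)` of an `n`-module: `M(ε)_a = M_{a + ε}`, with the transition maps of `M`. -/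
def NModule.shift {k : Type u} [Field k] {n : ℕ} (M : NModule k n) (ε : ℝ) : NModule k n where
  obj a := M.obj (a.add ε)
  map h := M.map (homOfLE (Grade.add_mono ε (leOfHom h)))
  map_id _ := M.map_id _
  map_comp _ _ := M.map_comp _ _

/-- `M` and `N` are `ε`-interleaved: there are morphisms `f : M ⟶ N(ε)` and `g : N ⟶ M(ε)` such
that `g(ε) ∘ f` and `f(ε) ∘ g` are the transition morphisms `M ⟶ M(2ε)` and `N ⟶ N(2ε)`. -/
def NModule.Interleaved {k : Type u} [Field k] {n : ℕ} (M N : NModule k n) {ε : ℝ}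
    (hε : 0 ≤ ε) : Prop :=
  ∃ (f : M ⟶ N.shift ε) (g : N ⟶ M.shift ε),
    (∀ a : Grade n, f.app a ≫ g.app (a.add ε) = M.map (homOfLE (a.le_add_add hε))) ∧
    (∀ a : Grade n, g.app a ≫ f.app (a.add ε) = N.map (homOfLE (a.le_add_add hε)))

/-- The sublevelset filtration of `γ : X → ℝⁿ`: at `a ∈ ℝⁿ` it is the subspace
`{x | γ x ≤ a}` of `X`, and its internal maps are the inclusions. -/
def sublevelFiltration {n : ℕ} (X : TopCat.{u}) (γ : X → Fin n → ℝ) : Grade n ⥤ TopCat.{u} where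
  obj a := TopCat.of {x : X // ∀ j, γ x j ≤ a j}
  map {_ _} h := TopCat.ofHom
    ⟨fun x => ⟨x.1, fun j => (x.2 j).trans (leOfHom h j)⟩, by fun_prop⟩

/-- Singular homology in degree `i` with coefficients in the field `k`. -/
def singularHomology (k : Type u) [Field k] (i : ℕ) : TopCat.{u} ⥤ ModuleCat.{u} k :=
  (AlgebraicTopology.singularHomologyFunctor (ModuleCat.{u} k) i).obj (ModuleCat.of k k)

/-- The `i`-th sublevelset persistent homology `n`-module of `γ : X → ℝⁿ`. -/
def sublevelHomology (k : Type u) [Field k] (i : ℕ) {n : ℕ} (X : TopCat.{u})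
    (γ : X → Fin n → ℝ) : NModule k n :=
  sublevelFiltration X γ ⋙ singularHomology k i

end

/-! ### Formal chains on tuples of points -/

/-! Realising one module. Every homogeneous element of $M$ is taken as a generator. Over a prime
field additive maps are linear (`AddMonoidHom.map_smul_of_primeField`), so $M_b$ is presented by the
elements of grade at most $b$, with relations that are alternating sums with coefficients $\pm1$: $x
= x'$ and $x + x' = x''$ suffice. Such a relation can be read off the boundary of one
$(i+1)$-simplex whose faces carry elements or nothing; $i \ge 1$ provides the three faces needed for
a sum.

The space starts from the real line with the function $x \mapsto (x,\dots,x)$. Its sublevel sets are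
nonempty and convex for every grade, which no single base point could achieve, since grades are
unbounded below. For every element and every tuple of $i+1$ integers below its grade, an $i$-simplex
is glued along the boundary of the affine simplex with these vertices in the line; the two simplices
form a sphere. For every relator an $(i+1)$-simplex is glued, whose faces are such cells or affine
simplices of the line. Over each cell the function equals the grade on a central part and
interpolates radially to the boundary values, which are no larger. A sublevel set contains the full
cells of grade at most $b$ and meets the others only in a collar that retracts radially. Hence $H_i$
of it is spanned by the spheres modulo the relators, which is $M_b$.

Two interleaved modules. The elements of $M$ and of $N$ are used together: $y \in N_a$ counts in $M$
as $g(y)$ in grade $a+\epsilon$, and $x \in M_a$ counts in $N$ as $f(x)$. A relator of $N$ holds in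
$M$ after a shift by $\epsilon$: apply $g$ and use $gf = \varphi_M$. So a single space with the
relators of both modules carries both functions. Their values at the centres of the cells differ by
exactly $\epsilon$, they agree on the line, and the interpolation keeps the bound.

The homology is computed with explicit chains. Small simplices (`SChain.exists_subdiv_mem`) give the
local homology of a simplex (`SChain.FaceCover.exists_decomposition`,
`SChain.FaceCover.eq_zero_of_d_eq`), then the effect of attaching cells
(`Attach.Adapted.exists_decomposition`, `Attach.Adapted.eq_zero_of_mem`), and after two stages the
generators and relations (`CellData.Adapted.exists_sphere`, `CellData.Adapted.mem_span_of_eq_d`).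
The algebraic side is `Presentation.mem_relSpan_of_evLabel_eq_zero`. Integral vertices make the line
and the cells a CW complex. -/

namespace FormalChain

variable (k : Type*) [Field k] {V W : Type*}

/-- Formal `k`-linear combinations of `n`-tuples of points; a tuple of length `n + 1` stands for an
`n`-simplex. -/
abbrev LC (n : ℕ) (V : Type*) := (Fin n → V) →₀ k

/-- The map on formal chains induced by a map of points. -/
noncomputable def push (f : V → W) (n : ℕ) : LC k n V →ₗ[k] LC k n W :=
  Finsupp.lmapDomain k k (fun v => f ∘ v)

@[simp] theorem push_single (f : V → W) (n : ℕ) (v : Fin n → V) (c : k) :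
    push k f n (Finsupp.single v c) = Finsupp.single (f ∘ v) c := by
  simp [push, Finsupp.lmapDomain_apply]

/-- The alternating sum of faces. -/
noncomputable def bd (n : ℕ) : LC k (n + 1) V →ₗ[k] LC k n V :=
  ∑ j : Fin (n + 1), (-1 : k) ^ (j : ℕ) • Finsupp.lmapDomain k k (fun v => v ∘ j.succAbove)

theorem bd_single (n : ℕ) (v : Fin (n + 1) → V) (c : k) :
    bd k n (Finsupp.single v c) =
      ∑ j : Fin (n + 1), (-1 : k) ^ (j : ℕ) • Finsupp.single (v ∘ j.succAbove) c := by
  simp [bd, LinearMap.sum_apply, Finsupp.lmapDomain_apply]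

/-- The cone with a given apex. -/
noncomputable def cone (a : V) (n : ℕ) : LC k n V →ₗ[k] LC k (n + 1) V :=
  Finsupp.lmapDomain k k (fun v => Fin.cons a v)

@[simp] theorem cone_single (a : V) (n : ℕ) (v : Fin n → V) (c : k) :
    cone k a n (Finsupp.single v c) = Finsupp.single (Fin.cons a v : Fin (n + 1) → V) c := by
  simp [cone, Finsupp.lmapDomain_apply]

theorem cons_comp_succAbove_succ {n : ℕ} (a : V) (v : Fin (n + 1) → V) (j : Fin (n + 1)) :
    (Fin.cons a v : Fin (n + 2) → V) ∘ j.succ.succAbove = Fin.cons a (v ∘ j.succAbove) := by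
  funext l
  refine Fin.cases ?_ (fun l => ?_) l
  · simp
  · simp [Fin.succ_succAbove_succ]

/-- The face opposite the apex returns the chain; every other face is the cone on a face, with the
sign shifted by one. The boundary formulas for subdivision and prisms all follow formally from this.
-/
theorem bd_cone (a : V) (n : ℕ) (c : LC k (n + 1) V) :
    bd k (n + 1) (cone k a (n + 1) c) = c - cone k a n (bd k n c) := by
  induction c using Finsupp.induction_linear with
  | zero => simp
  | add x y hx hy => simp only [map_add, hx, hy]; abel
  | single v c =>
    rw [cone_single, bd_single, Fin.sum_univ_succ, bd_single, map_sum]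
    have h0 : (Fin.cons a v : Fin (n + 2) → V) ∘ (0 : Fin (n + 2)).succAbove = v := by
      funext l; simp
    simp only [h0, cons_comp_succAbove_succ, map_smul, cone_single, Fin.val_zero, pow_zero,
      one_smul, Fin.val_succ, pow_succ, mul_neg, mul_one, neg_smul, Finset.sum_neg_distrib]
    abel

/-- The bottom case is separate because the empty tuple has no boundary: the complex is augmented
and stops at tuples of length `0`. -/
theorem bd_cone_zero (a : V) (c : LC k 0 V) : bd k 0 (cone k a 0 c) = c := by
  induction c using Finsupp.induction_linear with
  | zero => simp
  | add x y hx hy => simp only [map_add, hx, hy]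
  | single v c =>
    rw [cone_single, bd_single, Fin.sum_univ_succ]
    simp only [Finset.univ_eq_empty, Finset.sum_empty, add_zero, Fin.val_zero, pow_zero, one_smul]
    congr 1

theorem single_eq_cone {n : ℕ} (v : Fin (n + 1) → V) (c : k) :
    Finsupp.single v c = cone k (v 0) n (Finsupp.single (v ∘ Fin.succ) c) := by
  rw [cone_single]
  congr 1
  exact (Fin.cons_self_tail v).symm

/-- Every tuple is a cone from its first vertex, so the cone formula reduces the claim to one degree
lower. -/
theorem bd_bd (n : ℕ) (c : LC k (n + 2) V) : bd k n (bd k (n + 1) c) = 0 := by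
  induction n with
  | zero =>
    induction c using Finsupp.induction_linear with
    | zero => simp
    | add x y hx hy => simp only [map_add, hx, hy]; simp
    | single v c =>
      rw [single_eq_cone, bd_cone, map_sub, bd_cone_zero, sub_self]
  | succ n ih =>
    induction c using Finsupp.induction_linear with
    | zero => simp
    | add x y hx hy => simp only [map_add, hx, hy]; simp
    | single v c =>
      rw [single_eq_cone, bd_cone, map_sub, bd_cone, ih]
      simp

theorem bd_push (f : V → W) (n : ℕ) (c : LC k (n + 1) V) :
    bd k n (push k f (n + 1) c) = push k f n (bd k n c) := by
  induction c using Finsupp.induction_linear with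
  | zero => simp
  | add x y hx hy => simp only [map_add, hx, hy]
  | single v c =>
    simp only [push_single, bd_single, map_sum, map_smul]
    rfl

theorem push_cone (f : V → W) (a : V) (n : ℕ) (c : LC k n V) :
    push k f (n + 1) (cone k a n c) = cone k (f a) n (push k f n c) := by
  induction c using Finsupp.induction_linear with
  | zero => simp
  | add x y hx hy => simp only [map_add, hx, hy]
  | single v c =>
    simp only [push_single, cone_single]
    congr 1
    funext l
    refine Fin.cases ?_ (fun l => ?_) l <;> simp

theorem push_push {U : Type*} (g : W → U) (f : V → W) (n : ℕ) (c : LC k n V) :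
    push k g n (push k f n c) = push k (g ∘ f) n c := by
  induction c using Finsupp.induction_linear with
  | zero => simp
  | add x y hx hy => simp only [map_add, hx, hy]
  | single v c => simp only [push_single]; rfl

/-! ### Barycentric subdivision, relative to a choice of centres -/

section Subdivision

variable (β : ∀ n : ℕ, (Fin (n + 1) → V) → V)

/-- Barycentric subdivision with respect to a choice `β` of the centre of each tuple. -/
noncomputable def sd : ∀ n : ℕ, LC k n V →ₗ[k] LC k n V
  | 0 => LinearMap.id
  | n + 1 => Finsupp.linearCombination k fun v : Fin (n + 1) → V =>
      cone k (β n v) n (sd n (bd k n (Finsupp.single v 1)))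

/-- The chain homotopy from the identity to barycentric subdivision. -/
noncomputable def sdHomotopy : ∀ n : ℕ, LC k n V →ₗ[k] LC k (n + 1) V
  | 0 => 0
  | n + 1 => Finsupp.linearCombination k fun v : Fin (n + 1) → V =>
      cone k (β n v) (n + 1) (Finsupp.single v 1 - sdHomotopy n (bd k n (Finsupp.single v 1)))

theorem sd_succ_single (n : ℕ) (v : Fin (n + 1) → V) :
    sd k β (n + 1) (Finsupp.single v 1) =
      cone k (β n v) n (sd k β n (bd k n (Finsupp.single v 1))) := by
  simp [sd]

theorem sdHomotopy_succ_single (n : ℕ) (v : Fin (n + 1) → V) :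
    sdHomotopy k β (n + 1) (Finsupp.single v 1) = cone k (β n v) (n + 1)
      (Finsupp.single v 1 - sdHomotopy k β n (bd k n (Finsupp.single v 1))) := by
  simp [sdHomotopy]

variable {k} in
theorem linearMap_ext_single {A : Type*} {M : Type*} [AddCommGroup M] [Module k M]
    {f g : (A →₀ k) →ₗ[k] M} (h : ∀ a, f (Finsupp.single a 1) = g (Finsupp.single a 1)) :
    f = g :=
  Finsupp.lhom_ext' fun a => LinearMap.ext_ring (h a)

/-- The subdivision of a tuple is the cone on the subdivided boundary. In its boundary the
correction term is the cone on the boundary of that chain, which vanishes by induction and `bd_bd`.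
-/
theorem bd_sd (n : ℕ) (c : LC k (n + 1) V) :
    bd k n (sd k β (n + 1) c) = sd k β n (bd k n c) := by
  induction n with
  | zero =>
    refine LinearMap.congr_fun (f := bd k 0 ∘ₗ sd k β 1) (g := sd k β 0 ∘ₗ bd k 0)
      (linearMap_ext_single fun v => ?_) c
    simp only [LinearMap.comp_apply, sd_succ_single, bd_cone_zero]
  | succ n ih =>
    refine LinearMap.congr_fun (f := bd k (n + 1) ∘ₗ sd k β (n + 2))
      (g := sd k β (n + 1) ∘ₗ bd k (n + 1)) (linearMap_ext_single fun v => ?_) c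
    simp only [LinearMap.comp_apply]
    rw [sd_succ_single, bd_cone, ih, bd_bd]
    simp

theorem bd_sdHomotopy_zero (c : LC k 0 V) :
    bd k 0 (sdHomotopy k β 0 c) = c - sd k β 0 c := by
  simp [sdHomotopy, sd]

/-- Write $T$ for the homotopy. By induction $\partial(v - T\partial v)$ is the subdivision of
$\partial v$, and the cone on the latter is by definition the subdivision of $v$. -/
theorem bd_sdHomotopy (n : ℕ) (c : LC k (n + 1) V) :
    bd k (n + 1) (sdHomotopy k β (n + 1) c) =
      c - sd k β (n + 1) c - sdHomotopy k β n (bd k n c) := by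
  have key : ∀ n, bd k (n + 1) ∘ₗ sdHomotopy k β (n + 1) =
      (LinearMap.id - sd k β (n + 1) - sdHomotopy k β n ∘ₗ bd (V := V) k n) := by
    intro n
    induction n with
    | zero =>
      refine linearMap_ext_single fun v => ?_
      simp only [LinearMap.comp_apply, LinearMap.sub_apply, LinearMap.id_apply]
      rw [sdHomotopy_succ_single, bd_cone, map_sub (bd k 0), bd_sdHomotopy_zero, sd_succ_single]
      simp only [map_sub]
      abel
    | succ n ih =>
      refine linearMap_ext_single fun v => ?_
      have h := LinearMap.congr_fun ih (bd k (n + 1) (Finsupp.single v 1))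
      simp only [LinearMap.comp_apply, LinearMap.sub_apply, LinearMap.id_apply] at h ⊢
      rw [sdHomotopy_succ_single, bd_cone, map_sub (bd k (n + 1)), h, sd_succ_single, bd_bd]
      simp only [map_sub, map_zero]
      abel
  exact LinearMap.congr_fun (key n) c

variable {β} {γ : ∀ n : ℕ, (Fin (n + 1) → W) → W}

/-- Only compatibility with the centres is needed. For affine maps and barycentres this carries the
subdivision of the model simplex to every affine simplex. -/
theorem sd_push (f : V → W) (hf : ∀ n v, f (β n v) = γ n (f ∘ v)) (n : ℕ) (c : LC k n V) :
    sd k γ n (push k f n c) = push k f n (sd k β n c) := by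
  induction n with
  | zero => simp [sd]
  | succ n ih =>
    refine LinearMap.congr_fun (f := sd k γ (n + 1) ∘ₗ push k f (n + 1))
      (g := push k f (n + 1) ∘ₗ sd k β (n + 1)) (linearMap_ext_single fun v => ?_) c
    simp only [LinearMap.comp_apply, push_single]
    rw [sd_succ_single, sd_succ_single, push_cone, ← ih, hf, ← bd_push, push_single]

theorem sdHomotopy_push (f : V → W) (hf : ∀ n v, f (β n v) = γ n (f ∘ v)) (n : ℕ)
    (c : LC k n V) :
    sdHomotopy k γ n (push k f n c) = push k f (n + 1) (sdHomotopy k β n c) := by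
  induction n with
  | zero => simp [sdHomotopy]
  | succ n ih =>
    refine LinearMap.congr_fun (f := sdHomotopy k γ (n + 1) ∘ₗ push k f (n + 1))
      (g := push k f (n + 2) ∘ₗ sdHomotopy k β (n + 1)) (linearMap_ext_single fun v => ?_) c
    simp only [LinearMap.comp_apply, push_single]
    rw [sdHomotopy_succ_single, sdHomotopy_succ_single, push_cone,
      map_sub (push k f (n + 1)), ← ih, hf, ← bd_push, push_single]

end Subdivision

/-! ### Iterated subdivision -/

section Iterate

variable (β : ∀ n : ℕ, (Fin (n + 1) → V) → V)

/-- The `N`-fold barycentric subdivision. -/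
noncomputable def sdIter (N n : ℕ) : LC k n V →ₗ[k] LC k n V := (sd k β n) ^ N

/-- The chain homotopy from the identity to the `N`-fold barycentric subdivision. -/
noncomputable def sdIterHomotopy (N n : ℕ) : LC k n V →ₗ[k] LC k (n + 1) V :=
  ∑ q ∈ Finset.range N, sdHomotopy k β n ∘ₗ sdIter k β q n

theorem sdIter_succ (N n : ℕ) (c : LC k n V) :
    sdIter k β (N + 1) n c = sd k β n (sdIter k β N n c) := by
  simp [sdIter, pow_succ', Module.End.mul_apply]

theorem bd_sdIter (N n : ℕ) (c : LC k (n + 1) V) :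
    bd k n (sdIter k β N (n + 1) c) = sdIter k β N n (bd k n c) := by
  induction N with
  | zero => simp [sdIter]
  | succ N ih => rw [sdIter_succ, sdIter_succ, bd_sd, ih]

theorem sdIterHomotopy_succ (N n : ℕ) (c : LC k n V) :
    sdIterHomotopy k β (N + 1) n c =
      sdIterHomotopy k β N n c + sdHomotopy k β n (sdIter k β N n c) := by
  simp [sdIterHomotopy, Finset.sum_range_succ]

/-- The homotopies of the successive subdivisions telescope. -/
theorem bd_sdIterHomotopy (N n : ℕ) (c : LC k (n + 1) V) :
    bd k (n + 1) (sdIterHomotopy k β N (n + 1) c) =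
      c - sdIter k β N (n + 1) c - sdIterHomotopy k β N n (bd k n c) := by
  induction N with
  | zero => simp [sdIter, sdIterHomotopy]
  | succ N ih =>
    rw [sdIterHomotopy_succ, map_add, ih, bd_sdHomotopy, sdIter_succ, sdIterHomotopy_succ,
      bd_sdIter]
    abel

variable {β} {γ : ∀ n : ℕ, (Fin (n + 1) → W) → W}

theorem sdIter_push (f : V → W) (hf : ∀ n v, f (β n v) = γ n (f ∘ v)) (N n : ℕ)
    (c : LC k n V) :
    sdIter k γ N n (push k f n c) = push k f n (sdIter k β N n c) := by
  induction N with
  | zero => simp [sdIter]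
  | succ N ih => rw [sdIter_succ, sdIter_succ, ih, sd_push k f hf]

theorem sdIterHomotopy_push (f : V → W) (hf : ∀ n v, f (β n v) = γ n (f ∘ v)) (N n : ℕ)
    (c : LC k n V) :
    sdIterHomotopy k γ N n (push k f n c) = push k f (n + 1) (sdIterHomotopy k β N n c) := by
  induction N with
  | zero => simp [sdIterHomotopy]
  | succ N ih =>
    rw [sdIterHomotopy_succ, sdIterHomotopy_succ, ih, map_add, sdIter_push k f hf,
      sdHomotopy_push k f hf]

end Iterate

/-! ### The prism operator -/

section Prism

variable (b t : V → W)

/-- The prism operator between two maps of points, the bottom `b` and the top `t`. -/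
noncomputable def prism : ∀ n : ℕ, LC k n V →ₗ[k] LC k (n + 1) W
  | 0 => 0
  | n + 1 => Finsupp.linearCombination k fun v : Fin (n + 1) → V =>
      Finsupp.single (Fin.cons (b (v 0)) (t ∘ v) : Fin (n + 2) → W) 1 -
        cone k (b (v 0)) (n + 1) (prism n (Finsupp.single (v ∘ Fin.succ) 1))

theorem prism_succ_single (n : ℕ) (v : Fin (n + 1) → V) :
    prism k b t (n + 1) (Finsupp.single v 1) =
      Finsupp.single (Fin.cons (b (v 0)) (t ∘ v) : Fin (n + 2) → W) 1 -
        cone k (b (v 0)) (n + 1) (prism k b t n (Finsupp.single (v ∘ Fin.succ) 1)) := by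
  simp [prism]

/-- The recursion of `prism` on the first vertex, rewritten for cones, so that `bd_prism` can be
proved with `bd_cone`. -/
theorem prism_cone (a : V) (n : ℕ) (c : LC k n V) :
    prism k b t (n + 1) (cone k a n c) =
      cone k (b a) (n + 1) (cone k (t a) n (push k t n c)) -
        cone k (b a) (n + 1) (prism k b t n c) := by
  refine LinearMap.congr_fun (f := prism k b t (n + 1) ∘ₗ cone k a n)
    (g := cone k (b a) (n + 1) ∘ₗ cone k (t a) n ∘ₗ push k t n -
      cone k (b a) (n + 1) ∘ₗ prism k b t n) (linearMap_ext_single fun v => ?_) c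
  simp only [LinearMap.comp_apply, LinearMap.sub_apply, cone_single, push_single,
    prism_succ_single]
  congr 2
  · congr 1
    funext l
    refine Fin.cases ?_ (fun l => ?_) l <;> simp

theorem bd_prism_zero (c : LC k 0 V) :
    bd k 0 (prism k b t 0 c) = push k t 0 c - push k b 0 c := by
  have : push k t 0 = push k b 0 := linearMap_ext_single fun v => by
    simp only [push_single]
    congr 1
    exact Subsingleton.elim _ _
  simp [prism, this]

theorem bd_prism (n : ℕ) (c : LC k (n + 1) V) :
    bd k (n + 1) (prism k b t (n + 1) c) =
      push k t (n + 1) c - push k b (n + 1) c - prism k b t n (bd k n c) := by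
  have key : ∀ n, bd k (n + 1) ∘ₗ prism k b t (n + 1) =
      (push k t (n + 1) - push k b (n + 1) - prism k b t n ∘ₗ bd k n) := by
    intro n
    induction n with
    | zero =>
      refine linearMap_ext_single fun v => ?_
      simp only [LinearMap.comp_apply, LinearMap.sub_apply]
      rw [single_eq_cone, prism_cone, map_sub, bd_cone, bd_cone, bd_cone_zero, bd_prism_zero,
        bd_cone_zero, push_cone, push_cone]
      simp only [map_sub]
      simp only [prism, LinearMap.zero_apply]
      abel
    | succ n ih =>
      refine linearMap_ext_single fun v => ?_
      simp only [LinearMap.comp_apply, LinearMap.sub_apply]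
      have h := LinearMap.congr_fun ih (Finsupp.single (v ∘ Fin.succ) 1)
      simp only [LinearMap.comp_apply, LinearMap.sub_apply] at h
      rw [single_eq_cone, prism_cone, map_sub, bd_cone, bd_cone, bd_cone, h, bd_cone, push_cone,
        push_cone, bd_push]
      simp only [map_sub]
      rw [prism_cone]
      abel
  exact LinearMap.congr_fun (key n) c

theorem prism_push {V' W' : Type*} {b' t' : V' → W'} (f : V → V') (g : W → W')
    (hb : ∀ v, g (b v) = b' (f v)) (ht : ∀ v, g (t v) = t' (f v)) (n : ℕ) (c : LC k n V) :
    prism k b' t' n (push k f n c) = push k g (n + 1) (prism k b t n c) := by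
  induction n with
  | zero => simp [prism]
  | succ n ih =>
    refine LinearMap.congr_fun (f := prism k b' t' (n + 1) ∘ₗ push k f (n + 1))
      (g := push k g (n + 2) ∘ₗ prism k b t (n + 1)) (linearMap_ext_single fun v => ?_) c
    simp only [LinearMap.comp_apply]
    have h1 : (g ∘ t : V → W') = t' ∘ f := funext ht
    rw [single_eq_cone, push_cone, prism_cone, prism_cone, map_sub, push_cone, push_cone,
      push_cone, push_push, push_push, ih, h1, hb, ht]

end Prism

end FormalChain

/-! ### Affine simplices in convex sets -/

section Affine

variable {E F : Type*} [NormedAddCommGroup E] [NormedSpace ℝ E]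
  [NormedAddCommGroup F] [NormedSpace ℝ F]

/-- The affine simplex with given vertices in a convex set. -/
noncomputable def affineSimplex {K : Set E} (hK : Convex ℝ K) {n : ℕ} (v : Fin n → K) :
    C(stdSimplex ℝ (Fin n), K) where
  toFun p := ⟨∑ j, p j • (v j : E),
    hK.sum_mem (fun j _ => p.2.1 j) p.2.2 (fun j _ => (v j).2)⟩
  continuous_toFun := by
    refine Continuous.subtype_mk (continuous_finsetSum _ fun j _ => ?_) _
    exact ((continuous_apply j).comp continuous_subtype_val).smul continuous_const

theorem affineSimplex_coe {K : Set E} (hK : Convex ℝ K) {n : ℕ} (v : Fin n → K)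
    (p : stdSimplex ℝ (Fin n)) : (affineSimplex hK v p : E) = ∑ j, p j • (v j : E) := rfl

/-- The map of standard simplices induced by a map of vertices. -/
noncomputable def simplexMap {m n : ℕ} (f : Fin m → Fin n) :
    C(stdSimplex ℝ (Fin m), stdSimplex ℝ (Fin n)) :=
  ⟨stdSimplex.map f, stdSimplex.continuous_map f⟩

theorem simplexMap_sum {m n : ℕ} (f : Fin m → Fin n) (p : stdSimplex ℝ (Fin m)) (v : Fin n → E) :
    ∑ j, simplexMap f p j • v j = ∑ l, p l • v (f l) := by
  have h : ∀ j, simplexMap f p j = ∑ l with f l = j, p l := fun j => by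
    change stdSimplex.map f p j = _
    rw [stdSimplex.map_coe, FunOnFinite.linearMap_apply_apply]
  simp only [h, Finset.sum_smul]
  rw [← Finset.sum_fiberwise Finset.univ f (fun l => p l • v (f l))]
  refine Finset.sum_congr rfl fun j _ => Finset.sum_congr rfl fun l hl => ?_
  rw [(Finset.mem_filter.1 hl).2]

theorem affineSimplex_comp_simplexMap {K : Set E} (hK : Convex ℝ K) {m n : ℕ} (v : Fin n → K)
    (f : Fin m → Fin n) : (affineSimplex hK v).comp (simplexMap f) = affineSimplex hK (v ∘ f) := by
  ext p
  exact simplexMap_sum f p fun j => (v j : E)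

/-- A map between convex sets which preserves convex combinations. -/
def PreservesConvexComb {K : Set E} (hK : Convex ℝ K) {K' : Set F} (hK' : Convex ℝ K')
    (f : K → K') : Prop :=
  ∀ (n : ℕ) (v : Fin n → K) (p : stdSimplex ℝ (Fin n)),
    f (affineSimplex hK v p) = affineSimplex hK' (f ∘ v) p

theorem preservesConvexComb_affineSimplex {K : Set E} (hK : Convex ℝ K) {n : ℕ} (v : Fin n → K) :
    PreservesConvexComb (convex_stdSimplex ℝ (Fin n)) hK (affineSimplex hK v) := by
  intro m w p
  apply Subtype.ext
  simp only [affineSimplex_coe, Function.comp_apply]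
  have : ∀ j, (affineSimplex (convex_stdSimplex ℝ (Fin n)) w p) j = ∑ l, p l * w l j := by
    intro j
    change (∑ l, p l • (w l : Fin n → ℝ)) j = _
    rw [Finset.sum_apply]
    rfl
  simp only [this, Finset.sum_smul, Finset.smul_sum, smul_smul]
  rw [Finset.sum_comm]

/-- The vertices of the standard simplex. -/
noncomputable def stdVertices (n : ℕ) (j : Fin n) : stdSimplex ℝ (Fin n) :=
  ⟨Pi.single j 1, single_mem_stdSimplex ℝ j⟩

theorem affineSimplex_stdVertices (n : ℕ) :
    affineSimplex (convex_stdSimplex ℝ (Fin n)) (stdVertices n) = ContinuousMap.id _ := by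
  refine ContinuousMap.ext fun p => stdSimplex.ext (funext fun l => ?_)
  change (∑ j, p j • (Pi.single j (1 : ℝ) : Fin n → ℝ)) l = p l
  rw [Finset.sum_apply]
  simp [Pi.single_apply]

theorem simplexMap_stdVertices {m n : ℕ} (f : Fin m → Fin n) (l : Fin m) :
    simplexMap f (stdVertices m l) = stdVertices n (f l) := by
  apply stdSimplex.ext
  funext j
  change stdSimplex.map f _ j = _
  rw [stdSimplex.map_coe, FunOnFinite.linearMap_apply_apply]
  change ∑ l' with f l' = j, (Pi.single l (1 : ℝ) : Fin m → ℝ) l' = (Pi.single (f l) (1:ℝ) : Fin n → ℝ) j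
  simp [Pi.single_apply, eq_comm]

/-- The barycenter of a tuple of points of a convex set. -/
noncomputable def bary {K : Set E} (hK : Convex ℝ K) (n : ℕ) (v : Fin (n + 1) → K) : K :=
  affineSimplex hK v stdSimplex.barycenter

theorem PreservesConvexComb.bary {K : Set E} {hK : Convex ℝ K} {K' : Set F} {hK' : Convex ℝ K'}
    {f : K → K'} (hf : PreservesConvexComb hK hK' f) (n : ℕ) (v : Fin (n + 1) → K) :
    f (bary hK n v) = _root_.bary hK' n (f ∘ v) :=
  hf _ _ _

theorem preservesConvexComb_simplexMap {m n : ℕ} (f : Fin m → Fin n) :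
    PreservesConvexComb (convex_stdSimplex ℝ (Fin m)) (convex_stdSimplex ℝ (Fin n))
      (simplexMap f) := by
  have : simplexMap f = affineSimplex (convex_stdSimplex ℝ (Fin n)) (stdVertices n ∘ f) := by
    rw [← affineSimplex_comp_simplexMap, affineSimplex_stdVertices]
    rfl
  rw [this]
  exact preservesConvexComb_affineSimplex _ _

end Affine

/-! ### Singular chains -/

/-- Singular chains; a simplex with `n` vertices is a continuous map on
`stdSimplex ℝ (Fin n)`, so that the resulting complex is the augmented one. -/
abbrev SChain (k : Type*) [Field k] (n : ℕ) (X : Type*) [TopologicalSpace X] :=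
  C(stdSimplex ℝ (Fin n), X) →₀ k

namespace SChain

open FormalChain

variable (k : Type*) [Field k] {X Y Z : Type*} [TopologicalSpace X] [TopologicalSpace Y]
  [TopologicalSpace Z]
variable {E F : Type*} [NormedAddCommGroup E] [NormedSpace ℝ E]
  [NormedAddCommGroup F] [NormedSpace ℝ F]

/-- The inclusion of the `j`-th face of the standard simplex. -/
noncomputable abbrev face (n : ℕ) (j : Fin (n + 1)) :
    C(stdSimplex ℝ (Fin n), stdSimplex ℝ (Fin (n + 1))) := simplexMap j.succAbove

/-- The singular boundary operator. -/
noncomputable def d (n : ℕ) : SChain k (n + 1) X →ₗ[k] SChain k n X :=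
  ∑ j : Fin (n + 1), (-1 : k) ^ (j : ℕ) • Finsupp.lmapDomain k k (fun σ => σ.comp (face n j))

theorem d_single (n : ℕ) (σ : C(stdSimplex ℝ (Fin (n + 1)), X)) (c : k) :
    d k n (Finsupp.single σ c) =
      ∑ j : Fin (n + 1), (-1 : k) ^ (j : ℕ) • Finsupp.single (σ.comp (face n j)) c := by
  simp [d, LinearMap.sum_apply, Finsupp.lmapDomain_apply]

/-- The map on singular chains induced by a continuous map. -/
noncomputable def map (f : C(X, Y)) (n : ℕ) : SChain k n X →ₗ[k] SChain k n Y :=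
  Finsupp.lmapDomain k k (fun σ => f.comp σ)

@[simp] theorem map_single (f : C(X, Y)) (n : ℕ) (σ : C(stdSimplex ℝ (Fin n), X)) (c : k) :
    map k f n (Finsupp.single σ c) = Finsupp.single (f.comp σ) c := by
  simp [map, Finsupp.lmapDomain_apply]

theorem map_map (g : C(Y, Z)) (f : C(X, Y)) (n : ℕ) (c : SChain k n X) :
    map k g n (map k f n c) = map k (g.comp f) n c := by
  refine LinearMap.congr_fun (f := map k g n ∘ₗ map k f n) (linearMap_ext_single fun σ => ?_) c
  simp only [LinearMap.comp_apply, map_single]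
  rfl

theorem map_id (n : ℕ) (c : SChain k n X) : map k (ContinuousMap.id X) n c = c := by
  refine LinearMap.congr_fun (g := LinearMap.id) (linearMap_ext_single fun σ => ?_) c
  simp only [map_single, LinearMap.id_apply]
  rfl

theorem d_map (f : C(X, Y)) (n : ℕ) (c : SChain k (n + 1) X) :
    d k n (map k f (n + 1) c) = map k f n (d k n c) := by
  refine LinearMap.congr_fun (f := d k n ∘ₗ map k f (n + 1)) (g := map k f n ∘ₗ d k n)
    (linearMap_ext_single fun σ => ?_) c
  simp only [LinearMap.comp_apply, map_single, d_single, map_sum, map_smul]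
  rfl

theorem map_injective {f : C(X, Y)} (hf : Function.Injective f) (n : ℕ) :
    Function.Injective (map k f n) := by
  refine Finsupp.mapDomain_injective fun σ τ h => ?_
  ext p
  exact hf (DFunLike.congr_fun h p)

/-- The singular chain of affine simplices, in a space parametrised by a convex set, which is
described by a formal chain. -/
noncomputable def real {K : Set E} (hK : Convex ℝ K) (G : C(K, X)) (n : ℕ) :
    LC k n K →ₗ[k] SChain k n X :=
  Finsupp.lmapDomain k k (fun v => G.comp (affineSimplex hK v))

@[simp] theorem real_single {K : Set E} (hK : Convex ℝ K) (G : C(K, X)) (n : ℕ) (v : Fin n → K)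
    (c : k) :
    real k hK G n (Finsupp.single v c) = Finsupp.single (G.comp (affineSimplex hK v)) c := by
  simp [real, Finsupp.lmapDomain_apply]

theorem d_real {K : Set E} (hK : Convex ℝ K) (G : C(K, X)) (n : ℕ) (c : LC k (n + 1) K) :
    d k n (real k hK G (n + 1) c) = real k hK G n (bd k n c) := by
  refine LinearMap.congr_fun (f := d k n ∘ₗ real k hK G (n + 1)) (g := real k hK G n ∘ₗ bd k n)
    (linearMap_ext_single fun v => ?_) c
  simp only [LinearMap.comp_apply, real_single, d_single, bd_single, map_sum, map_smul,
    ContinuousMap.comp_assoc, affineSimplex_comp_simplexMap]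

theorem map_real {K : Set E} (hK : Convex ℝ K) (G : C(K, X)) (f : C(X, Y)) (n : ℕ)
    (c : LC k n K) : map k f n (real k hK G n c) = real k hK (f.comp G) n c := by
  refine LinearMap.congr_fun (f := map k f n ∘ₗ real k hK G n) (linearMap_ext_single fun v => ?_) c
  simp only [LinearMap.comp_apply, real_single, map_single]
  rfl

theorem real_push {K : Set E} {hK : Convex ℝ K} {K' : Set F} {hK' : Convex ℝ K'} (G : C(K', X))
    (f : C(K, K')) (hf : PreservesConvexComb hK hK' f) (n : ℕ) (c : LC k n K) :
    real k hK' G n (push k f n c) = real k hK (G.comp f) n c := by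
  refine LinearMap.congr_fun (f := real k hK' G n ∘ₗ push k f n) (linearMap_ext_single fun v => ?_) c
  simp only [LinearMap.comp_apply, real_single, push_single]
  congr 1
  ext p
  exact congrArg G (hf n v p).symm

/-- The tautological formal simplex. -/
noncomputable abbrev ι (n : ℕ) : LC k n (stdSimplex ℝ (Fin n)) :=
  Finsupp.single (stdVertices n) 1

/-- Every singular simplex is the realization, along itself, of one formal simplex. Identities
between natural operators on singular chains therefore reduce to identities between formal chains.
-/
theorem real_ι (n : ℕ) (σ : C(stdSimplex ℝ (Fin n), X)) :
    real k (convex_stdSimplex ℝ (Fin n)) σ n (ι k n) = Finsupp.single σ 1 := by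
  rw [real_single, affineSimplex_stdVertices]
  rfl

theorem d_d (n : ℕ) (c : SChain k (n + 2) X) : d k n (d k (n + 1) c) = 0 := by
  refine LinearMap.congr_fun (f := d k n ∘ₗ d k (n + 1)) (g := 0) (linearMap_ext_single fun σ => ?_) c
  simp only [LinearMap.comp_apply, LinearMap.zero_apply]
  rw [← real_ι, d_real, d_real, bd_bd, map_zero]

/-! ### Singular subdivision -/

/-- The centres used for barycentric subdivision of standard simplices. -/
noncomputable abbrev stdBary (m : ℕ) :=
  fun n v => bary (convex_stdSimplex ℝ (Fin m)) n v

/-- The `N`-fold barycentric subdivision of singular chains. -/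
noncomputable def subdiv (N n : ℕ) : SChain k n X →ₗ[k] SChain k n X :=
  Finsupp.linearCombination k fun σ =>
    real k (convex_stdSimplex ℝ (Fin n)) σ n (sdIter k (stdBary n) N n (ι k n))

/-- The chain homotopy from the identity to the `N`-fold barycentric subdivision. -/
noncomputable def subdivHomotopy (N n : ℕ) : SChain k n X →ₗ[k] SChain k (n + 1) X :=
  Finsupp.linearCombination k fun σ =>
    real k (convex_stdSimplex ℝ (Fin n)) σ (n + 1) (sdIterHomotopy k (stdBary n) N n (ι k n))

theorem subdiv_single (N n : ℕ) (σ : C(stdSimplex ℝ (Fin n), X)) :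
    subdiv k N n (Finsupp.single σ 1) =
      real k (convex_stdSimplex ℝ (Fin n)) σ n (sdIter k (stdBary n) N n (ι k n)) := by
  simp [subdiv]

theorem subdivHomotopy_single (N n : ℕ) (σ : C(stdSimplex ℝ (Fin n), X)) :
    subdivHomotopy k N n (Finsupp.single σ 1) =
      real k (convex_stdSimplex ℝ (Fin n)) σ (n + 1)
        (sdIterHomotopy k (stdBary n) N n (ι k n)) := by
  simp [subdivHomotopy]

theorem push_affineSimplex_ι {K : Set E} (hK : Convex ℝ K) (n : ℕ) (v : Fin n → K) :
    push k (affineSimplex hK v) n (ι k n) = Finsupp.single v 1 := by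
  rw [push_single]
  congr 1
  funext j
  apply Subtype.ext
  change ∑ l, (Pi.single j (1 : ℝ) : Fin n → ℝ) l • (v l : E) = v j
  simp [Pi.single_apply]

/-- Affine maps preserve barycentres, so subdividing inside the parametrising convex set agrees with
subdividing each singular simplex in its own model. This applies in particular to the faces of a
simplex. -/
theorem subdiv_real {K : Set E} (hK : Convex ℝ K) (G : C(K, X)) (N n : ℕ) (c : LC k n K) :
    subdiv k N n (real k hK G n c) = real k hK G n (sdIter k (bary hK) N n c) := by
  refine LinearMap.congr_fun (f := subdiv k N n ∘ₗ real k hK G n)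
    (g := real k hK G n ∘ₗ sdIter k (bary hK) N n) (linearMap_ext_single fun v => ?_) c
  simp only [LinearMap.comp_apply]
  rw [real_single, subdiv_single, ← real_push k (hK := convex_stdSimplex ℝ (Fin n)) (hK' := hK) G
    (affineSimplex hK v) (preservesConvexComb_affineSimplex hK v),
    ← sdIter_push k (γ := bary hK) _ (fun n w => (preservesConvexComb_affineSimplex hK v).bary n w),
    push_affineSimplex_ι]

theorem subdivHomotopy_real {K : Set E} (hK : Convex ℝ K) (G : C(K, X)) (N n : ℕ)
    (c : LC k n K) :
    subdivHomotopy k N n (real k hK G n c) =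
      real k hK G (n + 1) (sdIterHomotopy k (bary hK) N n c) := by
  refine LinearMap.congr_fun (f := subdivHomotopy k N n ∘ₗ real k hK G n)
    (g := real k hK G (n + 1) ∘ₗ sdIterHomotopy k (bary hK) N n)
    (linearMap_ext_single fun v => ?_) c
  simp only [LinearMap.comp_apply]
  rw [real_single, subdivHomotopy_single,
    ← real_push k (hK := convex_stdSimplex ℝ (Fin n)) (hK' := hK) G
    (affineSimplex hK v) (preservesConvexComb_affineSimplex hK v),
    ← sdIterHomotopy_push k (γ := bary hK) _
      (fun n w => (preservesConvexComb_affineSimplex hK v).bary n w),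
    push_affineSimplex_ι]

theorem map_subdiv (f : C(X, Y)) (N n : ℕ) (c : SChain k n X) :
    map k f n (subdiv k N n c) = subdiv k N n (map k f n c) := by
  refine LinearMap.congr_fun (f := map k f n ∘ₗ subdiv k N n)
    (g := subdiv k N n ∘ₗ map k f n) (linearMap_ext_single fun σ => ?_) c
  simp only [LinearMap.comp_apply]
  rw [map_single, subdiv_single, subdiv_single, map_real]

theorem d_subdiv (N n : ℕ) (c : SChain k (n + 1) X) :
    d k n (subdiv k N (n + 1) c) = subdiv k N n (d k n c) := by
  refine LinearMap.congr_fun (f := d k n ∘ₗ subdiv k N (n + 1))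
    (g := subdiv k N n ∘ₗ d k n) (linearMap_ext_single fun σ => ?_) c
  simp only [LinearMap.comp_apply]
  rw [subdiv_single, d_real, bd_sdIter, ← subdiv_real, ← d_real, real_ι]

theorem d_subdivHomotopy (N n : ℕ) (c : SChain k (n + 1) X) :
    d k (n + 1) (subdivHomotopy k N (n + 1) c) =
      c - subdiv k N (n + 1) c - subdivHomotopy k N n (d k n c) := by
  refine LinearMap.congr_fun (f := d k (n + 1) ∘ₗ subdivHomotopy k N (n + 1))
    (g := LinearMap.id - subdiv k N (n + 1) - subdivHomotopy k N n ∘ₗ d k n)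
    (linearMap_ext_single fun σ => ?_) c
  simp only [LinearMap.comp_apply, LinearMap.sub_apply, LinearMap.id_apply]
  rw [subdivHomotopy_single, d_real, bd_sdIterHomotopy, map_sub, map_sub, real_ι,
    ← subdiv_real, ← subdivHomotopy_real, ← d_real, real_ι]

/-! ### The singular prism operator -/

/-- The cylinder on a standard simplex, as a convex set. -/
abbrev cyl (n : ℕ) : Set ((Fin n → ℝ) × ℝ) := stdSimplex ℝ (Fin n) ×ˢ unitInterval

theorem convex_cyl (n : ℕ) : Convex ℝ (cyl n) :=
  (convex_stdSimplex ℝ (Fin n)).prod (convex_Icc 0 1)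

/-- The points of the cylinder at a given height. -/
def cylPt (n : ℕ) (t : unitInterval) : C(stdSimplex ℝ (Fin n), cyl n) where
  toFun p := ⟨(p, t), p.2, t.2⟩
  continuous_toFun := by fun_prop

/-- A homotopy restricted to a singular simplex, as a map on the cylinder. -/
def cylMap (H : C(X × unitInterval, Y)) {n : ℕ} (σ : C(stdSimplex ℝ (Fin n), X)) :
    C(cyl n, Y) where
  toFun q := H (σ ⟨q.1.1, q.2.1⟩, ⟨q.1.2, q.2.2⟩)
  continuous_toFun := by fun_prop

/-- The chain homotopy induced by a homotopy. -/
noncomputable def prismOp (H : C(X × unitInterval, Y)) (n : ℕ) :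
    SChain k n X →ₗ[k] SChain k (n + 1) Y :=
  Finsupp.linearCombination k fun σ =>
    real k (convex_cyl n) (cylMap H σ) (n + 1) (prism k (cylPt n 0) (cylPt n 1) n (ι k n))

theorem prismOp_single (H : C(X × unitInterval, Y)) (n : ℕ) (σ : C(stdSimplex ℝ (Fin n), X)) :
    prismOp k H n (Finsupp.single σ 1) = real k (convex_cyl n) (cylMap H σ) (n + 1)
      (prism k (cylPt n 0) (cylPt n 1) n (ι k n)) := by
  simp [prismOp]

/-- A homotopy at a given time. -/
def atTime (H : C(X × unitInterval, Y)) (t : unitInterval) : C(X, Y) :=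
  ⟨fun x => H (x, t), by fun_prop⟩

theorem preservesConvexComb_cylPt (n : ℕ) (t : unitInterval) :
    PreservesConvexComb (convex_stdSimplex ℝ (Fin n)) (convex_cyl n) (cylPt n t) := by
  intro m v p
  apply Subtype.ext
  rw [affineSimplex_coe]
  apply Prod.ext
  · rw [Prod.fst_sum]
    rfl
  · rw [Prod.snd_sum]
    change (t : ℝ) = ∑ j, p j * (t : ℝ)
    rw [← Finset.sum_mul, stdSimplex.sum_eq_one, one_mul]

theorem real_cylMap_push (H : C(X × unitInterval, Y)) (n : ℕ) (t : unitInterval)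
    (σ : C(stdSimplex ℝ (Fin n), X)) :
    real k (convex_cyl n) (cylMap H σ) n (push k (cylPt n t) n (ι k n)) =
      map k (atTime H t) n (Finsupp.single σ 1) := by
  rw [real_push k (hK := convex_stdSimplex ℝ (Fin n)) (cylMap H σ)
    (cylPt n t) (preservesConvexComb_cylPt n t), real_ι, map_single]
  rfl

/-- A map of standard simplices induces a map of cylinders. -/
noncomputable def cylFace {m n : ℕ} (f : Fin m → Fin n) : C(cyl m, cyl n) where
  toFun q := cylPt n ⟨q.1.2, q.2.2⟩ (simplexMap f ⟨q.1.1, q.2.1⟩)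
  continuous_toFun := by
    refine Continuous.subtype_mk (Continuous.prodMk ?_ (by fun_prop)) _
    exact continuous_subtype_val.comp ((simplexMap f).continuous.comp (by fun_prop))

theorem preservesConvexComb_cylFace {m n : ℕ} (f : Fin m → Fin n) :
    PreservesConvexComb (convex_cyl m) (convex_cyl n) (cylFace f) := by
  intro l v p
  have h := preservesConvexComb_simplexMap f l (fun j => ⟨(v j).1.1, (v j).2.1⟩) p
  apply Subtype.ext
  rw [affineSimplex_coe]
  apply Prod.ext
  · rw [Prod.fst_sum]
    have h' := congrArg Subtype.val h
    rw [affineSimplex_coe] at h'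
    refine Eq.trans ?_ h'
    change Subtype.val (simplexMap f ⟨(∑ j, p j • (v j).1).1, _⟩) = _
    congr 2
    apply Subtype.ext
    simp only [affineSimplex_coe, Prod.fst_sum, Prod.smul_fst]
  · rw [Prod.snd_sum]
    change (∑ j, p j • (v j).1).2 = _
    rw [Prod.snd_sum]
    rfl

/-- The cylinder on a face maps affinely into the cylinder on the simplex. Hence the prism over the
singular boundary can be computed in one cylinder, where `bd_prism` applies. -/
theorem prismOp_real_bd (H : C(X × unitInterval, Y)) (n : ℕ)
    (σ : C(stdSimplex ℝ (Fin (n + 1)), X)) :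
    prismOp k H n (d k n (Finsupp.single σ 1)) =
      real k (convex_cyl (n + 1)) (cylMap H σ) (n + 1)
        (prism k (cylPt (n + 1) 0) (cylPt (n + 1) 1) n (bd k n (ι k (n + 1)))) := by
  rw [d_single, bd_single, map_sum, map_sum, map_sum]
  refine Finset.sum_congr rfl fun j _ => ?_
  rw [map_smul, map_smul, map_smul, prismOp_single]
  congr 1
  have h1 : (Finsupp.single (stdVertices (n + 1) ∘ j.succAbove) 1 : LC k n _) =
      push k (simplexMap j.succAbove) n (ι k n) := by
    rw [push_single]
    congr 1
    funext l
    exact (simplexMap_stdVertices _ _).symm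
  rw [h1, prism_push k (cylPt n 0) (cylPt n 1) (simplexMap j.succAbove) (cylFace j.succAbove)
    (fun _ => rfl) (fun _ => rfl), real_push k (hK := convex_cyl n) _ (cylFace j.succAbove)
    (preservesConvexComb_cylFace _)]
  rfl

theorem d_prismOp (H : C(X × unitInterval, Y)) (n : ℕ) (c : SChain k (n + 1) X) :
    d k (n + 1) (prismOp k H (n + 1) c) =
      map k (atTime H 1) (n + 1) c - map k (atTime H 0) (n + 1) c - prismOp k H n (d k n c) := by
  refine LinearMap.congr_fun (f := d k (n + 1) ∘ₗ prismOp k H (n + 1))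
    (g := map k (atTime H 1) (n + 1) - map k (atTime H 0) (n + 1) - prismOp k H n ∘ₗ d k n)
    (linearMap_ext_single fun σ => ?_) c
  simp only [LinearMap.comp_apply, LinearMap.sub_apply]
  rw [prismOp_single, d_real, bd_prism, map_sub, map_sub, prismOp_real_bd, real_cylMap_push,
    real_cylMap_push]

end SChain

namespace SChain

open FormalChain

/-! ### Chains supported in a subset -/

section Support

variable (k : Type*) [Field k] {X Y : Type*} [TopologicalSpace X] [TopologicalSpace Y]
variable {E : Type*} [NormedAddCommGroup E] [NormedSpace ℝ E]

/-- The singular chains whose simplices lie in a given subset. -/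
def Ch (S : Set X) (n : ℕ) : Submodule k (SChain k n X) :=
  Finsupp.supported k k {σ | ∀ p, σ p ∈ S}

variable {k}

theorem single_mem_Ch {S : Set X} {n : ℕ} {σ : C(stdSimplex ℝ (Fin n), X)} (h : ∀ p, σ p ∈ S)
    (c : k) : Finsupp.single σ c ∈ Ch k S n :=
  Finsupp.single_mem_supported k c h

theorem apply_mem_of_mem_Ch {S : Set X} {n : ℕ} {M : Type*} [AddCommGroup M] [Module k M]
    {f : SChain k n X →ₗ[k] M} {A : Submodule k M}
    (h : ∀ σ : C(stdSimplex ℝ (Fin n), X), (∀ p, σ p ∈ S) → f (Finsupp.single σ 1) ∈ A)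
    {c : SChain k n X} (hc : c ∈ Ch k S n) : f c ∈ A := by
  have : Ch k S n ≤ A.comap f := by
    rw [Ch, Finsupp.supported_eq_span_single, Submodule.span_le]
    rintro _ ⟨σ, hσ, rfl⟩
    exact h σ hσ
  exact this hc

theorem Ch_mono {S T : Set X} (h : S ⊆ T) (n : ℕ) : Ch k S n ≤ Ch k T n :=
  Finsupp.supported_mono fun _ hσ p => h (hσ p)

theorem mem_Ch_inter {S T : Set X} {n : ℕ} {c : SChain k n X} (h₁ : c ∈ Ch k S n)
    (h₂ : c ∈ Ch k T n) : c ∈ Ch k (S ∩ T) n := by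
  rw [Ch, Finsupp.mem_supported] at *
  exact fun σ hσ p => ⟨h₁ hσ p, h₂ hσ p⟩

theorem mem_Ch_univ {n : ℕ} (c : SChain k n X) : c ∈ Ch k Set.univ n := by
  rw [Ch, Finsupp.mem_supported]
  exact fun σ _ p => trivial

theorem d_mem_Ch {S : Set X} {n : ℕ} {c : SChain k (n + 1) X} (hc : c ∈ Ch k S (n + 1)) :
    d k n c ∈ Ch k S n := by
  refine apply_mem_of_mem_Ch (fun σ hσ => ?_) hc
  rw [d_single]
  exact Submodule.sum_mem _ fun j _ => Submodule.smul_mem _ _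
    (single_mem_Ch (fun p => hσ (face n j p)) _)

theorem map_mem_Ch {S : Set X} {T : Set Y} {f : C(X, Y)} (h : Set.MapsTo f S T) {n : ℕ}
    {c : SChain k n X} (hc : c ∈ Ch k S n) : map k f n c ∈ Ch k T n := by
  refine apply_mem_of_mem_Ch (fun σ hσ => ?_) hc
  rw [map_single]
  exact single_mem_Ch (fun p => h (hσ p)) _

theorem real_mem_Ch {K : Set E} (hK : Convex ℝ K) {G : C(K, X)} {S : Set X} (h : ∀ q, G q ∈ S)
    {n : ℕ} (c : LC k n K) : real k hK G n c ∈ Ch k S n := by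
  induction c using Finsupp.induction_linear with
  | zero => simp
  | add x y hx hy => rw [map_add]; exact Submodule.add_mem _ hx hy
  | single v c => rw [real_single]; exact single_mem_Ch (fun p => h _) _

theorem subdiv_mem_Ch {S : Set X} (N : ℕ) {n : ℕ} {c : SChain k n X} (hc : c ∈ Ch k S n) :
    subdiv k N n c ∈ Ch k S n := by
  refine apply_mem_of_mem_Ch (fun σ hσ => ?_) hc
  rw [subdiv_single]
  exact real_mem_Ch _ hσ _

theorem subdivHomotopy_mem_Ch {S : Set X} (N : ℕ) {n : ℕ} {c : SChain k n X}
    (hc : c ∈ Ch k S n) : subdivHomotopy k N n c ∈ Ch k S (n + 1) := by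
  refine apply_mem_of_mem_Ch (fun σ hσ => ?_) hc
  rw [subdivHomotopy_single]
  exact real_mem_Ch _ hσ _

theorem prismOp_mem_Ch {S : Set X} {T : Set Y} {H : C(X × unitInterval, Y)}
    (h : ∀ x ∈ S, ∀ t, H (x, t) ∈ T) {n : ℕ} {c : SChain k n X} (hc : c ∈ Ch k S n) :
    prismOp k H n c ∈ Ch k T (n + 1) := by
  refine apply_mem_of_mem_Ch (fun σ hσ => ?_) hc
  rw [prismOp_single]
  exact real_mem_Ch _ (fun q => h _ (hσ _) _) _

/-- Chains supported in the image of a subset under an embedding come from that subset. -/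
theorem exists_map_eq_of_mem_Ch {f : C(X, Y)} (hf : Topology.IsEmbedding f) {S : Set X} {n : ℕ}
    {c : SChain k n Y} (hc : c ∈ Ch k (f '' S) n) : ∃ c' ∈ Ch k S n, map k f n c' = c := by
  suffices h : Ch k (f '' S) n ≤ (Ch k S n).map (map k f n) by
    simpa using h hc
  rw [Ch, Finsupp.supported_eq_span_single, Submodule.span_le]
  rintro _ ⟨σ, hσ, rfl⟩
  choose τ hτS hτ using hσ
  have hcont : Continuous τ := by
    rw [hf.continuous_iff]
    convert σ.continuous using 1
    exact funext hτ
  refine ⟨Finsupp.single ⟨τ, hcont⟩ 1, single_mem_Ch hτS _, ?_⟩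
  rw [map_single]
  congr 1
  exact ContinuousMap.ext hτ

/-- Distinct simplices have distinct images under an injective map, so no cancellation can hide a
simplex that leaves the preimage. -/
theorem mem_Ch_of_map_mem_Ch {f : C(X, Y)} (hf : Function.Injective f) {S : Set Y} {n : ℕ}
    {c : SChain k n X} (hc : map k f n c ∈ Ch k S n) : c ∈ Ch k (f ⁻¹' S) n := by
  classical
  rw [Ch, Finsupp.mem_supported] at *
  intro σ hσ p
  have hinj : Function.Injective fun σ : C(stdSimplex ℝ (Fin n), X) => f.comp σ := by
    intro σ τ h
    ext p
    exact hf (DFunLike.congr_fun h p)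
  refine hc (a := f.comp σ) ?_ p
  rw [Finset.mem_coe, Finsupp.mem_support_iff] at hσ ⊢
  change Finsupp.mapDomain _ c _ ≠ 0
  rwa [Finsupp.mapDomain_apply hinj]

end Support

/-! ### Small simplices -/

section Small

variable {k : Type*} [Field k] {X : Type*} [TopologicalSpace X]
variable {E : Type*} [NormedAddCommGroup E] [NormedSpace ℝ E]

/-- The difference between a vertex and the barycentre is the mean of its differences with the `n +
1` vertices, one of which is zero. This gives the factor `n / (n + 1)`. -/
theorem dist_bary_le {K : Set E} (hK : Convex ℝ K) {n : ℕ} (v : Fin (n + 1) → K) {δ : ℝ}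
    (hv : ∀ i j, dist (v i) (v j) ≤ δ) (j : Fin (n + 1)) :
    dist (v j) (bary hK n v) ≤ n / (n + 1) * δ := by
  have hb : (bary hK n v : E) = ∑ l, (1 / (n + 1 : ℝ)) • (v l : E) := by
    rw [bary, affineSimplex_coe]
    refine Finset.sum_congr rfl fun l _ => ?_
    congr 1
    change (Fintype.card (Fin (n + 1)) : ℝ)⁻¹ = _
    simp
  have hn : (0 : ℝ) < n + 1 := by positivity
  have h1 : (v j : E) - bary hK n v = ∑ l, (1 / (n + 1 : ℝ)) • ((v j : E) - v l) := by
    rw [hb]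
    simp only [smul_sub, Finset.sum_sub_distrib, Finset.sum_const, Finset.card_univ,
      Fintype.card_fin]
    congr 1
    rw [← Nat.cast_smul_eq_nsmul ℝ, smul_smul]
    push_cast
    rw [mul_one_div_cancel hn.ne', one_smul]
  rw [Subtype.dist_eq, dist_eq_norm, h1]
  refine (norm_sum_le _ _).trans ?_
  have h2 : ∀ l, ‖(1 / (n + 1 : ℝ)) • ((v j : E) - v l)‖ ≤
      if l = j then 0 else 1 / (n + 1 : ℝ) * δ := by
    intro l
    split_ifs with h
    · simp [h]
    · rw [norm_smul, Real.norm_of_nonneg (by positivity), ← dist_eq_norm]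
      exact mul_le_mul_of_nonneg_left (hv j l) (by positivity)
  refine (Finset.sum_le_sum fun l _ => h2 l).trans (le_of_eq ?_)
  rw [Finset.sum_ite, Finset.sum_const_zero, zero_add, Finset.sum_const,
    Finset.filter_ne' , Finset.card_erase_of_mem (Finset.mem_univ j), Finset.card_univ,
    Fintype.card_fin, nsmul_eq_mul]
  simp
  ring

/-- The tuples which lie in a given set and have diameter at most `δ`. -/
def smallTuples {K : Set E} (C : Set E) (δ : ℝ) (n : ℕ) : Set (Fin n → K) :=
  {w | (∀ j, (w j : E) ∈ C) ∧ ∀ i j, dist (w i) (w j) ≤ δ}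

/-- The convex set `C` strengthens the induction: the faces lie in the ball of radius `M / (M + 1) *
δ` about the barycentre, so by convexity do their subdivisions, and coning with the barycentre keeps
the diameter below that bound. The number `M` gives one contraction factor for all dimensions
involved. -/
theorem sd_mem_smallTuples {K : Set E} (hK : Convex ℝ K) (M n : ℕ) (hn : n ≤ M + 1) {δ : ℝ}
    (hδ : 0 ≤ δ) {C : Set E} (hC : Convex ℝ C) {v : Fin n → K} (hv : v ∈ smallTuples C δ n) :
    sd k (bary hK) n (Finsupp.single v 1) ∈
      Finsupp.supported k k (smallTuples (K := K) C (M / (M + 1) * δ) n) := by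
  induction n generalizing C with
  | zero =>
    exact Finsupp.single_mem_supported k _ ⟨fun j => j.elim0, fun j => j.elim0⟩
  | succ n ih =>
    have hρ : (n : ℝ) / (n + 1) * δ ≤ M / (M + 1) * δ := by
      refine mul_le_mul_of_nonneg_right ?_ hδ
      rw [div_le_div_iff₀ (by positivity) (by positivity)]
      have : (n : ℝ) ≤ M := by exact_mod_cast Nat.le_of_succ_le_succ hn
      nlinarith
    have hd : ∀ j, dist (v j) (bary hK n v) ≤ M / (M + 1) * δ := fun j =>
      (dist_bary_le hK v hv.2 j).trans hρ
    set C' := C ∩ Metric.closedBall (bary hK n v : E) (M / (M + 1) * δ) with hC'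
    have hC'c : Convex ℝ C' := hC.inter (convex_closedBall _ _)
    have hbC : (bary hK n v : E) ∈ C :=
      hC.sum_mem (fun j _ => (stdSimplex.barycenter (𝕜 := ℝ) (X := Fin (n + 1))).2.1 j)
        (stdSimplex.barycenter (𝕜 := ℝ) (X := Fin (n + 1))).2.2 (fun j _ => hv.1 j)
    have key : sd k (bary hK) n (bd k n (Finsupp.single v 1)) ∈
        Finsupp.supported k k (smallTuples (K := K) C' (M / (M + 1) * δ) n) := by
      rw [bd_single, map_sum]
      refine Submodule.sum_mem _ fun j _ => ?_
      rw [map_smul]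
      refine Submodule.smul_mem _ _ (ih (Nat.le_of_succ_le hn) hC'c ⟨fun l => ⟨hv.1 _, ?_⟩,
        fun _ _ => hv.2 _ _⟩)
      exact hd _
    rw [sd_succ_single]
    have h2 : Finsupp.supported k k (smallTuples (K := K) C' (M / (M + 1) * δ) n) ≤
        (Finsupp.supported k k (smallTuples (K := K) C (M / (M + 1) * δ) (n + 1))).comap
          (cone k (bary hK n v) n) := by
      rw [Finsupp.supported_eq_span_single, Submodule.span_le]
      rintro _ ⟨w, hw, rfl⟩
      rw [SetLike.mem_coe, Submodule.mem_comap, cone_single]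
      refine Finsupp.single_mem_supported k _ ⟨fun j => ?_, fun i j => ?_⟩
      · refine Fin.cases ?_ (fun j => ?_) j
        · exact hbC
        · exact (hw.1 j).1
      · refine Fin.cases ?_ (fun i => ?_) i <;> refine Fin.cases ?_ (fun j => ?_) j
        · simp only [Fin.cons_zero, dist_self]
          positivity
        · simp only [Fin.cons_zero, Fin.cons_succ]
          rw [dist_comm]
          exact (hw.1 j).2
        · simp only [Fin.cons_zero, Fin.cons_succ]
          exact (hw.1 i).2
        · simp only [Fin.cons_succ]
          exact hw.2 i j
    exact h2 key

theorem sdIter_mem_smallTuples {K : Set E} (hK : Convex ℝ K) (N n : ℕ) {δ : ℝ}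
    (hδ : 0 ≤ δ) {v : Fin n → K} (hv : ∀ i j, dist (v i) (v j) ≤ δ) :
    sdIter k (bary hK) N n (Finsupp.single v 1) ∈
      Finsupp.supported k k
        (smallTuples (K := K) Set.univ ((n / (n + 1) : ℝ) ^ N * δ) n) := by
  induction N with
  | zero =>
    simp only [sdIter, pow_zero, Module.End.one_apply, one_mul]
    exact Finsupp.single_mem_supported k _ ⟨fun _ => trivial, hv⟩
  | succ N ih =>
    rw [sdIter_succ]
    have h2 : Finsupp.supported k k
        (smallTuples (K := K) Set.univ ((n / (n + 1) : ℝ) ^ N * δ) n) ≤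
        (Finsupp.supported k k (smallTuples (K := K) Set.univ
          ((n / (n + 1) : ℝ) ^ (N + 1) * δ) n)).comap (sd k (bary hK) n) := by
      rw [Finsupp.supported_eq_span_single, Submodule.span_le]
      rintro _ ⟨w, hw, rfl⟩
      rw [SetLike.mem_coe, Submodule.mem_comap, pow_succ', mul_assoc]
      exact sd_mem_smallTuples hK n n (Nat.le_succ n) (by positivity) convex_univ hw
    exact h2 ih

/-- A Lebesgue number for the preimages of `P` and `Q` is beaten by the geometric decay of
diameters. Allowing all `N ≥ N₀` lets the finitely many simplices of a chain share one `N`. -/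
theorem subdiv_single_small {S P Q : Set X} (hP : IsOpen P) (hQ : IsOpen Q) (hS : S ⊆ P ∪ Q)
    {n : ℕ} {σ : C(stdSimplex ℝ (Fin n), X)} (hσ : ∀ p, σ p ∈ S) :
    ∃ N₀, ∀ N ≥ N₀, subdiv k N n (Finsupp.single σ 1) ∈ Ch k (S ∩ P) n ⊔ Ch k (S ∩ Q) n := by
  obtain ⟨δ, hδ, hball⟩ := lebesgue_number_lemma_of_metric (ι := Bool)
    (c := fun b => σ ⁻¹' (if b then P else Q)) (s := Set.univ) isCompact_univ
    (fun b => by cases b <;> simp [hP.preimage σ.continuous, hQ.preimage σ.continuous])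
    (fun p _ => by
      rcases hS (hσ p) with h | h
      · exact Set.mem_iUnion.2 ⟨true, by simpa using h⟩
      · exact Set.mem_iUnion.2 ⟨false, by simpa using h⟩)
  obtain ⟨N₀, hN₀⟩ := exists_pow_lt_of_lt_one hδ
    (show (n / (n + 1) : ℝ) < 1 by rw [div_lt_one (by positivity)]; linarith)
  refine ⟨N₀, fun N hN => ?_⟩
  rw [subdiv_single]
  have hsmall := sdIter_mem_smallTuples (k := k) (convex_stdSimplex ℝ (Fin n)) N n zero_le_one
    (v := stdVertices n) (fun i j => by
      rw [Subtype.dist_eq]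
      exact (Metric.dist_le_diam_of_mem (bounded_stdSimplex _) (stdVertices n i).2
        (stdVertices n j).2).trans diam_stdSimplex_le)
  rw [mul_one] at hsmall
  have h2 : Finsupp.supported k k (smallTuples (K := stdSimplex ℝ (Fin n)) Set.univ
      ((n / (n + 1) : ℝ) ^ N) n) ≤ (Ch k (S ∩ P) n ⊔ Ch k (S ∩ Q) n).comap
        (real k (convex_stdSimplex ℝ (Fin n)) σ n) := by
    rw [Finsupp.supported_eq_span_single, Submodule.span_le]
    rintro _ ⟨w, hw, rfl⟩
    rw [SetLike.mem_coe, Submodule.mem_comap, real_single]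
    cases n with
    | zero =>
      refine Submodule.mem_sup_left (single_mem_Ch (fun p => ?_) _)
      -- The simplex without vertices is empty, since the empty sum of coordinates is not `1`.
      exact absurd p.2.2 (by simp)
    | succ n =>
      have hin : ∀ p, affineSimplex (convex_stdSimplex ℝ (Fin (n + 1))) w p ∈
          Metric.ball (w 0) δ := by
        intro p
        refine Metric.closedBall_subset_ball (lt_of_le_of_lt (pow_le_pow_of_le_one
          (by positivity) ?_ hN) hN₀) ?_
        · rw [div_le_one (by positivity)]; linarith
        · exact (convex_closedBall (w 0 : Fin (n + 1) → ℝ) _).sum_mem (fun j _ => p.2.1 j) p.2.2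
            (fun j _ => hw.2 j 0)
      obtain ⟨b, hb⟩ := hball (w 0) trivial
      cases b
      · exact Submodule.mem_sup_right
          (single_mem_Ch (S := S ∩ Q)
          (σ := σ.comp (affineSimplex _ w)) (fun p => ⟨hσ _, by simpa using hb (hin p)⟩) _)
      · exact Submodule.mem_sup_left
          (single_mem_Ch (S := S ∩ P)
          (σ := σ.comp (affineSimplex _ w)) (fun p => ⟨hσ _, by simpa using hb (hin p)⟩) _)
  exact h2 hsmall

/-- The theorem of small simplices, for a cover by two open sets. -/
theorem exists_subdiv_mem {S P Q : Set X} (hP : IsOpen P) (hQ : IsOpen Q) (hS : S ⊆ P ∪ Q)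
    {n : ℕ} {c : SChain k n X} (hc : c ∈ Ch k S n) :
    ∃ N, ∃ a ∈ Ch k (S ∩ P) n, ∃ b ∈ Ch k (S ∩ Q) n, subdiv k N n c = a + b := by
  classical
  rw [Ch, Finsupp.mem_supported] at hc
  have h : ∀ σ : C(stdSimplex ℝ (Fin n), X), ∃ N₀, σ ∈ c.support → ∀ N ≥ N₀,
      subdiv k N n (Finsupp.single σ 1) ∈ Ch k (S ∩ P) n ⊔ Ch k (S ∩ Q) n := by
    intro σ
    by_cases hσ : σ ∈ c.support
    · obtain ⟨N₀, h⟩ := subdiv_single_small (k := k) hP hQ hS (hc hσ)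
      exact ⟨N₀, fun _ => h⟩
    · exact ⟨0, fun h => absurd h hσ⟩
  choose N₀ hN₀ using h
  refine ⟨c.support.sup N₀, ?_⟩
  have hmem : subdiv k (c.support.sup N₀) n c ∈ Ch k (S ∩ P) n ⊔ Ch k (S ∩ Q) n := by
    rw [show subdiv k (c.support.sup N₀) n c = subdiv k (c.support.sup N₀) n (c.sum Finsupp.single)
      by rw [Finsupp.sum_single], Finsupp.sum, map_sum]
    refine Submodule.sum_mem _ fun σ hσ => ?_
    rw [← mul_one (c σ), ← smul_eq_mul, ← Finsupp.smul_single, map_smul]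
    exact Submodule.smul_mem _ _ (hN₀ σ hσ _ (Finset.le_sup hσ))
  obtain ⟨a, ha, b, hb, hab⟩ := Submodule.mem_sup.1 hmem
  exact ⟨a, ha, b, hb, hab.symm⟩

end Small

/-! ### Contractions -/

section Contraction

variable {k : Type*} [Field k] {X : Type*} [TopologicalSpace X]

theorem d_const (e : X) (n : ℕ) :
    d k n (Finsupp.single (ContinuousMap.const _ e) 1) =
      if Even n then Finsupp.single (ContinuousMap.const _ e) 1 else 0 := by
  have h : ∀ j : Fin (n + 1), (ContinuousMap.const (stdSimplex ℝ (Fin (n + 1))) e).comp (face n j) =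
    ContinuousMap.const _ e := fun j => rfl
  rw [d_single]
  simp only [h]
  rw [← Finset.sum_smul, Fin.sum_univ_eq_sum_range (fun j => (-1 : k) ^ j), neg_one_geom_sum]
  simp only [Nat.even_add_one, ite_not]
  split_ifs with h <;> simp

theorem map_const_eq (e : X) (n : ℕ) (c : SChain k n X) :
    map k (ContinuousMap.const X e) n c =
      (Finsupp.linearCombination k (fun _ => (1 : k)) c) •
        Finsupp.single (ContinuousMap.const _ e) 1 := by
  refine LinearMap.congr_fun (f := map k (ContinuousMap.const X e) n)
    (g := (Finsupp.linearCombination k (fun _ => (1 : k))).smulRight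
      (Finsupp.single (ContinuousMap.const _ e) (1 : k)))
    (linearMap_ext_single fun σ => ?_) c
  rw [map_single, LinearMap.smulRight_apply, Finsupp.linearCombination_single, one_smul, one_smul]
  rfl

/-- Cycles in a set which contracts to one of its points are boundaries. -/
theorem exists_d_eq_of_contraction {S : Set X} (H : C(X × unitInterval, X)) (e : X) (he : e ∈ S)
    (h0 : ∀ x, H (x, 0) = x) (h1 : ∀ x, H (x, 1) = e) (hS : ∀ x ∈ S, ∀ t, H (x, t) ∈ S)
    {n : ℕ} {c : SChain k (n + 1) X} (hc : c ∈ Ch k S (n + 1)) (hd : d k n c = 0) :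
    ∃ w ∈ Ch k S (n + 2), d k (n + 1) w = c := by
  have hP := d_prismOp k H n c
  have e1 : atTime H 1 = ContinuousMap.const X e := ContinuousMap.ext h1
  have e0 : atTime H 0 = ContinuousMap.id X := ContinuousMap.ext h0
  rw [hd, map_zero, sub_zero, e1, e0, map_id, map_const_eq] at hP
  have hcyc : d k n (map k (ContinuousMap.const X e) (n + 1) c) = 0 := by
    rw [d_map, hd, map_zero]
  rw [map_const_eq, map_smul, d_const] at hcyc
  set ε := Finsupp.linearCombination k (fun _ => (1 : k)) c with hε
  have hPm := prismOp_mem_Ch hS hc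
  -- The prism shows that `c` is homologous to `ε` times a constant simplex. For even `n` the
  -- constant simplex has nonzero boundary, so the cycle condition forces `ε = 0`; for odd `n` it is
  -- itself the boundary of the next constant simplex.
  by_cases hn : Even n
  · have hne : (Finsupp.single (ContinuousMap.const (stdSimplex ℝ (Fin n)) e) (1 : k)) ≠ 0 := by
      simp
    rw [if_pos hn, smul_eq_zero, or_iff_left hne] at hcyc
    rw [hcyc, zero_smul, zero_sub] at hP
    exact ⟨-prismOp k H (n + 1) c, Submodule.neg_mem _ hPm, by rw [map_neg, hP, neg_neg]⟩
  · refine ⟨ε • Finsupp.single (ContinuousMap.const _ e) 1 - prismOp k H (n + 1) c,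
      Submodule.sub_mem _ (Submodule.smul_mem _ _ (single_mem_Ch (fun _ => he) _)) hPm, ?_⟩
    rw [map_sub, map_smul, d_const, if_pos (Nat.even_add_one.2 hn), hP, sub_sub_cancel]

theorem exists_d_eq_of_starConvex {E : Type*} [NormedAddCommGroup E] [NormedSpace ℝ E]
    {S : Set E} {e : E} (hS : StarConvex ℝ e S) (he : e ∈ S)
    {n : ℕ} {c : SChain k (n + 1) E} (hc : c ∈ Ch k S (n + 1)) (hd : d k n c = 0) :
    ∃ w ∈ Ch k S (n + 2), d k (n + 1) w = c := by
  refine exists_d_eq_of_contraction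
    ⟨fun q => (q.2 : ℝ) • e + (1 - (q.2 : ℝ)) • q.1, by fun_prop⟩ e he ?_ ?_ ?_ hc hd
  · intro x; simp
  · intro x; simp
  · intro x hx t
    exact hS hx t.2.1 (by linarith [t.2.2]) (by ring)

end Contraction

end SChain

namespace SChain

open FormalChain

theorem Ch_weaken {k : Type*} [Field k] {X : Type*} [TopologicalSpace X] {S T : Set X} {n : ℕ}
    {c : SChain k n X} (hc : c ∈ Ch k S n) (h : ∀ x, x ∈ S → x ∈ T) : c ∈ Ch k T n :=
  Ch_mono h n hc

/-! ### The local homology of a simplex -/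

section Sphere

variable {k : Type*} [Field k] {E : Type*} [NormedAddCommGroup E] [NormedSpace ℝ E]

/-- The affine singular simplex with given vertices. -/
noncomputable def aff {n : ℕ} (v : Fin n → E) : C(stdSimplex ℝ (Fin n), E) where
  toFun p := ∑ j, p j • v j
  continuous_toFun := continuous_finsetSum _ fun j _ =>
    ((continuous_apply j).comp continuous_subtype_val).smul continuous_const

theorem aff_comp_simplexMap {m n : ℕ} (v : Fin n → E) (f : Fin m → Fin n) :
    (aff v).comp (simplexMap f) = aff (v ∘ f) :=
  ContinuousMap.ext fun p => simplexMap_sum f p v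

theorem aff_mem {C : Set E} (hC : Convex ℝ C) {n : ℕ} {v : Fin n → E} (hv : ∀ j, v j ∈ C)
    (p : stdSimplex ℝ (Fin n)) : aff v p ∈ C :=
  hC.sum_mem (fun j _ => p.2.1 j) p.2.2 (fun j _ => hv j)

theorem d_aff {n : ℕ} (v : Fin (n + 1) → E) :
    d k n (Finsupp.single (aff v) 1) =
      ∑ j : Fin (n + 1), (-1 : k) ^ (j : ℕ) • Finsupp.single (aff (v ∘ j.succAbove)) 1 := by
  rw [d_single]
  simp only [aff_comp_simplexMap]

variable (k) in
/-- The affine simplex with given vertices, as a chain with `m` vertices; zero if the number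
of vertices is not `m`. -/
noncomputable def affChain {n : ℕ} (v : Fin n → E) (m : ℕ) : SChain k m E :=
  if h : m = n then Finsupp.single (aff (v ∘ Fin.cast h)) 1 else 0

theorem affChain_self {n : ℕ} (v : Fin n → E) :
    affChain k v n = Finsupp.single (aff v) 1 := by
  simp [affChain]

theorem affChain_of_ne {n : ℕ} (v : Fin n → E) {m : ℕ} (h : m ≠ n) : affChain k v m = 0 := by
  simp [affChain, h]

/-- Convex open sets `W l` and points `v l` of a convex set such that `v j` lies in `W l` for
all `l ≠ j`. -/
structure FaceCover (D : Set E) {n : ℕ} (W : Fin n → Set E) (v : Fin n → E) : Prop where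
  convex : Convex ℝ D
  isOpen : ∀ l, IsOpen (W l)
  convexW : ∀ l, Convex ℝ (W l)
  mem : ∀ j, v j ∈ D
  memW : ∀ j l, l ≠ j → v j ∈ W l

variable {D : Set E} {n : ℕ}

/-- The inductive step of both theorems on face covers: all vertices but the last lie in the last
set, so they form a face cover of its intersection with `D`. -/
theorem FaceCover.init {W : Fin (n + 1) → Set E} {v : Fin (n + 1) → E} (h : FaceCover D W v) :
    FaceCover (D ∩ W (Fin.last n)) (W ∘ Fin.castSucc) (v ∘ Fin.castSucc) where
  convex := h.convex.inter (h.convexW _)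
  isOpen _ := h.isOpen _
  convexW _ := h.convexW _
  mem j := ⟨h.mem _, h.memW _ _ (Fin.castSucc_lt_last j).ne'⟩
  memW _ _ hl := h.memW _ _ fun e => hl (Fin.castSucc_injective n e)

/-- The last vertex lies in each of the other sets, so their union is star-shaped about it and has
no reduced homology. -/
theorem FaceCover.starConvex {W : Fin (n + 1) → Set E} {v : Fin (n + 1) → E}
    (h : FaceCover D W v) :
    StarConvex ℝ (v (Fin.last n)) (D ∩ ⋃ l, (W ∘ Fin.castSucc) l) := by
  rintro x ⟨hxD, hx⟩ a b ha hb hab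
  obtain ⟨l, hl⟩ := Set.mem_iUnion.1 hx
  exact ⟨h.convex (h.mem _) hxD ha hb hab, Set.mem_iUnion.2 ⟨l,
    h.convexW _ (h.memW _ _ (Fin.castSucc_lt_last l).ne) hl ha hb hab⟩⟩

theorem FaceCover.face_mem {W : Fin (n + 1) → Set E} {v : Fin (n + 1) → E}
    (h : FaceCover D W v) (j : Fin (n + 1)) :
    Finsupp.single (aff (v ∘ j.succAbove)) (1 : k) ∈ Ch k (D ∩ W j) n :=
  single_mem_Ch (aff_mem (h.convex.inter (h.convexW j)) fun l =>
    ⟨h.mem _, h.memW _ _ (Fin.succAbove_ne j l).symm⟩) _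

theorem iUnion_eq_castSucc_union_last {E : Type*} (W : Fin (n + 1) → Set E) :
    (⋃ l, W l) = (⋃ l, (W ∘ Fin.castSucc) l) ∪ W (Fin.last n) := by
  ext x
  simp only [Set.mem_iUnion, Set.mem_union, Function.comp_apply]
  constructor
  · rintro ⟨l, hl⟩
    refine Fin.lastCases (fun h => Or.inr h) (fun l h => Or.inl ⟨l, h⟩) l hl
  · rintro (⟨l, hl⟩ | h)
    · exact ⟨_, hl⟩
    · exact ⟨_, h⟩

/-- Up to a chain in the union of the first `n` sets, the boundary of the affine simplex is its
last face. -/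
theorem FaceCover.d_aff_sub_mem {W : Fin (n + 1) → Set E} {v : Fin (n + 1) → E}
    (h : FaceCover D W v) :
    Finsupp.single (aff (v ∘ Fin.castSucc)) (1 : k) -
      d k n ((-1 : k) ^ n • Finsupp.single (aff v) 1) ∈
        Ch k (D ∩ ⋃ l, (W ∘ Fin.castSucc) l) n := by
  rw [map_smul, d_aff, Fin.sum_univ_castSucc, smul_add, smul_smul]
  have h1 : (Fin.last n).succAbove = Fin.castSucc := by
    funext l; exact Fin.succAbove_last_apply l
  rw [h1, Fin.val_last, ← pow_add, Even.neg_one_pow ⟨n, rfl⟩, one_smul, sub_add_eq_sub_sub,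
    sub_right_comm, sub_self, zero_sub]
  refine Submodule.neg_mem _ (Submodule.smul_mem _ _ (Submodule.sum_mem _ fun j _ =>
    Submodule.smul_mem _ _ (Ch_mono ?_ _ (h.face_mem _))))
  exact Set.inter_subset_inter_right _ (Set.subset_iUnion (W ∘ Fin.castSucc) j)

theorem subsingleton_zero {X : Type*} [TopologicalSpace X] :
    Subsingleton C(stdSimplex ℝ (Fin 0), X) :=
  ⟨fun σ τ => ContinuousMap.ext fun p => absurd p.2.2 (by simp)⟩

/-- There is one map from the empty simplex, so `d k 0` is the augmentation with values in a line; a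
multiple of any point corrects it to zero. -/
theorem d_zero_eq {X : Type*} [TopologicalSpace X] (z : SChain k 1 X)
    (σ : C(stdSimplex ℝ (Fin 1), X)) :
    ∃ a : k, d k 0 (z - a • Finsupp.single σ 1) = 0 := by
  have := subsingleton_zero (X := X)
  have hσ : d k 0 (Finsupp.single σ (1 : k)) = Finsupp.single (σ.comp (face 0 0)) 1 := by
    rw [d_single, Fin.sum_univ_succ]
    simp
  refine ⟨d k 0 z (σ.comp (face 0 0)), ?_⟩
  rw [map_sub, map_smul, hσ]
  ext τ
  rw [Subsingleton.elim τ (σ.comp (face 0 0))]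
  simp

theorem affChain_mem_Ch {C : Set E} (hC : Convex ℝ C) {v : Fin n → E} (hv : ∀ j, v j ∈ C)
    (m : ℕ) : affChain k v m ∈ Ch k C m := by
  rw [affChain]
  split_ifs with h
  · exact single_mem_Ch (aff_mem hC fun j => hv _) _
  · exact Submodule.zero_mem _

/-- The relative homology of `D` modulo the union of the sets of a face cover is generated by the
affine simplex. -/
theorem FaceCover.exists_decomposition {W : Fin n → Set E} {v : Fin n → E}
    (h : FaceCover D W v) {m : ℕ} (hm : m + 1 ≤ n) {z : SChain k (m + 1) E}
    (hz : z ∈ Ch k D (m + 1)) (hdz : d k m z ∈ Ch k (D ∩ ⋃ l, W l) m) :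
    ∃ y ∈ Ch k (D ∩ ⋃ l, W l) (m + 1), ∃ a : k, ∃ w ∈ Ch k D (m + 2),
      z = y + a • affChain k v (m + 1) + d k (m + 1) w := by
  induction n generalizing D m with
  | zero => omega
  | succ n ih =>
    have hstarD : StarConvex ℝ (v (Fin.last n)) D := h.convex.starConvex (h.mem _)
    cases m with
    | zero =>
      -- A `0`-chain in the convex set `D` is homologous to a multiple of the last vertex. If there
      -- is only one vertex, this is the affine simplex itself; otherwise the last vertex already
      -- lies in `W 0`.
      obtain ⟨a, ha⟩ := d_zero_eq z (aff (fun _ => v (Fin.last n)))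
      have hmem : Finsupp.single (aff fun _ => v (Fin.last n)) (1 : k) ∈ Ch k D 1 :=
        single_mem_Ch (aff_mem h.convex fun _ => h.mem _) _
      obtain ⟨w, hw, hdw⟩ := exists_d_eq_of_starConvex hstarD (h.mem _)
        (Submodule.sub_mem _ hz (Submodule.smul_mem _ a hmem)) ha
      cases n with
      | zero =>
        refine ⟨0, Submodule.zero_mem _, a, w, hw, ?_⟩
        rw [affChain_self, hdw, show v = fun _ => v (Fin.last 0) from funext fun j => by
          rw [Fin.fin_one_eq_zero j]; rfl]
        simp
      | succ n =>
        refine ⟨a • Finsupp.single (aff fun _ => v (Fin.last (n + 1))) 1,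
          Submodule.smul_mem _ _ ?_, 0, w, hw, by rw [hdw]; simp⟩
        refine Ch_mono (Set.inter_subset_inter_right _ (Set.subset_iUnion W 0)) _
          (single_mem_Ch (aff_mem (h.convex.inter (h.convexW 0)) fun _ => ⟨h.mem _, h.memW _ _ ?_⟩) _)
        exact (Fin.last_pos).ne
    | succ m =>
      have hm' : m + 1 ≤ n := by omega
      rw [iUnion_eq_castSucc_union_last] at hdz ⊢
      set U := ⋃ l, (W ∘ Fin.castSucc) l with hU
      set V := W (Fin.last n) with hV
      have hUo : IsOpen U := isOpen_iUnion fun l => h.isOpen _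
      have hUmem : v (Fin.last n) ∈ D ∩ U := ⟨h.mem _, Set.mem_iUnion.2 ⟨⟨0, by omega⟩,
        h.memW _ _ (Fin.castSucc_lt_last _).ne⟩⟩
      -- A Mayer–Vietoris argument for `U` and `V`: after subdivision the boundary splits as `u₁ +
      -- v₁`, and the boundary of `v₁` lies in both sets.
      obtain ⟨N, u₁, hu, v₁, hv, huv⟩ := exists_subdiv_mem hUo (h.isOpen (Fin.last n))
        (Set.inter_subset_right) hdz
      have hu' : u₁ ∈ Ch k (D ∩ U) _ := Ch_weaken hu fun x hx => ⟨hx.1.1, hx.2⟩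
      have hv' : v₁ ∈ Ch k (D ∩ V) _ := Ch_weaken hv fun x hx => ⟨hx.1.1, hx.2⟩
      have hsum : d k (m + 1) (subdiv k N (m + 2) z) = u₁ + v₁ := by rw [d_subdiv, huv]
      have hdv : d k m v₁ = - d k m u₁ := by
        have := d_d k m (subdiv k N (m + 2) z)
        rw [hsum, map_add] at this
        exact eq_neg_of_add_eq_zero_right this
      have hdv' : d k m v₁ ∈ Ch k ((D ∩ V) ∩ U) m := by
        refine Ch_weaken (mem_Ch_inter (d_mem_Ch hv') (?_ :
          d k m v₁ ∈ Ch k (D ∩ U) m)) fun x hx => ⟨hx.1, hx.2.2⟩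
        rw [hdv]
        exact Submodule.neg_mem _ (d_mem_Ch hu')
      -- The chain `v₁` is a relative cycle for the face cover of the first `n` vertices, one
      -- dimension lower.
      obtain ⟨y, hy, a, w, hw, hv₁⟩ := ih h.init hm' hv' hdv'
      -- The simplex on the first `n` vertices is, modulo chains in `U`, the boundary of the whole
      -- simplex up to sign. In the wrong dimension both affine chains vanish, and `c = 0` serves.
      obtain ⟨c, hc⟩ : ∃ c : k, affChain k (v ∘ Fin.castSucc) (m + 1) -
          d k (m + 1) (c • affChain k v (m + 2)) ∈ Ch k (D ∩ U) (m + 1) := by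
        by_cases hmn : m + 1 = n
        · subst hmn
          refine ⟨(-1) ^ (m + 1), ?_⟩
          rw [affChain_self, affChain_self]
          exact h.d_aff_sub_mem
        · refine ⟨0, ?_⟩
          rw [affChain_of_ne _ hmn]
          simp
      have hAD : affChain k v (m + 2) ∈ Ch k D (m + 2) := affChain_mem_Ch h.convex h.mem _
      have hw' : w ∈ Ch k D (m + 2) := Ch_mono Set.inter_subset_left _ hw
      -- After these corrections the boundary of `x` lies in the star-shaped set `D ∩ U`, where it
      -- is filled by `t`; then `x - t` is a cycle in the convex set `D` and bounds `s`.
      set x := subdiv k N (m + 2) z - a • c • affChain k v (m + 2) - w with hx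
      have hxD : x ∈ Ch k D (m + 2) := Submodule.sub_mem _ (Submodule.sub_mem _
        (subdiv_mem_Ch N hz) (Submodule.smul_mem _ _ (Submodule.smul_mem _ _ hAD))) hw'
      have hdx : d k (m + 1) x ∈ Ch k (D ∩ U) (m + 1) := by
        have : d k (m + 1) x = u₁ + y + a • (affChain k (v ∘ Fin.castSucc) (m + 1) -
            d k (m + 1) (c • affChain k v (m + 2))) := by
          rw [hx, map_sub, map_sub, hsum, hv₁, smul_sub, map_smul _ a]
          abel
        rw [this]
        exact Submodule.add_mem _ (Submodule.add_mem _ hu'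
          (Ch_weaken hy fun x hx => ⟨hx.1.1, hx.2⟩)) (Submodule.smul_mem _ _ hc)
      obtain ⟨t, ht, hdt⟩ := exists_d_eq_of_starConvex h.starConvex hUmem hdx (d_d k _ _)
      obtain ⟨s, hs, hds⟩ := exists_d_eq_of_starConvex hstarD (h.mem _)
        (Submodule.sub_mem _ hxD (Ch_mono Set.inter_subset_left _ ht))
        (by rw [map_sub, hdt, sub_self])
      -- The two homotopy terms undo the subdivision of `z`; the one applied to the boundary of `z`
      -- stays in the union.
      refine ⟨w + t + subdivHomotopy k N _ (d k (m + 1) z), ?_, a * c,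
        s + subdivHomotopy k N _ z, ?_, ?_⟩
      · refine Submodule.add_mem _ (Submodule.add_mem _ (Ch_mono ?_ _ hw) (Ch_mono ?_ _ ht))
          (subdivHomotopy_mem_Ch N hdz)
        · exact fun x hx => ⟨hx.1, Or.inr hx.2⟩
        · exact fun x hx => ⟨hx.1, Or.inl hx.2⟩
      · exact Submodule.add_mem _ hs (subdivHomotopy_mem_Ch N hz)
      · rw [map_add, hds, d_subdivHomotopy, hx, mul_smul]
        abel

/-- The boundary of the affine simplex of a face cover with empty total intersection is
nontrivial in the homology of the union. -/
theorem FaceCover.eq_zero_of_d_eq {W : Fin (n + 1) → Set E} {v : Fin (n + 1) → E}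
    (h : FaceCover D W v) (hD : ∀ x ∈ D, ∃ l, x ∉ W l) {a : k} {w : SChain k (n + 1) E}
    (hw : w ∈ Ch k (D ∩ ⋃ l, W l) (n + 1))
    (hdw : a • d k n (Finsupp.single (aff v) 1) = d k n w) : a = 0 := by
  induction n generalizing D a with
  | zero =>
    -- With a single set the hypothesis `hD` makes `D ∩ W 0` empty, so it carries no point.
    have hw0 : w = 0 := by
      rw [Ch, Finsupp.mem_supported] at hw
      rw [← Finsupp.support_eq_empty, Finset.eq_empty_iff_forall_notMem]
      intro σ hσ
      obtain ⟨h1, h2⟩ := hw hσ (stdVertices 1 0)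
      obtain ⟨l, hl⟩ := hD _ h1
      obtain ⟨l', hl'⟩ := Set.mem_iUnion.1 h2
      rw [show l' = l from (Fin.fin_one_eq_zero l').trans (Fin.fin_one_eq_zero l).symm] at hl'
      exact hl hl'
    rw [hw0, map_zero, d_aff, Fin.sum_univ_succ] at hdw
    simpa using hdw
  | succ n ih =>
    rw [iUnion_eq_castSucc_union_last] at hw
    set U := ⋃ l, (W ∘ Fin.castSucc) l with hU
    set V := W (Fin.last (n + 1)) with hV
    have hUo : IsOpen U := isOpen_iUnion fun l => h.isOpen _
    obtain ⟨N, w₁, hw₁, w₂, hw₂, hww⟩ := exists_subdiv_mem hUo (h.isOpen (Fin.last (n + 1)))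
      (Set.inter_subset_right) hw
    have hw₁' : w₁ ∈ Ch k (D ∩ U) _ := Ch_weaken hw₁ fun x hx => ⟨hx.1.1, hx.2⟩
    have hw₂' : w₂ ∈ Ch k (D ∩ V) _ := Ch_weaken hw₂ fun x hx => ⟨hx.1.1, hx.2⟩
    set F : SChain k (n + 1) E := Finsupp.single (aff (v ∘ Fin.castSucc)) 1 with hF
    set G := F - d k (n + 1) ((-1 : k) ^ (n + 1) • Finsupp.single (aff v) 1) with hG
    have hGm : G ∈ Ch k (D ∩ U) (n + 1) := h.d_aff_sub_mem
    have hFm : F ∈ Ch k (D ∩ V) (n + 1) :=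
      single_mem_Ch (aff_mem h.init.convex h.init.mem) _
    set s : k := (-1) ^ (n + 1) with hs
    have hss : s * s = 1 := by rw [hs, ← pow_add, Even.neg_one_pow ⟨n + 1, rfl⟩]
    have heq : a • (F - G) = s • d k (n + 1) w := by
      rw [hG, sub_sub_cancel, map_smul, smul_comm, hdw]
    -- The face `F` lies in `V` and the remaining faces `G` lie in `U`. Sorting the equation by the
    -- two sets gives a chain that lies in `U` and in `V` at once.
    have heq2 : a • subdiv k N _ F - s • d k (n + 1) w₂ =
        a • subdiv k N _ G + s • d k (n + 1) w₁ := by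
      have := congrArg (subdiv k N (n + 1)) heq
      rw [map_smul, map_sub, map_smul, ← d_subdiv, hww, map_add, smul_sub, smul_add] at this
      rw [sub_eq_iff_eq_add] at this ⊢
      rw [this]
      abel
    set y := a • subdiv k N _ F - s • d k (n + 1) w₂ with hy
    have hyV : y ∈ Ch k (D ∩ V) (n + 1) := Submodule.sub_mem _
      (Submodule.smul_mem _ _ (subdiv_mem_Ch N hFm)) (Submodule.smul_mem _ _ (d_mem_Ch hw₂'))
    have hyU : y ∈ Ch k (D ∩ U) (n + 1) := by
      rw [heq2]
      exact Submodule.add_mem _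
        (Submodule.smul_mem _ _ (subdiv_mem_Ch N hGm)) (Submodule.smul_mem _ _ (d_mem_Ch hw₁'))
    have hyUV : y ∈ Ch k ((D ∩ V) ∩ U) (n + 1) :=
      Ch_weaken (mem_Ch_inter hyV hyU) fun x hx => ⟨hx.1, hx.2.2⟩
    have hdF : d k n F ∈ Ch k ((D ∩ V) ∩ U) n := by
      rw [hF, d_aff]
      refine Submodule.sum_mem _ fun j _ => Submodule.smul_mem _ _
        (Ch_mono ?_ _ (h.init.face_mem j))
      exact Set.inter_subset_inter_right _ (Set.subset_iUnion (W ∘ Fin.castSucc) j)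
    have hH := subdivHomotopy_mem_Ch N hdF
    -- Subdividing `F` changes its boundary; the homotopy on the boundary of `F`, which lies in the
    -- intersection, restores it.
    refine ih h.init ?_ (w := y + a • subdivHomotopy k N n (d k n F))
      (Submodule.add_mem _ hyUV (Submodule.smul_mem _ _ hH)) ?_
    · rintro x ⟨hxD, hxV⟩
      obtain ⟨l, hl⟩ := hD x hxD
      refine Fin.lastCases (fun hl => absurd hxV hl) (fun l hl => ⟨l, hl⟩) l hl
    · have h1 := d_d k n (subdivHomotopy k N (n + 1) F)
      rw [d_subdivHomotopy, map_sub, map_sub] at h1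
      rw [map_add, hy, map_sub, map_smul, map_smul, d_d, map_smul, smul_zero, sub_zero,
        ← smul_add]
      congr 1
      rw [sub_sub, sub_eq_zero] at h1
      exact h1

end Sphere

end SChain

/-! ### Polar coordinates on the standard simplex -/

namespace Cell

open SChain

variable {d : ℕ}

/-- The standard `d`-simplex. -/
abbrev Simp (d : ℕ) : Type := stdSimplex ℝ (Fin (d + 1))

/-- The smallest barycentric coordinate. -/
noncomputable def minCoord (p : Simp d) : ℝ := Finset.univ.inf' Finset.univ_nonempty fun j => p j

/-- The radial coordinate: `0` at the barycenter and `1` on the boundary. -/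
noncomputable def rad (p : Simp d) : ℝ := 1 - (d + 1) * minCoord p

theorem minCoord_le (p : Simp d) (j : Fin (d + 1)) : minCoord p ≤ p j :=
  Finset.inf'_le _ (Finset.mem_univ j)

theorem exists_eq_minCoord (p : Simp d) : ∃ j, p j = minCoord p := by
  obtain ⟨j, -, hj⟩ := Finset.exists_mem_eq_inf' (Finset.univ_nonempty (α := Fin (d + 1)))
    (fun j => p j)
  exact ⟨j, hj.symm⟩

theorem minCoord_nonneg (p : Simp d) : 0 ≤ minCoord p := by
  obtain ⟨j, hj⟩ := exists_eq_minCoord p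
  exact hj ▸ p.2.1 j

theorem continuous_coord (j : Fin (d + 1)) : Continuous fun p : Simp d => p j :=
  (continuous_apply j).comp continuous_subtype_val

theorem continuous_minCoord : Continuous (minCoord (d := d)) :=
  Continuous.finset_inf'_apply _ fun j _ => continuous_coord j

theorem continuous_rad : Continuous (rad (d := d)) :=
  continuous_const.sub (continuous_const.mul continuous_minCoord)

theorem rad_nonneg (p : Simp d) : 0 ≤ rad p := by
  have h : ∑ _j : Fin (d + 1), minCoord p ≤ ∑ j, p j :=
    Finset.sum_le_sum fun j _ => minCoord_le p j
  rw [stdSimplex.sum_eq_one] at h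
  simp at h
  simpa [rad] using h

theorem rad_le_one (p : Simp d) : rad p ≤ 1 := by
  have := minCoord_nonneg p
  rw [rad]
  have : 0 ≤ (d + 1 : ℝ) * minCoord p := by positivity
  linarith

theorem rad_eq_one_iff (p : Simp d) : rad p = 1 ↔ ∃ j, p j = 0 := by
  have hd : (d + 1 : ℝ) ≠ 0 := by positivity
  have h1 : rad p = 1 ↔ minCoord p = 0 := by
    rw [rad]
    constructor
    · intro h
      have : (d + 1 : ℝ) * minCoord p = 0 := by linarith
      simpa [hd] using this
    · intro h; rw [h]; ring
  rw [h1]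
  constructor
  · intro h
    obtain ⟨j, hj⟩ := exists_eq_minCoord p
    exact ⟨j, hj.trans h⟩
  · rintro ⟨j, hj⟩
    exact le_antisymm (hj ▸ minCoord_le p j) (minCoord_nonneg p)

/-- The threshold is half the coordinate of the barycentre. It makes the outer region the trace on
the simplex of `d + 1` open half-spaces, which form a face cover. -/
theorem half_lt_rad_iff (p : Simp d) : 1 / 2 < rad p ↔ ∃ j, p j < 1 / (2 * (d + 1)) := by
  have hd : (0 : ℝ) < d + 1 := by positivity
  have h1 : 1 / 2 < rad p ↔ minCoord p < 1 / (2 * (d + 1)) := by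
    rw [rad, lt_div_iff₀ (by positivity)]
    constructor <;> intro h <;> linarith
  rw [h1]
  constructor
  · intro h
    obtain ⟨j, hj⟩ := exists_eq_minCoord p
    exact ⟨j, hj ▸ h⟩
  · rintro ⟨j, hj⟩
    exact (minCoord_le p j).trans_lt hj

/-- Scaling of the simplex from its barycenter. -/
noncomputable def scale (c : ℝ) (p : Simp d) (hc : 0 ≤ c) (hp : c * rad p ≤ 1) : Simp d :=
  ⟨fun j => 1 / (d + 1) + c * (p j - 1 / (d + 1)), by
    have hd : (0 : ℝ) < d + 1 := by positivity
    constructor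
    · intro j
      have h1 : c * (minCoord p - 1 / (d + 1)) ≤ c * (p j - 1 / (d + 1)) :=
        mul_le_mul_of_nonneg_left (by linarith [minCoord_le p j]) hc
      have h2 : 1 / (d + 1) + c * (minCoord p - 1 / (d + 1)) = (1 - c * rad p) / (d + 1) := by
        rw [rad]; field_simp; ring
      have h3 : 0 ≤ (1 - c * rad p) / (d + 1) := div_nonneg (by linarith) hd.le
      linarith
    · rw [Finset.sum_add_distrib, ← Finset.mul_sum, Finset.sum_sub_distrib,
        stdSimplex.sum_eq_one]
      simp [hd.ne']⟩

theorem scale_apply {c : ℝ} {p : Simp d} (hc : 0 ≤ c) (hp : c * rad p ≤ 1) (j : Fin (d + 1)) :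
    scale c p hc hp j = 1 / (d + 1) + c * (p j - 1 / (d + 1)) := rfl

theorem rad_scale {c : ℝ} {p : Simp d} (hc : 0 ≤ c) (hp : c * rad p ≤ 1) :
    rad (scale c p hc hp) = c * rad p := by
  have hd : (0 : ℝ) < d + 1 := by positivity
  have h : minCoord (scale c p hc hp) = 1 / (d + 1) + c * (minCoord p - 1 / (d + 1)) := by
    apply le_antisymm
    · obtain ⟨j, hj⟩ := exists_eq_minCoord p
      exact (minCoord_le _ j).trans (by rw [scale_apply, hj])
    · obtain ⟨j, hj⟩ := exists_eq_minCoord (scale c p hc hp)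
      rw [← hj, scale_apply]
      have := mul_le_mul_of_nonneg_left
        (show minCoord p - 1 / (d + 1) ≤ p j - 1 / (d + 1) by linarith [minCoord_le p j]) hc
      linarith
  rw [rad, h, rad]
  field_simp
  ring

theorem scale_scale {c c' : ℝ} {p : Simp d} (hc : 0 ≤ c) (hp : c * rad p ≤ 1) (hc' : 0 ≤ c')
    (hp' : c' * rad (scale c p hc hp) ≤ 1) :
    scale c' (scale c p hc hp) hc' hp' = scale (c' * c) p (mul_nonneg hc' hc)
      (by rw [rad_scale] at hp'; linarith) := by
  apply stdSimplex.ext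
  funext j
  rw [scale_apply, scale_apply, scale_apply]
  ring

theorem scale_one {c : ℝ} {p : Simp d} (hc : 0 ≤ c) (hp : c * rad p ≤ 1) (h : c = 1) :
    scale c p hc hp = p := by
  subst h
  apply stdSimplex.ext
  funext j
  rw [scale_apply]
  ring

/-- The scaling factor of the radial expansion. -/
noncomputable def factor (p : Simp d) (t : ℝ) : ℝ := (1 + t) / max 1 ((1 + t) * rad p)

theorem factor_nonneg (p : Simp d) {t : ℝ} (ht : 0 ≤ t) : 0 ≤ factor p t := by
  rw [factor]
  positivity

/-- The maximum in `factor` stops the expansion when the boundary is reached: the new radius is `(1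
+ t) * rad p` capped at `1`. -/
theorem factor_mul_rad (p : Simp d) {t : ℝ} (ht : 0 ≤ t) :
    factor p t * rad p = min 1 ((1 + t) * rad p) := by
  have hr := rad_nonneg p
  have hx : 0 ≤ (1 + t) * rad p := by positivity
  rw [factor, div_mul_eq_mul_div]
  rcases le_total 1 ((1 + t) * rad p) with h | h
  · rw [max_eq_right h, min_eq_left h, div_self (by linarith)]
  · rw [max_eq_left h, min_eq_right h, div_one]

theorem factor_of_le {p : Simp d} {t : ℝ} (h : 1 ≤ (1 + t) * rad p) :
    factor p t = 1 / rad p := by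
  have h0 : (1 + t) * rad p ≠ 0 := by linarith
  have h1 : (1 + t) ≠ 0 := left_ne_zero_of_mul h0
  have h2 : rad p ≠ 0 := right_ne_zero_of_mul h0
  rw [factor, max_eq_right h]
  field_simp

/-- The radial expansion of the simplex, by a factor increasing from `1` to `2`. -/
noncomputable def expand : C(Simp d × unitInterval, Simp d) where
  toFun q := scale (factor q.1 q.2) q.1 (factor_nonneg _ q.2.2.1)
    (by rw [factor_mul_rad _ q.2.2.1]; exact min_le_left _ _)
  continuous_toFun := by
    have hf : Continuous fun q : Simp d × unitInterval => factor q.1 (q.2 : ℝ) := by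
      have hr : Continuous fun q : Simp d × unitInterval => rad q.1 :=
        continuous_rad.comp continuous_fst
      refine Continuous.div (by fun_prop) (by fun_prop) fun q => ?_
      exact ne_of_gt (lt_of_lt_of_le one_pos (le_max_left _ _))
    refine Continuous.subtype_mk (continuous_pi fun j => ?_) _
    have hj : Continuous fun q : Simp d × unitInterval => q.1 j :=
      (continuous_coord j).comp continuous_fst
    fun_prop

theorem expand_apply (p : Simp d) (t : unitInterval) :
    expand (p, t) = scale (factor p t) p (factor_nonneg _ t.2.1)
      (by rw [factor_mul_rad _ t.2.1]; exact min_le_left _ _) := rfl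

theorem rad_expand (p : Simp d) (t : unitInterval) :
    rad (expand (p, t)) = min 1 ((1 + t) * rad p) := by
  rw [expand_apply, rad_scale, factor_mul_rad _ t.2.1]

theorem rad_le_rad_expand (p : Simp d) (t : unitInterval) : rad p ≤ rad (expand (p, t)) := by
  rw [rad_expand]
  refine le_min (rad_le_one p) ?_
  nlinarith [rad_nonneg p, t.2.1]

theorem rad_expand_one {p : Simp d} (h : 1 / 2 ≤ rad p) : rad (expand (p, 1)) = 1 := by
  rw [rad_expand]
  refine min_eq_left ?_
  rw [Set.Icc.coe_one]
  linarith

theorem expand_zero (p : Simp d) : expand (p, 0) = p := by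
  rw [expand_apply]
  refine scale_one _ _ ?_
  rw [factor, Set.Icc.coe_zero, add_zero, one_mul, max_eq_left (rad_le_one p), div_one]

theorem expand_of_rad_eq_one {p : Simp d} (h : rad p = 1) (t : unitInterval) :
    expand (p, t) = p := by
  rw [expand_apply]
  refine scale_one _ _ ?_
  rw [factor_of_le (by rw [h]; linarith [t.2.1]), h, div_one]

/-- Points on one ray from the barycentre with radius at least `1 / 2` have the same end point on
the boundary. Hence a function interpolated along rays can be compared at `p` and at its expansion.
-/
theorem expand_expand_one {p : Simp d} (h : 1 / 2 ≤ rad p) (t : unitInterval) :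
    expand (expand (p, t), 1) = expand (p, 1) := by
  have hr : 0 < rad p := by linarith
  simp only [expand_apply]
  rw [scale_scale]
  have hm : factor p t * rad p = rad (expand (p, t)) := by rw [rad_expand, factor_mul_rad _ t.2.1]
  have h1 : 1 / 2 ≤ rad (expand (p, t)) := h.trans (rad_le_rad_expand p t)
  have e1 : factor (scale (factor p t) p (factor_nonneg _ t.2.1)
      (by rw [factor_mul_rad _ t.2.1]; exact min_le_left _ _)) (1 : unitInterval) =
        1 / (factor p t * rad p) := by
    rw [← expand_apply, factor_of_le, hm]
    rw [Set.Icc.coe_one]; linarith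
  have e2 : factor p (1 : unitInterval) = 1 / rad p := factor_of_le (by
    rw [Set.Icc.coe_one]; linarith)
  have hf : factor p t ≠ 0 := by
    intro h0
    rw [h0, zero_mul] at hm
    linarith
  congr 1
  rw [e1, e2]
  field_simp

/-- The boundary of the standard simplex. -/
def bdry (d : ℕ) : Set (Simp d) := {p | rad p = 1}

/-! ### Local homology of the standard simplex -/

section LocalHomology

variable {k : Type*} [Field k]

/-- The complement of the central part of the simplex. -/
def outer (d : ℕ) : Set (Simp d) := {p | 1 / 2 < rad p}

/-- The points with small `l`-th coordinate. -/
def outerPart (d : ℕ) (l : Fin (d + 1)) : Set (Fin (d + 1) → ℝ) := {x | x l < 1 / (2 * (d + 1))}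

variable (k) in
/-- The affine simplex with given vertices in the standard simplex, as a chain with `m` vertices;
zero if `m ≠ d + 1`. -/
noncomputable def cellChain (v : Fin (d + 1) → Simp d) (m : ℕ) : SChain k m (Simp d) :=
  if h : m = d + 1 then
    Finsupp.single (affineSimplex (convex_stdSimplex ℝ (Fin (d + 1))) (v ∘ Fin.cast h)) 1
  else 0

theorem cellChain_self (v : Fin (d + 1) → Simp d) : cellChain k v (d + 1) =
    Finsupp.single (affineSimplex (convex_stdSimplex ℝ (Fin (d + 1))) v) 1 := by
  simp [cellChain]

theorem cellChain_of_ne (v : Fin (d + 1) → Simp d) {m : ℕ} (h : m ≠ d + 1) :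
    cellChain k v m = 0 := by
  simp [cellChain, h]

/-- The inclusion of the standard simplex in the vector space. -/
def incl (d : ℕ) : C(Simp d, Fin (d + 1) → ℝ) := ⟨Subtype.val, continuous_subtype_val⟩

theorem isEmbedding_incl : Topology.IsEmbedding (incl d) := Topology.IsEmbedding.subtypeVal

theorem map_incl_cellChain (v : Fin (d + 1) → Simp d) (m : ℕ) :
    map k (incl d) m (cellChain k v m) = affChain k (fun j => (v j : Fin (d + 1) → ℝ)) m := by
  by_cases h : m = d + 1
  · subst h
    rw [cellChain_self, affChain_self, map_single]
    rfl
  · rw [cellChain_of_ne _ h, affChain_of_ne _ h, map_zero]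

/-- Tuples of points which are close to the vertices of the simplex. -/
def NearVertices (v : Fin (d + 1) → Simp d) : Prop :=
  ∀ j l, l ≠ j → v j l < 1 / (2 * (d + 1))

theorem NearVertices.faceCover {v : Fin (d + 1) → Simp d} (hv : NearVertices v) :
    FaceCover (stdSimplex ℝ (Fin (d + 1))) (outerPart d) fun j => (v j : Fin (d + 1) → ℝ) where
  convex := convex_stdSimplex ℝ _
  isOpen l := isOpen_lt (continuous_apply l) continuous_const
  convexW l :=
    convex_halfSpace_lt (f := fun x : Fin (d + 1) → ℝ => x l) ⟨fun _ _ => rfl, fun _ _ => rfl⟩ _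
  mem j := (v j).2
  memW j l h := hv j l h

theorem image_outer : incl d '' outer d = stdSimplex ℝ (Fin (d + 1)) ∩ ⋃ l, outerPart d l := by
  ext x
  constructor
  · rintro ⟨p, hp, rfl⟩
    exact ⟨p.2, Set.mem_iUnion.2 ((half_lt_rad_iff p).1 hp)⟩
  · rintro ⟨hx, hx'⟩
    obtain ⟨l, hl⟩ := Set.mem_iUnion.1 hx'
    exact ⟨⟨x, hx⟩, (half_lt_rad_iff _).2 ⟨l, hl⟩, rfl⟩

/-- If all coordinates were below the threshold, their sum would be less than `1 / 2`. This is the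
empty total intersection needed for the nontriviality of the local homology. -/
theorem exists_notMem_outerPart (x : Fin (d + 1) → ℝ) (hx : x ∈ stdSimplex ℝ (Fin (d + 1))) :
    ∃ l, x ∉ outerPart d l := by
  by_contra! h
  have hd : (0 : ℝ) < d + 1 := by positivity
  have h1 : ∑ l, x l < ∑ _l : Fin (d + 1), 1 / (2 * (d + 1) : ℝ) :=
    Finset.sum_lt_sum_of_nonempty Finset.univ_nonempty fun l _ => h l
  rw [hx.2] at h1
  simp only [Finset.sum_const, Finset.card_univ, Fintype.card_fin, nsmul_eq_mul] at h1
  push_cast at h1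
  rw [mul_one_div, mul_comm 2, ← div_div, div_self hd.ne'] at h1
  norm_num at h1

/-- Face covers live in a normed space, so the chain is pushed into the ambient vector space,
decomposed there, and pulled back along the embedding. -/
theorem exists_local_decomposition {v : Fin (d + 1) → Simp d} (hv : NearVertices v) {m : ℕ}
    (hm : m ≤ d) {z : SChain k (m + 1) (Simp d)} (hdz : SChain.d k m z ∈ Ch k (outer d) m) :
    ∃ y ∈ Ch k (outer d) (m + 1), ∃ a : k, ∃ w : SChain k (m + 2) (Simp d),
      z = y + a • cellChain k v (m + 1) + SChain.d k (m + 1) w := by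
  obtain ⟨y, hy, a, w, hw, h⟩ := hv.faceCover.exists_decomposition (k := k) (m := m)
    (z := map k (incl d) (m + 1) z) (by omega)
    (map_mem_Ch (S := Set.univ) (fun p _ => p.2) (mem_Ch_univ z))
    (by rw [d_map, ← image_outer]; exact map_mem_Ch (Set.mapsTo_image _ _) hdz)
  rw [← image_outer] at hy
  obtain ⟨y', hy', rfl⟩ := exists_map_eq_of_mem_Ch isEmbedding_incl hy
  obtain ⟨w', -, rfl⟩ := exists_map_eq_of_mem_Ch (S := Set.univ) (c := w)
    (isEmbedding_incl (d := d)) (Ch_weaken hw fun x hx => ⟨⟨x, hx⟩, trivial, rfl⟩)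
  refine ⟨y', hy', a, w', map_injective k isEmbedding_incl.injective _ ?_⟩
  rw [h, d_map, map_add, map_add, map_smul, map_incl_cellChain]

theorem local_eq_zero {v : Fin (d + 1) → Simp d} (hv : NearVertices v) {a : k}
    {y : SChain k (d + 1) (Simp d)} (hy : y ∈ Ch k (outer d) (d + 1))
    (h : a • SChain.d k d (cellChain k v (d + 1)) = SChain.d k d y) : a = 0 := by
  refine hv.faceCover.eq_zero_of_d_eq (k := k) exists_notMem_outerPart
    (w := map k (incl d) (d + 1) y)
    (by rw [← image_outer]; exact map_mem_Ch (Set.mapsTo_image _ _) hy) ?_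
  rw [d_map, ← h, map_smul, ← d_map, map_incl_cellChain, affChain_self]

theorem nearVertices_std : NearVertices (stdVertices (d + 1)) := by
  intro j l hl
  change (Pi.single j (1 : ℝ) : Fin (d + 1) → ℝ) l < _
  rw [Pi.single_eq_of_ne hl]
  positivity

/-- The vertices of a concentric smaller copy of the simplex. -/
noncomputable def innerVertices (d : ℕ) (j : Fin (d + 1)) : Simp d :=
  scale (3 / 4) (stdVertices (d + 1) j) (by norm_num)
    (by linarith [rad_le_one (stdVertices (d + 1) j)])

/-- The factor `3 / 4` turns the zero coordinates into `1 / (4 * (d + 1))`: below the threshold, so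
the vertices still give a face cover, and positive, so the smaller simplex avoids the boundary and
lifts to open cells. -/
theorem nearVertices_inner : NearVertices (innerVertices d) := by
  intro j l hl
  have hd : (0 : ℝ) < d + 1 := by positivity
  rw [innerVertices, scale_apply]
  change 1 / (d + 1) + 3 / 4 * ((Pi.single j (1 : ℝ) : Fin (d + 1) → ℝ) l - 1 / (d + 1)) < _
  rw [Pi.single_eq_of_ne hl]
  have : 1 / (2 * (d + 1) : ℝ) = 1 / 2 * (1 / (d + 1)) := by rw [one_div_mul_one_div]
  rw [this]
  have : (0 : ℝ) < 1 / (d + 1) := by positivity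
  linarith

theorem rad_lt_one_iff (p : Simp d) : rad p < 1 ↔ ∀ j, 0 < p j := by
  rw [(rad_le_one p).lt_iff_ne, Ne, rad_eq_one_iff]
  push Not
  exact forall_congr' fun j => ⟨fun h => (p.2.1 j).lt_of_ne' h, fun h => h.ne'⟩

theorem rad_affineSimplex_innerVertices_lt (p : Simp d) :
    rad (affineSimplex (convex_stdSimplex ℝ (Fin (d + 1))) (innerVertices d) p) < 1 := by
  have hpos : ∀ j l, 1 / (4 * (d + 1) : ℝ) ≤ innerVertices d j l := by
    intro j l
    have : 0 ≤ stdVertices (d + 1) j l := (stdVertices (d + 1) j).2.1 l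
    rw [innerVertices, scale_apply]
    have h2 : 1 / (4 * (d + 1) : ℝ) = 1 / 4 * (1 / (d + 1)) := by rw [one_div_mul_one_div]
    rw [h2]
    linarith
  rw [rad_lt_one_iff]
  intro l
  change 0 < (∑ j, p j • (innerVertices d j : Fin (d + 1) → ℝ)) l
  rw [Finset.sum_apply]
  have h1 : ∑ j, p j * (1 / (4 * (d + 1) : ℝ)) ≤ ∑ j, p j * innerVertices d j l :=
    Finset.sum_le_sum fun j _ => mul_le_mul_of_nonneg_left (hpos j l) (p.2.1 j)
  rw [← Finset.sum_mul, stdSimplex.sum_eq_one, one_mul] at h1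
  exact lt_of_lt_of_le (by positivity) h1

end LocalHomology

end Cell

open Cell SChain

theorem SChain.eq_of_mem_Ch {k : Type*} [Field k] {X : Type*} [TopologicalSpace X] {S : Set X}
    {n : ℕ} {M : Type*} [AddCommMonoid M] [Module k M] {f g : SChain k n X →ₗ[k] M}
    (h : ∀ σ : C(stdSimplex ℝ (Fin n), X), (∀ p, σ p ∈ S) →
      f (Finsupp.single σ 1) = g (Finsupp.single σ 1))
    {c : SChain k n X} (hc : c ∈ Ch k S n) : f c = g c := by
  have : Ch k S n ≤ LinearMap.eqLocus f g := by
    rw [Ch, Finsupp.supported_eq_span_single, Submodule.span_le]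
    rintro _ ⟨σ, hσ, rfl⟩
    exact h σ hσ
  exact this hc

/-! ### Attaching cells to a space -/

section Attach

universe v

variable {A : Type u} [TopologicalSpace A] {J : Type v} {d : ℕ}

/-- The space obtained from `A` by attaching a family of `d`-cells, in the form of standard
simplices, along maps defined on their boundary. -/
def Attach (_φ : J → C(bdry d, A)) : Type (max u v) := A ⊕ (J × {p : Simp d // p ∉ bdry d})

namespace Attach

variable (φ : J → C(bdry d, A))

open Classical in
/-- The quotient map onto the space with the cells attached. -/
noncomputable def quot : A ⊕ (Σ _ : J, Simp d) → Attach φ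
  | Sum.inl a => Sum.inl a
  | Sum.inr ⟨j, p⟩ => if h : p ∈ bdry d then Sum.inl (φ j ⟨p, h⟩) else Sum.inr (j, ⟨p, h⟩)

noncomputable instance : TopologicalSpace (Attach φ) := TopologicalSpace.coinduced (quot φ) inferInstance

theorem continuous_quot : Continuous (quot φ) := continuous_coinduced_rng

/-- The inclusion of the original space. -/
noncomputable def base : C(A, Attach φ) :=
  ⟨fun a => quot φ (Sum.inl a), (continuous_quot φ).comp continuous_inl⟩

/-- The characteristic map of a cell. -/
noncomputable def cell (j : J) : C(Simp d, Attach φ) :=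
  ⟨fun p => quot φ (Sum.inr ⟨j, p⟩), (continuous_quot φ).comp
    (continuous_inr.comp continuous_sigmaMk)⟩

variable {φ}

theorem cell_of_mem (j : J) {p : Simp d} (h : p ∈ bdry d) :
    cell φ j p = base φ (φ j ⟨p, h⟩) :=
  dif_pos h

theorem cell_of_notMem (j : J) {p : Simp d} (h : p ∉ bdry d) :
    cell φ j p = (Sum.inr (j, ⟨p, h⟩) : A ⊕ (J × {p : Simp d // p ∉ bdry d})) := by
  exact dif_neg h

theorem base_injective : Function.Injective (base φ) := fun _ _ h => Sum.inl_injective h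

theorem cell_ne_base {j : J} {p : Simp d} (h : p ∉ bdry d) (a : A) : cell φ j p ≠ base φ a := by
  rw [cell_of_notMem j h]
  exact Sum.inr_ne_inl

theorem cell_eq_cell {j j' : J} {p p' : Simp d} (h : p ∉ bdry d) (h' : p' ∉ bdry d)
    (e : cell φ j p = cell φ j' p') : j = j' ∧ p = p' := by
  rw [cell_of_notMem j h, cell_of_notMem j' h'] at e
  have e' := Prod.ext_iff.1 (Sum.inr_injective e)
  exact ⟨e'.1, congrArg Subtype.val e'.2⟩

/-- Every point lies in the original space or in exactly one open cell. -/
theorem cases (x : Attach φ) : (∃ a, x = base φ a) ∨ ∃ j, ∃ p ∉ bdry d, x = cell φ j p := by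
  rcases x with a | ⟨j, p, hp⟩
  · exact Or.inl ⟨a, rfl⟩
  · exact Or.inr ⟨j, p, hp, (cell_of_notMem j hp).symm⟩

theorem isOpen_iff {U : Set (Attach φ)} :
    IsOpen U ↔ IsOpen (base φ ⁻¹' U) ∧ ∀ j, IsOpen (cell φ j ⁻¹' U) := by
  rw [isOpen_coinduced, isOpen_sum_iff, isOpen_sigma_iff]
  rfl

theorem isClosed_iff {U : Set (Attach φ)} :
    IsClosed U ↔ IsClosed (base φ ⁻¹' U) ∧ ∀ j, IsClosed (cell φ j ⁻¹' U) := by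
  simp only [← isOpen_compl_iff, isOpen_iff, Set.preimage_compl]

theorem continuous_iff {T : Type*} [TopologicalSpace T] {f : Attach φ → T} :
    Continuous f ↔ Continuous (fun a => f (base φ a)) ∧ ∀ j, Continuous fun p => f (cell φ j p) := by
  constructor
  · exact fun h => ⟨h.comp (base φ).continuous, fun j => h.comp (cell φ j).continuous⟩
  · rintro ⟨h1, h2⟩
    refine ⟨fun U hU => isOpen_iff.2 ⟨hU.preimage h1, fun j => hU.preimage (h2 j)⟩⟩

theorem isClosed_bdry : IsClosed (bdry d) := isClosed_eq continuous_rad continuous_const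

theorem isClosedEmbedding_base : Topology.IsClosedEmbedding (base φ) := by
  refine .of_continuous_injective_isClosedMap (base φ).continuous base_injective fun C hC => ?_
  refine isClosed_iff.2 ⟨by rwa [Set.preimage_image_eq _ base_injective], fun j => ?_⟩
  have : cell φ j ⁻¹' (base φ '' C) = Subtype.val '' (φ j ⁻¹' C) := by
    ext p
    constructor
    · rintro ⟨a, ha, h⟩
      by_cases hp : p ∈ bdry d
      · rw [cell_of_mem j hp] at h
        exact ⟨⟨p, hp⟩, by rwa [Set.mem_preimage, ← base_injective h], rfl⟩
      · exact absurd h.symm (cell_ne_base hp a)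
    · rintro ⟨q, hq, rfl⟩
      exact ⟨_, hq, (cell_of_mem j q.2).symm⟩
  rw [this]
  exact isClosed_bdry.isClosedEmbedding_subtypeVal.isClosedMap _ (hC.preimage (φ j).continuous)

section Desc

variable {T : Type*} [TopologicalSpace T]

/-- Gluing of a continuous map. -/
noncomputable def desc (f : C(A, T)) (g : J → C(Simp d, T)) (h : ∀ j (p : bdry d), g j p = f (φ j p)) :
    C(Attach φ, T) where
  toFun
    | Sum.inl a => f a
    | Sum.inr (j, p) => g j p
  continuous_toFun := by
    refine continuous_iff.2 ⟨f.continuous, fun j => ?_⟩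
    convert (g j).continuous using 1
    funext p
    by_cases hp : p ∈ bdry d
    · rw [cell_of_mem j hp]
      exact (h j ⟨p, hp⟩).symm
    · rw [cell_of_notMem j hp]

variable (f : C(A, T)) (g : J → C(Simp d, T)) (h : ∀ j (p : bdry d), g j p = f (φ j p))

@[simp] theorem desc_cell (j : J) (p : Simp d) : desc f g h (cell φ j p) = g j p := by
  by_cases hp : p ∈ bdry d
  · rw [cell_of_mem j hp]
    exact (h j ⟨p, hp⟩).symm
  · rw [cell_of_notMem j hp]
    rfl

theorem hom_ext {f g : C(Attach φ, T)} (h1 : ∀ a, f (base φ a) = g (base φ a))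
    (h2 : ∀ j p, f (cell φ j p) = g (cell φ j p)) : f = g := by
  ext x
  rcases cases x with ⟨a, rfl⟩ | ⟨j, p, -, rfl⟩
  · exact h1 a
  · exact h2 j p

end Desc

/-- The radial coordinate, which is `1` on the original space. -/
noncomputable def radius : C(Attach φ, ℝ) :=
  desc (ContinuousMap.const _ 1) (fun _ => ⟨rad, continuous_rad⟩) fun _ p => p.2

theorem radius_base (a : A) : radius (base φ a) = 1 := rfl

theorem radius_cell (j : J) (p : Simp d) : radius (cell φ j p) = rad p := desc_cell _ _ _ _ _

variable (φ) in
/-- The radial expansion of all cells, as a homotopy. -/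
noncomputable def expandHtpy : C(Attach φ × unitInterval, Attach φ) :=
  -- Gluing is done with values in the path space, so that only the universal property of the
  -- quotient is used, not one for its product with the interval.
  ContinuousMap.uncurry (desc (T := C(unitInterval, Attach φ))
    (ContinuousMap.curry ⟨fun q : A × unitInterval => base φ q.1, by fun_prop⟩)
    (fun j => ContinuousMap.curry ((cell φ j).comp expand))
    (fun j p => by
      ext t
      simp only [ContinuousMap.curry_apply, ContinuousMap.comp_apply, ContinuousMap.coe_mk]
      rw [expand_of_rad_eq_one p.2]
      exact cell_of_mem j p.2))

theorem expandHtpy_base (a : A) (t : unitInterval) :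
    expandHtpy φ (base φ a, t) = base φ a := rfl

theorem expandHtpy_cell (j : J) (p : Simp d) (t : unitInterval) :
    expandHtpy φ (cell φ j p, t) = cell φ j (expand (p, t)) := by
  change desc (T := C(unitInterval, Attach φ)) _ _ _ (cell φ j p) t = _
  rw [desc_cell]
  rfl

theorem expandHtpy_zero (x : Attach φ) : expandHtpy φ (x, 0) = x := by
  rcases cases x with ⟨a, rfl⟩ | ⟨j, p, -, rfl⟩
  · rfl
  · rw [expandHtpy_cell, expand_zero]

variable (φ) in
/-- The union of the open cells with index in `B`. -/
def openCells (B : Set J) : Set (Attach φ) := {x | ∃ j ∈ B, ∃ p ∉ bdry d, x = cell φ j p}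

theorem isOpen_openCells (B : Set J) : IsOpen (openCells φ B) := by
  refine isOpen_iff.2 ⟨?_, fun j => ?_⟩
  · convert isOpen_empty
    ext a
    simp only [Set.mem_preimage, Set.mem_empty_iff_false, iff_false]
    rintro ⟨j, -, p, hp, h⟩
    exact cell_ne_base hp a h.symm
  · by_cases hj : j ∈ B
    · convert isClosed_bdry.isOpen_compl (X := Simp d)
      ext p
      refine ⟨?_, fun hp => ⟨j, hj, p, hp, rfl⟩⟩
      rintro ⟨j', -, p', hp', h⟩ hp
      rw [cell_of_mem j hp] at h
      exact cell_ne_base hp' _ h.symm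
    · convert isOpen_empty
      ext p
      simp only [Set.mem_preimage, Set.mem_empty_iff_false, iff_false]
      rintro ⟨j', hj', p', hp', h⟩
      by_cases hp : p ∈ bdry d
      · rw [cell_of_mem j hp] at h
        exact cell_ne_base hp' _ h.symm
      · exact hj ((cell_eq_cell hp hp' h).1 ▸ hj')

theorem notMem_bdry_iff {p : Simp d} : p ∉ bdry d ↔ rad p < 1 :=
  (rad_le_one p).lt_iff_ne.symm

/-- A singular simplex in the union of the open cells lies in a single one. -/
theorem exists_lift {B : Set J} {m : ℕ} {σ : C(stdSimplex ℝ (Fin (m + 1)), Attach φ)}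
    (hσ : ∀ q, σ q ∈ openCells φ B) :
    ∃ j ∈ B, ∃ τ : C(stdSimplex ℝ (Fin (m + 1)), Simp d), (∀ q, τ q ∉ bdry d) ∧
      σ = (cell φ j).comp τ := by
  choose j hj p hp hσp using hσ
  -- The open cells are open and disjoint, so the index of the cell is locally constant on the
  -- connected simplex. At least one vertex is required for the simplex to be nonempty.
  have hjc : ∀ q q', j q = j q' := by
    have : IsLocallyConstant j := by
      rw [IsLocallyConstant.iff_exists_open]
      intro q
      refine ⟨σ ⁻¹' openCells φ {j q}, (isOpen_openCells _).preimage σ.continuous,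
        ⟨j q, rfl, p q, hp q, hσp q⟩, ?_⟩
      rintro q' ⟨j', hj', p', hp', h⟩
      rw [hσp q'] at h
      exact (cell_eq_cell (hp q') hp' h).1.trans hj'
    exact fun q q' => this.apply_eq_of_preconnectedSpace q q'
  obtain ⟨q₀⟩ : Nonempty (stdSimplex ℝ (Fin (m + 1))) := inferInstance
  have hσp' : ∀ q, σ q = cell φ (j q₀) (p q) := fun q => by rw [hσp q, hjc q q₀]
  -- The characteristic map is open on the interior of the cell, so the lifted point depends
  -- continuously on `σ q`.
  have hpc : Continuous p := by
    refine ⟨fun W hW => ?_⟩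
    have hW' : IsOpen (cell φ (j q₀) '' (W ∩ (bdry d)ᶜ)) := by
      refine isOpen_iff.2 ⟨?_, fun j' => ?_⟩
      · convert isOpen_empty
        ext a
        simp only [Set.mem_preimage, Set.mem_empty_iff_false, iff_false]
        rintro ⟨p', hp', h⟩
        exact cell_ne_base hp'.2 a h
      · by_cases hj' : j' = j q₀
        · subst hj'
          convert hW.inter isClosed_bdry.isOpen_compl
          ext p'
          refine ⟨?_, fun h => ⟨p', h, rfl⟩⟩
          rintro ⟨p'', hp'', h⟩
          by_cases hb : p' ∈ bdry d
          · rw [cell_of_mem _ hb] at h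
            exact absurd h (cell_ne_base hp''.2 _)
          · rw [← (cell_eq_cell hp''.2 hb h).2]
            exact hp''
        · convert isOpen_empty
          ext p'
          simp only [Set.mem_preimage, Set.mem_empty_iff_false, iff_false]
          rintro ⟨p'', hp'', h⟩
          by_cases hb : p' ∈ bdry d
          · rw [cell_of_mem _ hb] at h
            exact absurd h (cell_ne_base hp''.2 _)
          · exact hj' (cell_eq_cell hp''.2 hb h).1.symm
    convert hW'.preimage σ.continuous
    ext q
    simp only [Set.mem_preimage, hσp' q]
    constructor
    · exact fun h => ⟨_, ⟨h, hp q⟩, rfl⟩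
    · rintro ⟨p', hp', h⟩
      rw [← (cell_eq_cell hp'.2 (hp q) h).2]
      exact hp'.1
  exact ⟨j q₀, hj q₀, ⟨p, hpc⟩, hp, ContinuousMap.ext hσp'⟩

theorem lift_unique {j j' : J} {m : ℕ} {τ τ' : C(stdSimplex ℝ (Fin (m + 1)), Simp d)}
    (hτ : ∀ q, τ q ∉ bdry d) (hτ' : ∀ q, τ' q ∉ bdry d)
    (h : (cell φ j).comp τ = (cell φ j').comp τ') : j = j' ∧ τ = τ' := by
  have h' := fun q => cell_eq_cell (hτ q) (hτ' q) (DFunLike.congr_fun h q)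
  obtain ⟨q₀⟩ : Nonempty (stdSimplex ℝ (Fin (m + 1))) := inferInstance
  exact ⟨(h' q₀).1, ContinuousMap.ext fun q => (h' q).2⟩

/-! ### Lifting chains to the cells -/

section Lift

variable (k : Type*) [Field k]

open Classical in
variable (φ) in
/-- The components of a chain in the open cells. -/
noncomputable def lift (m : ℕ) : SChain k (m + 1) (Attach φ) →ₗ[k] J →₀ SChain k (m + 1) (Simp d) :=
  Finsupp.linearCombination k fun σ =>
    -- Simplices outside a single open cell are sent to zero by convention; the map carries
    -- information only on chains supported in `openCells`.
    if h : ∃ (j : J) (τ : C(stdSimplex ℝ (Fin (m + 1)), Simp d)), (∀ q, τ q ∉ bdry d) ∧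
        σ = (cell φ j).comp τ then
      Finsupp.single h.choose (Finsupp.single h.choose_spec.choose 1)
    else 0

theorem lift_single {m : ℕ} (j : J) {τ : C(stdSimplex ℝ (Fin (m + 1)), Simp d)}
    (hτ : ∀ q, τ q ∉ bdry d) :
    lift φ k m (Finsupp.single ((cell φ j).comp τ) 1) =
      Finsupp.single j (Finsupp.single τ 1) := by
  have h : ∃ (j' : J) (τ' : C(stdSimplex ℝ (Fin (m + 1)), Simp d)), (∀ q, τ' q ∉ bdry d) ∧
        (cell φ j).comp τ = (cell φ j').comp τ' := ⟨j, τ, hτ, rfl⟩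
  have h2 := lift_unique hτ h.choose_spec.choose_spec.1 h.choose_spec.choose_spec.2
  rw [lift, Finsupp.linearCombination_single, one_smul, dif_pos h]
  exact (congrArg₂ (fun a b => Finsupp.single a (Finsupp.single b 1)) h2.1 h2.2).symm

variable (φ) in
/-- The sum of the images of chains in the cells. -/
noncomputable def total (m : ℕ) : (J →₀ SChain k m (Simp d)) →ₗ[k] SChain k m (Attach φ) :=
  Finsupp.lsum k fun j => SChain.map k (cell φ j) m

theorem total_single (m : ℕ) (j : J) (c : SChain k m (Simp d)) :
    total φ k m (Finsupp.single j c) = SChain.map k (cell φ j) m c := by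
  simp [total]

variable {k}

theorem induction_openCells {B : Set J} {m : ℕ} {M : Type*} [AddCommGroup M] [Module k M]
    {f : SChain k (m + 1) (Attach φ) →ₗ[k] M} {N : Submodule k M}
    (h : ∀ j ∈ B, ∀ τ : C(stdSimplex ℝ (Fin (m + 1)), Simp d), (∀ q, τ q ∉ bdry d) →
      f (Finsupp.single ((cell φ j).comp τ) 1) ∈ N)
    {c : SChain k (m + 1) (Attach φ)} (hc : c ∈ Ch k (openCells φ B) (m + 1)) : f c ∈ N := by
  refine apply_mem_of_mem_Ch (fun σ hσ => ?_) hc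
  obtain ⟨j, hj, τ, hτ, rfl⟩ := exists_lift hσ
  exact h j hj τ hτ

theorem eq_of_openCells {B : Set J} {m : ℕ} {M : Type*} [AddCommGroup M] [Module k M]
    {f g : SChain k (m + 1) (Attach φ) →ₗ[k] M}
    (h : ∀ j ∈ B, ∀ τ : C(stdSimplex ℝ (Fin (m + 1)), Simp d), (∀ q, τ q ∉ bdry d) →
      f (Finsupp.single ((cell φ j).comp τ) 1) = g (Finsupp.single ((cell φ j).comp τ) 1))
    {c : SChain k (m + 1) (Attach φ)} (hc : c ∈ Ch k (openCells φ B) (m + 1)) : f c = g c := by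
  have := induction_openCells (f := f - g) (N := ⊥) (fun j hj τ hτ => by
    rw [LinearMap.sub_apply, h j hj τ hτ, sub_self]; exact Submodule.zero_mem _) hc
  rwa [Submodule.mem_bot, LinearMap.sub_apply, sub_eq_zero] at this

theorem total_lift {B : Set J} {m : ℕ} {c : SChain k (m + 1) (Attach φ)}
    (hc : c ∈ Ch k (openCells φ B) (m + 1)) : total φ k (m + 1) (lift φ k m c) = c :=
  eq_of_openCells (f := total φ k (m + 1) ∘ₗ lift φ k m) (g := LinearMap.id)
    (fun j _ τ hτ => by
      rw [LinearMap.comp_apply, lift_single k j hτ, total_single, map_single]; rfl) hc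

/-- Faces of a simplex in an open cell stay in that cell. The simplices have at least two vertices,
so that their faces are nonempty and determine the cell. -/
theorem lift_d {B : Set J} {m : ℕ} {c : SChain k (m + 2) (Attach φ)}
    (hc : c ∈ Ch k (openCells φ B) (m + 2)) (j : J) :
    lift φ k m (SChain.d k (m + 1) c) j = SChain.d k (m + 1) (lift φ k (m + 1) c j) := by
  refine eq_of_openCells (f := Finsupp.lapply j ∘ₗ lift φ k m ∘ₗ SChain.d k (m + 1))
    (g := SChain.d k (m + 1) ∘ₗ Finsupp.lapply j ∘ₗ lift φ k (m + 1)) (fun j' _ τ hτ => ?_) hc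
  simp only [LinearMap.comp_apply]
  rw [lift_single k j' hτ, d_single, map_sum, map_sum]
  simp only [map_smul, ContinuousMap.comp_assoc]
  have h1 : ∀ i : Fin (m + 2), lift φ k m (Finsupp.single ((cell φ j').comp
      (τ.comp (face (m + 1) i))) 1) = Finsupp.single j' (Finsupp.single (τ.comp (face (m + 1) i)) 1) :=
    fun i => lift_single k j' fun q => hτ _
  simp only [h1, Finsupp.lapply_apply]
  classical
  by_cases hj : j' = j
  · subst hj
    simp only [Finsupp.single_eq_same, d_single]
  · simp [Finsupp.single_eq_of_ne (Ne.symm hj)]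

theorem lift_mem_outer {B : Set J} {m : ℕ} {c : SChain k (m + 1) (Attach φ)}
    (hc : c ∈ Ch k (openCells φ B ∩ {x | 1 / 2 < radius x}) (m + 1)) (j : J) :
    lift φ k m c j ∈ Ch k (outer d) (m + 1) := by
  refine apply_mem_of_mem_Ch (f := Finsupp.lapply j ∘ₗ lift φ k m) (fun σ hσ => ?_) hc
  obtain ⟨j', hj', τ, hτ, rfl⟩ := exists_lift fun q => (hσ q).1
  rw [LinearMap.comp_apply, lift_single k j' hτ, Finsupp.lapply_apply]
  classical
  rw [Finsupp.single_apply]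
  split_ifs
  · refine single_mem_Ch (fun q => ?_) _
    have h := (hσ q).2
    rwa [Set.mem_ofPred_eq, ContinuousMap.comp_apply, radius_cell] at h
  · exact Submodule.zero_mem _

theorem lift_eq_zero {B : Set J} {m : ℕ} {c : SChain k (m + 1) (Attach φ)}
    (hc : c ∈ Ch k (openCells φ B) (m + 1)) {j : J} (hj : j ∉ B) : lift φ k m c j = 0 := by
  refine eq_of_openCells (f := Finsupp.lapply j ∘ₗ lift φ k m) (g := 0)
    (fun j' hj' τ hτ => ?_) hc
  classical
  have hne : ¬ j' = j := fun h => hj (h ▸ hj')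
  rw [LinearMap.comp_apply, lift_single k j' hτ, Finsupp.lapply_apply, LinearMap.zero_apply,
    Finsupp.single_apply, if_neg hne]

theorem lift_map_cell {m : ℕ} {c : SChain k (m + 1) (Simp d)}
    (hc : c ∈ Ch k (bdry d)ᶜ (m + 1)) (j : J) :
    lift φ k m (SChain.map k (cell φ j) (m + 1) c) = Finsupp.single j c := by
  refine eq_of_mem_Ch (f := lift φ k m ∘ₗ SChain.map k (cell φ j) (m + 1))
    (g := (Finsupp.lsingle j : SChain k (m + 1) (Simp d) →ₗ[k] _)) (fun σ hσ => ?_) hc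
  rw [LinearMap.comp_apply, map_single, lift_single k j hσ, Finsupp.lsingle_apply]

end Lift

end Attach

end Attach

/-! ### Relative homology of a space with cells attached -/

namespace Attach

universe v

variable {A : Type u} [TopologicalSpace A] {J : Type v} {d : ℕ} {φ : J → C(bdry d, A)}

/-- A subset which contains the cells with index in `B`, meets the other cells only near their
boundary, and is preserved by the radial expansion. -/
structure Adapted (S : Set (Attach φ)) (B : Set J) : Prop where
  cell_mem : ∀ j ∈ B, ∀ p, cell φ j p ∈ S
  half_lt : ∀ j ∉ B, ∀ p, cell φ j p ∈ S → 1 / 2 < rad p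
  expand_mem : ∀ x ∈ S, ∀ t, expandHtpy φ (x, t) ∈ S

variable (k : Type*) [Field k]

variable (φ) in
/-- The combination of characteristic maps of cells, as a chain with `m` vertices; zero if
`m ≠ d + 1`. -/
noncomputable def cellSum (v : Fin (d + 1) → Simp d) (m : ℕ) :
    (J →₀ k) →ₗ[k] SChain k m (Attach φ) :=
  Finsupp.linearCombination k fun j => SChain.map k (cell φ j) m (cellChain k v m)

theorem cellSum_single (v : Fin (d + 1) → Simp d) (m : ℕ) (j : J) (a : k) :
    cellSum φ k v m (Finsupp.single j a) =
      a • SChain.map k (cell φ j) m (cellChain k v m) := by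
  simp [cellSum]

variable {k}

theorem cellSum_mem {v : Fin (d + 1) → Simp d} {m : ℕ} {B : Set J} {c : J →₀ k}
    (hc : c ∈ Finsupp.supported k k B) {N : Submodule k (SChain k m (Attach φ))}
    (h : ∀ j ∈ B, SChain.map k (cell φ j) m (cellChain k v m) ∈ N) : cellSum φ k v m c ∈ N := by
  rw [cellSum, Finsupp.linearCombination_apply]
  exact Submodule.sum_mem _ fun j hj => Submodule.smul_mem _ _ (h j (hc hj))

theorem cellChain_stdVertices_self :
    cellChain k (stdVertices (d + 1)) (d + 1) = Finsupp.single (ContinuousMap.id _) 1 := by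
  rw [cellChain_self, affineSimplex_stdVertices]

theorem rad_face_eq_one (j : Fin (d + 1)) (p : stdSimplex ℝ (Fin d)) : rad (face d j p) = 1 := by
  rw [rad_eq_one_iff]
  refine ⟨j, ?_⟩
  change stdSimplex.map j.succAbove p j = 0
  rw [stdSimplex.map_coe, FunOnFinite.linearMap_apply_apply]
  exact Finset.sum_eq_zero fun l hl => absurd (Finset.mem_filter.1 hl).2 (Fin.succAbove_ne j l)

theorem d_cellChain_mem (m : ℕ) :
    SChain.d k m (cellChain k (stdVertices (d + 1)) (m + 1)) ∈ Ch k (bdry d) m := by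
  by_cases h : m = d
  · subst h
    rw [cellChain_stdVertices_self, d_single]
    exact Submodule.sum_mem _ fun j _ => Submodule.smul_mem _ _
      (single_mem_Ch (fun p => rad_face_eq_one j p) _)
  · rw [cellChain_of_ne _ (by omega), map_zero]
    exact Submodule.zero_mem _

variable {S : Set (Attach φ)} {B : Set J}

theorem Adapted.base_image_subset :
    base φ '' (base φ ⁻¹' S) ⊆ S ∩ {x | 1 / 2 < radius x} := by
  rintro _ ⟨a, ha, rfl⟩
  exact ⟨ha, by rw [Set.mem_ofPred_eq, radius_base]; norm_num⟩

/-- The cover along which chains are cut: one part retracts to the original space, the other splits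
into cells. -/
theorem Adapted.subset_union (h : Adapted S B) :
    S ⊆ {x | 1 / 2 < radius x} ∪ openCells φ B := by
  intro x hx
  rcases cases x with ⟨a, rfl⟩ | ⟨j, p, hp, rfl⟩
  · exact Or.inl (by rw [Set.mem_ofPred_eq, radius_base]; norm_num)
  · by_cases hj : j ∈ B
    · exact Or.inr ⟨j, hj, p, hp, rfl⟩
    · exact Or.inl (by rw [Set.mem_ofPred_eq, radius_cell]; exact h.half_lt j hj p hx)

theorem isOpen_half_lt_radius : IsOpen {x : Attach φ | 1 / 2 < radius x} :=
  isOpen_lt continuous_const radius.continuous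

theorem Adapted.map_cell_mem (h : Adapted S B) {j : J} (hj : j ∈ B) {m : ℕ}
    (c : SChain k m (Simp d)) : SChain.map k (cell φ j) m c ∈ Ch k S m :=
  map_mem_Ch (S := Set.univ) (fun p _ => h.cell_mem j hj p) (mem_Ch_univ c)

theorem Adapted.map_cell_mem_outer (h : Adapted S B) {j : J} (hj : j ∈ B) {m : ℕ}
    {c : SChain k m (Simp d)} (hc : c ∈ Ch k (outer d) m) :
    SChain.map k (cell φ j) m c ∈ Ch k (S ∩ {x | 1 / 2 < radius x}) m := by
  refine map_mem_Ch (fun p hp => ?_) hc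
  exact ⟨h.cell_mem j hj p, by rw [Set.mem_ofPred_eq, radius_cell]; exact hp⟩

theorem Adapted.map_cell_mem_base (h : Adapted S B) {j : J} (hj : j ∈ B) {m : ℕ}
    {c : SChain k m (Simp d)} (hc : c ∈ Ch k (bdry d) m) :
    SChain.map k (cell φ j) m c ∈ Ch k (base φ '' (base φ ⁻¹' S)) m := by
  refine map_mem_Ch (fun p hp => ?_) hc
  have := h.cell_mem j hj p
  rw [cell_of_mem j hp] at this ⊢
  exact ⟨_, this, rfl⟩

theorem isEmbedding_base : Topology.IsEmbedding (base φ) := isClosedEmbedding_base.isEmbedding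

/-- A relative cycle is homologous to the sum of a chain in the original space and a combination
of cells. -/
theorem Adapted.exists_decomposition (h : Adapted S B) {m : ℕ} (hm : m + 1 ≤ d)
    {z : SChain k (m + 2) (Attach φ)} (hz : z ∈ Ch k S (m + 2))
    (hdz : SChain.d k (m + 1) z ∈ Ch k (base φ '' (base φ ⁻¹' S)) (m + 1)) :
    ∃ a ∈ Ch k (base φ ⁻¹' S) (m + 2), ∃ c ∈ Finsupp.supported k k B,
      ∃ w ∈ Ch k S (m + 3), z = SChain.map k (base φ) (m + 2) a +
        cellSum φ k (stdVertices (d + 1)) (m + 2) c + SChain.d k (m + 2) w := by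
  classical
  obtain ⟨N, u, hu, v, hv, huv⟩ := exists_subdiv_mem (isOpen_half_lt_radius (φ := φ))
    (isOpen_openCells B) h.subset_union hz
  have hv' : v ∈ Ch k (openCells φ B) (m + 2) := Ch_weaken hv fun x hx => hx.2
  have hdv : SChain.d k (m + 1) v ∈ Ch k (S ∩ {x | 1 / 2 < radius x}) (m + 1) := by
    have : SChain.d k (m + 1) v =
        subdiv k N (m + 1) (SChain.d k (m + 1) z) - SChain.d k (m + 1) u := by
      rw [← d_subdiv, huv, map_add, add_sub_cancel_left]
    rw [this]
    exact Submodule.sub_mem _ (subdiv_mem_Ch N (Ch_mono Adapted.base_image_subset _ hdz))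
      (d_mem_Ch hu)
  have hdv' : SChain.d k (m + 1) v ∈ Ch k (openCells φ B ∩ {x | 1 / 2 < radius x}) (m + 1) :=
    Ch_weaken (mem_Ch_inter (d_mem_Ch hv') hdv) fun x hx => ⟨hx.1, hx.2.2⟩
  -- The part in the open cells is, in each cell, a cycle relative to the outer region. There it is
  -- an outer chain plus a multiple of the standard simplex, up to a boundary.
  have hloc : ∀ j, ∃ y ∈ Ch k (outer d) (m + 2), ∃ a : k, ∃ w : SChain k (m + 3) (Simp d),
      lift φ k (m + 1) v j = y + a • cellChain k (stdVertices (d + 1)) (m + 2) +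
        SChain.d k (m + 2) w := by
    intro j
    refine exists_local_decomposition nearVertices_std hm ?_
    rw [← lift_d hv' j]
    exact lift_mem_outer hdv' j
  choose y hy a w hyaw using hloc
  set s := (lift φ k (m + 1) v).support with hs
  have hsB : ∀ j ∈ s, j ∈ B := by
    intro j hj
    by_contra hjB
    exact Finsupp.mem_support_iff.1 hj (lift_eq_zero hv' hjB)
  have hvsum : v = ∑ j ∈ s, SChain.map k (cell φ j) (m + 2) (y j) +
      cellSum φ k (stdVertices (d + 1)) (m + 2) (∑ j ∈ s, Finsupp.single j (a j)) +
      SChain.d k (m + 2) (∑ j ∈ s, SChain.map k (cell φ j) (m + 3) (w j)) := by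
    conv_lhs => rw [← total_lift hv', total, Finsupp.lsum_apply, Finsupp.sum]
    rw [map_sum, map_sum, ← Finset.sum_add_distrib, ← Finset.sum_add_distrib]
    refine Finset.sum_congr rfl fun j _ => ?_
    rw [hyaw j, map_add, map_add, map_smul, cellSum_single, d_map]
  set c : J →₀ k := ∑ j ∈ s, Finsupp.single j (a j) with hcdef
  have hc : c ∈ Finsupp.supported k k B :=
    Submodule.sum_mem _ fun j hj => Finsupp.single_mem_supported k _ (hsB j hj)
  have hY : ∑ j ∈ s, SChain.map k (cell φ j) (m + 2) (y j) ∈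
      Ch k (S ∩ {x | 1 / 2 < radius x}) (m + 2) :=
    Submodule.sum_mem _ fun j hj => h.map_cell_mem_outer (hsB j hj) (hy j)
  have hW : ∑ j ∈ s, SChain.map k (cell φ j) (m + 3) (w j) ∈ Ch k S (m + 3) :=
    Submodule.sum_mem _ fun j hj => h.map_cell_mem (hsB j hj) _
  set Y := ∑ j ∈ s, SChain.map k (cell φ j) (m + 2) (y j) with hYdef
  set W := ∑ j ∈ s, SChain.map k (cell φ j) (m + 3) (w j) with hWdef
  set T := subdivHomotopy k N (m + 1) (SChain.d k (m + 1) z) with hT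
  have hTm : T ∈ Ch k (S ∩ {x | 1 / 2 < radius x}) (m + 2) :=
    subdivHomotopy_mem_Ch N (Ch_mono Adapted.base_image_subset _ hdz)
  -- All terms in the outer region are collected in `x`. Its boundary lies in the original space,
  -- because those of `z` and of the attached simplices do.
  set x := u + Y + T with hx
  have hxm : x ∈ Ch k (S ∩ {x | 1 / 2 < radius x}) (m + 2) :=
    Submodule.add_mem _ (Submodule.add_mem _ hu hY) hTm
  have hz' : z = x + cellSum φ k (stdVertices (d + 1)) (m + 2) c +
      SChain.d k (m + 2) (W + subdivHomotopy k N (m + 2) z) := by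
    rw [map_add, d_subdivHomotopy, huv, hx, ← hT]
    nth_rewrite 1 [hvsum]
    abel
  have hdx : SChain.d k (m + 1) x ∈ Ch k (base φ '' (base φ ⁻¹' S)) (m + 1) := by
    have hd2 : SChain.d k (m + 1) x = SChain.d k (m + 1) z -
        SChain.d k (m + 1) (cellSum φ k (stdVertices (d + 1)) (m + 2) c) := by
      have h' := congrArg (SChain.d k (m + 1)) hz'
      rw [map_add, map_add, d_d, add_zero] at h'
      rw [h', add_sub_cancel_right]
    rw [hd2]
    refine Submodule.sub_mem _ hdz ?_
    refine cellSum_mem (N := (Ch k (base φ '' (base φ ⁻¹' S)) (m + 1)).comap (SChain.d k (m + 1)))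
      hc fun j hj => ?_
    rw [Submodule.mem_comap, d_map]
    exact h.map_cell_mem_base hj (d_cellChain_mem _)
  -- The radial expansion carries `x` into the original space. It fixes that space pointwise, so the
  -- prism over the boundary of `x` also stays there.
  have hP := d_prismOp k (expandHtpy φ) (m + 1) x
  have e0 : atTime (expandHtpy φ) 0 = ContinuousMap.id _ := ContinuousMap.ext expandHtpy_zero
  rw [e0, map_id] at hP
  have h1 : SChain.map k (atTime (expandHtpy φ) 1) (m + 2) x ∈
      Ch k (base φ '' (base φ ⁻¹' S)) (m + 2) := by
    refine map_mem_Ch (fun q hq => ?_) hxm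
    have hqS := h.expand_mem q hq.1 1
    change expandHtpy φ (q, 1) ∈ _
    rcases cases q with ⟨a, rfl⟩ | ⟨j, p, hp, rfl⟩
    · exact ⟨a, hq.1, (expandHtpy_base a 1).symm⟩
    · have hr := hq.2
      rw [Set.mem_ofPred_eq, radius_cell] at hr
      rw [expandHtpy_cell] at hqS ⊢
      rw [cell_of_mem j (rad_expand_one hr.le)] at hqS ⊢
      exact ⟨_, hqS, rfl⟩
  have h2 : prismOp k (expandHtpy φ) (m + 1) (SChain.d k (m + 1) x) ∈
      Ch k (base φ '' (base φ ⁻¹' S)) (m + 2) := by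
    refine prismOp_mem_Ch (fun q hq t => ?_) hdx
    obtain ⟨a, ha, rfl⟩ := hq
    exact ⟨a, ha, (expandHtpy_base a t).symm⟩
  have h3 : prismOp k (expandHtpy φ) (m + 2) x ∈ Ch k S (m + 3) :=
    prismOp_mem_Ch h.expand_mem (Ch_weaken hxm fun q hq => hq.1)
  obtain ⟨a', ha', haeq⟩ := exists_map_eq_of_mem_Ch isEmbedding_base (Submodule.sub_mem _ h1 h2)
  refine ⟨a', ha', c, hc, W + subdivHomotopy k N (m + 2) z - prismOp k (expandHtpy φ) (m + 2) x,
    Submodule.sub_mem _ (Submodule.add_mem _ hW (subdivHomotopy_mem_Ch N hz)) h3, ?_⟩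
  rw [haeq, map_sub, hP]
  nth_rewrite 1 [hz']
  abel

/-- A relation for the subdivided simplex is turned into one for the simplex itself: the homotopy on
the boundary lies in the outer region, so `local_eq_zero` still applies. -/
theorem local_subdiv_eq_zero {m : ℕ} {a : k} {N : ℕ} {w : SChain k (m + 3) (Simp (m + 1))}
    (h : a • subdiv k N (m + 2) (cellChain k (innerVertices (m + 1)) (m + 2)) +
      SChain.d k (m + 2) w ∈ Ch k (outer (m + 1)) (m + 2))
    (hκ : SChain.d k (m + 1) (cellChain k (innerVertices (m + 1)) (m + 2)) ∈
      Ch k (outer (m + 1)) (m + 1)) : a = 0 := by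
  set κ := cellChain k (innerVertices (m + 1)) (m + 2) with hκdef
  refine local_eq_zero (d := m + 1) nearVertices_inner (a := a)
    (y := a • subdiv k N (m + 2) κ + SChain.d k (m + 2) w +
      a • subdivHomotopy k N (m + 1) (SChain.d k (m + 1) κ))
    (Submodule.add_mem _ h (Submodule.smul_mem _ _ (subdivHomotopy_mem_Ch N hκ))) ?_
  have h1 := d_d k (m + 1) (subdivHomotopy k N (m + 2) κ)
  rw [d_subdivHomotopy, map_sub, map_sub, sub_sub, sub_eq_zero] at h1
  rw [map_add, map_add, d_d, add_zero, map_smul, map_smul, ← smul_add, ← h1]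

theorem d_innerChain_mem :
    SChain.d k d (cellChain k (innerVertices d) (d + 1)) ∈ Ch k (outer d) d := by
  have h1 : SChain.map k (incl d) d (SChain.d k d (cellChain k (innerVertices d) (d + 1))) ∈
      Ch k (incl d '' outer d) d := by
    rw [← d_map, map_incl_cellChain, affChain_self, d_aff, image_outer]
    refine Submodule.sum_mem _ fun j _ => Submodule.smul_mem _ _ (Ch_mono ?_ _
      (nearVertices_inner.faceCover.face_mem j))
    exact Set.inter_subset_inter_right _ (Set.subset_iUnion _ j)
  have h2 := mem_Ch_of_map_mem_Ch isEmbedding_incl.injective h1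
  rwa [Set.preimage_image_eq _ isEmbedding_incl.injective] at h2

/-- The cells are independent in the relative homology. -/
theorem Adapted.eq_zero_of_mem (h : Adapted S B) {m : ℕ} (hm : d = m + 1) {c : J →₀ k}
    (hc : c ∈ Finsupp.supported k k B) {w : SChain k (m + 3) (Attach φ)} (hw : w ∈ Ch k S (m + 3))
    (hcw : cellSum φ k (stdVertices (d + 1)) (m + 2) c + SChain.d k (m + 2) w ∈
      Ch k (base φ '' (base φ ⁻¹' S)) (m + 2)) : c = 0 := by
  classical
  subst hm
  -- The standard simplex touches the boundary and has no lift to the open cell. It is replaced by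
  -- the smaller copy `κ`, which represents the same local class up to a scalar `a`.
  set κ := cellChain k (innerVertices (m + 1)) (m + 2) with hκ
  have hκd : SChain.d k (m + 1) κ ∈ Ch k (outer (m + 1)) (m + 1) := d_innerChain_mem
  have hκb : κ ∈ Ch k (bdry (m + 1))ᶜ (m + 2) := by
    rw [hκ, cellChain_self]
    exact single_mem_Ch (fun p => notMem_bdry_iff.2 (rad_affineSimplex_innerVertices_lt p)) _
  obtain ⟨y, hy, a, w', hyaw⟩ := exists_local_decomposition (k := k) (d := m + 1) (m := m + 1)
    nearVertices_inner le_rfl (z := cellChain k (stdVertices (m + 2)) (m + 2))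
    (Ch_weaken (d_cellChain_mem _) fun p hp => by
      change 1 / 2 < rad p
      rw [show rad p = 1 from hp]; norm_num)
  rw [← hκ] at hyaw
  -- Otherwise the boundary of the standard simplex would bound in the outer region.
  have ha : a ≠ 0 := by
    rintro rfl
    refine one_ne_zero (α := k) (local_eq_zero (d := m + 1) nearVertices_std (a := 1) hy ?_)
    rw [hyaw, one_smul, zero_smul, add_zero, map_add, d_d, add_zero]
  set W := w + ∑ j ∈ c.support, c j • SChain.map k (cell φ j) (m + 3) w' with hW
  have hWm : W ∈ Ch k S (m + 3) := Submodule.add_mem _ hw (Submodule.sum_mem _ fun j hj =>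
    Submodule.smul_mem _ _ (h.map_cell_mem (hc hj) _))
  set ζ := ∑ j ∈ c.support, (c j * a) • SChain.map k (cell φ j) (m + 2) κ with hζ
  have hsum : cellSum φ k (stdVertices (m + 1 + 1)) (m + 2) c =
      ∑ j ∈ c.support, c j • SChain.map k (cell φ j) (m + 2) y + ζ +
        SChain.d k (m + 2) (∑ j ∈ c.support, c j • SChain.map k (cell φ j) (m + 3) w') := by
    rw [cellSum, Finsupp.linearCombination_apply, Finsupp.sum, hζ, map_sum,
      ← Finset.sum_add_distrib, ← Finset.sum_add_distrib]
    refine Finset.sum_congr rfl fun j _ => ?_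
    rw [hyaw, map_add, map_add, map_smul, map_smul, d_map, smul_add, smul_add, smul_smul]
  have hζW : ζ + SChain.d k (m + 2) W ∈ Ch k (S ∩ {x | 1 / 2 < radius x}) (m + 2) := by
    have : ζ + SChain.d k (m + 2) W =
        (cellSum φ k (stdVertices (m + 1 + 1)) (m + 2) c + SChain.d k (m + 2) w) -
          ∑ j ∈ c.support, c j • SChain.map k (cell φ j) (m + 2) y := by
      rw [hsum, hW, map_add]
      abel
    rw [this]
    exact Submodule.sub_mem _ (Ch_mono Adapted.base_image_subset _ hcw)
      (Submodule.sum_mem _ fun j hj => Submodule.smul_mem _ _ (h.map_cell_mem_outer (hc hj) hy))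
  obtain ⟨N, u, hu, v, hv, huv⟩ := exists_subdiv_mem (isOpen_half_lt_radius (φ := φ))
    (isOpen_openCells B) h.subset_union hWm
  have hv' : v ∈ Ch k (openCells φ B) (m + 3) := Ch_weaken hv fun x hx => hx.2
  have hsubζ : subdiv k N (m + 2) ζ = ∑ j ∈ c.support,
      (c j * a) • SChain.map k (cell φ j) (m + 2) (subdiv k N (m + 2) κ) := by
    rw [hζ, map_sum]
    exact Finset.sum_congr rfl fun j _ => by rw [map_smul, map_subdiv]
  have hκs : subdiv k N (m + 2) κ ∈ Ch k (bdry (m + 1))ᶜ (m + 2) := subdiv_mem_Ch N hκb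
  -- The chain `f` lies in the open cells and in the outer region. Its component in cell `j` shows
  -- that `c j * a` times the subdivision of `κ` is, modulo a boundary, an outer chain, so this
  -- coefficient is zero.
  set f := subdiv k N (m + 2) ζ + SChain.d k (m + 2) v with hf
  have hfU : f ∈ Ch k (S ∩ {x | 1 / 2 < radius x}) (m + 2) := by
    have : f = subdiv k N (m + 2) (ζ + SChain.d k (m + 2) W) - SChain.d k (m + 2) u := by
      rw [map_add, ← d_subdiv, huv, map_add, hf]
      abel
    rw [this]
    exact Submodule.sub_mem _ (subdiv_mem_Ch N hζW) (d_mem_Ch hu)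
  have hfV : f ∈ Ch k (openCells φ B) (m + 2) := by
    refine Submodule.add_mem _ ?_ (d_mem_Ch hv')
    rw [hsubζ]
    refine Submodule.sum_mem _ fun j hj => Submodule.smul_mem _ _ (map_mem_Ch (fun p hp => ?_) hκs)
    exact ⟨j, hc hj, p, hp, rfl⟩
  have hfUV : f ∈ Ch k (openCells φ B ∩ {x | 1 / 2 < radius x}) (m + 2) :=
    Ch_weaken (mem_Ch_inter hfV hfU) fun x hx => ⟨hx.1, hx.2.2⟩
  ext j
  rw [Finsupp.zero_apply]
  by_contra hj
  have hjs : j ∈ c.support := Finsupp.mem_support_iff.2 hj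
  have hlift : lift φ k (m + 1) f j = (c j * a) • subdiv k N (m + 2) κ +
      SChain.d k (m + 2) (lift φ k (m + 2) v j) := by
    rw [hf, map_add, Finsupp.add_apply, lift_d hv', hsubζ, map_sum]
    congr 1
    simp only [map_smul, lift_map_cell hκs]
    rw [Finsupp.finsetSum_apply, Finset.sum_eq_single j]
    · simp
    · intro j' _ hj'
      simp [hj']
    · exact fun h => absurd hjs h
  have hmem := lift_mem_outer hfUV j
  rw [hlift] at hmem
  exact mul_ne_zero hj ha (local_subdiv_eq_zero hmem hκd)

end Attach

/-! ### Extension of functions over attached cells -/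

namespace Cell

variable {d n : ℕ}

/-- The extension of a function from the boundary of a simplex which interpolates radially
between the boundary values and a constant value on the central part. -/
noncomputable def height (g : C(bdry d, Fin n → ℝ)) (c : Fin n → ℝ) : C(Simp d, Fin n → ℝ) :=
  -- The Tietze extension of `g` only makes the formula meaningful everywhere. For radius at most `1
  -- / 2` its coefficient is zero, and beyond that `expand (p, 1)` is on the boundary, where it
  -- equals `g`.
  ⟨fun p => c + max 0 (2 * rad p - 1) •
    ((g.exists_restrict_eq (isClosed_eq continuous_rad continuous_const)).choose (expand (p, 1)) - c),
    by have := continuous_rad (d := d); fun_prop⟩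

variable (g : C(bdry d, Fin n → ℝ)) (c : Fin n → ℝ)

theorem height_of_rad_le {p : Simp d} (h : rad p ≤ 1 / 2) : height g c p = c := by
  change c + max 0 (2 * rad p - 1) • _ = c
  rw [max_eq_left (by linarith), zero_smul, add_zero]

theorem height_of_le_rad {p : Simp d} (h : 1 / 2 ≤ rad p) :
    height g c p = c + (2 * rad p - 1) • (g ⟨expand (p, 1), rad_expand_one h⟩ - c) := by
  change c + max 0 (2 * rad p - 1) • _ = _
  rw [max_eq_right (by linarith)]
  congr 3
  exact DFunLike.congr_fun
    (g.exists_restrict_eq (isClosed_eq continuous_rad continuous_const)).choose_spec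
    ⟨expand (p, 1), rad_expand_one h⟩

theorem height_bdry (p : bdry d) : height g c p = g p := by
  have h : rad (p : Simp d) = 1 := p.2
  have h' : 1 / 2 ≤ rad (p : Simp d) := by rw [h]; norm_num
  have hp : (⟨expand (p.1, 1), rad_expand_one h'⟩ : bdry d) = p :=
    Subtype.ext (expand_of_rad_eq_one h 1)
  have h1 : 2 * rad (p : Simp d) - 1 = 1 := by rw [h]; norm_num
  rw [height_of_le_rad g c h', h1, one_smul, add_sub_cancel, hp]

variable {g c}

theorem height_le (h : ∀ p, g p ≤ c) (p : Simp d) : height g c p ≤ c := by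
  rcases le_total (rad p) (1 / 2) with hp | hp
  · rw [height_of_rad_le g c hp]
  · rw [height_of_le_rad g c hp]
    exact add_le_of_nonpos_right
      (smul_nonpos_of_nonneg_of_nonpos (by linarith) (sub_nonpos.2 (h _)))

/-- Beyond radius `1 / 2` the function is affine along each ray, descending from `c` to the boundary
value. So its sublevel sets are stable under radial expansion. -/
theorem height_expand_le (h : ∀ p, g p ≤ c) (p : Simp d) (t : unitInterval) :
    height g c (expand (p, t)) ≤ height g c p := by
  rcases le_total (rad p) (1 / 2) with hp | hp
  · rw [height_of_rad_le g c hp]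
    exact height_le h _
  · have hp' := hp.trans (rad_le_rad_expand p t)
    rw [height_of_le_rad g c hp, height_of_le_rad g c hp']
    have : (⟨expand (expand (p, t), 1), rad_expand_one hp'⟩ : bdry d) =
        ⟨expand (p, 1), rad_expand_one hp⟩ := Subtype.ext (expand_expand_one hp t)
    rw [this]
    refine add_le_add_right (fun j => ?_) c
    have h1 := sub_nonpos.2 (h ⟨expand (p, 1), rad_expand_one hp⟩ j)
    have h2 := rad_le_rad_expand p t
    simp only [Pi.smul_apply, Pi.sub_apply, smul_eq_mul]
    nlinarith

/-- At a given point both functions are the same convex combination, with weights `2 - 2 * rad p`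
and `2 * rad p - 1`, of the central value and the value at the end of the ray. -/
theorem norm_height_sub_le {g' : C(bdry d, Fin n → ℝ)} {c' : Fin n → ℝ} {ε : ℝ}
    (hg : ∀ p, ‖g p - g' p‖ ≤ ε) (hc : ‖c - c'‖ ≤ ε) (p : Simp d) :
    ‖height g c p - height g' c' p‖ ≤ ε := by
  rcases le_total (rad p) (1 / 2) with hp | hp
  · rwa [height_of_rad_le g c hp, height_of_rad_le g' c' hp]
  · rw [height_of_le_rad g c hp, height_of_le_rad g' c' hp]
    set q : bdry d := ⟨expand (p, 1), rad_expand_one hp⟩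
    have e : c + (2 * rad p - 1) • (g q - c) - (c' + (2 * rad p - 1) • (g' q - c')) =
        (2 - 2 * rad p) • (c - c') + (2 * rad p - 1) • (g q - g' q) := by module
    have h1 := rad_le_one p
    have h2 := norm_nonneg (c - c')
    rw [e]
    refine (norm_add_le _ _).trans ?_
    rw [norm_smul, norm_smul, Real.norm_of_nonneg (by linarith), Real.norm_of_nonneg (by linarith)]
    nlinarith [hg q]

end Cell

/-! ### Functions on a space with cells attached -/

namespace Attach

universe v

variable {A : Type u} [TopologicalSpace A] {J : Type v} {d n : ℕ} {φ : J → C(bdry d, A)}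

/-- The extension of a function to the attached cells, with given values at the centers. -/
noncomputable def height (f : C(A, Fin n → ℝ)) (c : J → Fin n → ℝ) : C(Attach φ, Fin n → ℝ) :=
  desc f (fun j => Cell.height (f.comp (φ j)) (c j)) fun _ p => height_bdry _ _ p

variable {f : C(A, Fin n → ℝ)} {c : J → Fin n → ℝ}

theorem height_cell (j : J) (p : Simp d) :
    height f c (cell φ j p) = Cell.height (f.comp (φ j)) (c j) p := desc_cell _ _ _ _ _

/-- The function equals `c j` on the central part of cell `j` and nowhere exceeds it in that cell.
Thus the cell is contained in the sublevel set if `c j ≤ b`, and meets it only in the outer region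
if not. -/
theorem adapted_height (h : ∀ j p, f (φ j p) ≤ c j) (b : Fin n → ℝ) :
    Adapted {x : Attach φ | height f c x ≤ b} {j | c j ≤ b} where
  cell_mem j hj p := by
    rw [Set.mem_ofPred_eq, height_cell]
    exact (Cell.height_le (h j) p).trans hj
  half_lt j hj p hp := by
    by_contra hr
    rw [Set.mem_ofPred_eq, height_cell, height_of_rad_le _ _ (not_lt.1 hr)] at hp
    exact hj hp
  expand_mem x hx t := by
    rcases cases x with ⟨a, rfl⟩ | ⟨j, p, -, rfl⟩
    · exact hx
    · rw [Set.mem_ofPred_eq, height_cell] at hx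
      rw [Set.mem_ofPred_eq, expandHtpy_cell, height_cell]
      exact (height_expand_le (h j) p t).trans hx

theorem height_center (j : J) :
    height f c (cell φ j stdSimplex.barycenter) = c j := by
  rw [height_cell]
  refine height_of_rad_le _ _ ?_
  obtain ⟨l, hl⟩ := exists_eq_minCoord (stdSimplex.barycenter : Simp d)
  have hb : (stdSimplex.barycenter : Simp d) l = ((d : ℝ) + 1)⁻¹ := by
    change (stdSimplex.barycenter : Simp d).val l = _
    rw [stdSimplex.barycenter_apply]
    simp
  rw [rad, ← hl, hb, mul_inv_cancel₀ (by positivity)]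
  norm_num

theorem norm_height_sub_le {f' : C(A, Fin n → ℝ)} {c' : J → Fin n → ℝ} {ε : ℝ}
    (hf : ∀ a, ‖f a - f' a‖ ≤ ε) (hc : ∀ j, ‖c j - c' j‖ ≤ ε) (x : Attach φ) :
    ‖height f c x - height f' c' x‖ ≤ ε := by
  rcases cases x with ⟨a, rfl⟩ | ⟨j, p, -, rfl⟩
  · exact hf a
  · rw [height_cell, height_cell]
    exact Cell.norm_height_sub_le (fun q => hf (φ j q)) (hc j) p

end Attach

/-! ### Two stages of attaching cells -/

/-- Data for the construction of a complex by attaching cells of two consecutive dimensions to a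
vector space: the vertices of the lower cells, and the faces and vertices of the upper cells. -/
structure CellData (E : Type u) (i : ℕ) where
  G : Type u
  R : Type u
  vert : G → Fin (i + 1) → E
  faces : R → Fin (i + 2) → Option G
  rvert : R → Fin (i + 2) → E
  vert_face : ∀ r j g, faces r j = some g → vert g = rvert r ∘ j.succAbove

namespace CellData

variable {E : Type u} [NormedAddCommGroup E] [NormedSpace ℝ E] {i : ℕ} (D : CellData E i)

/-- The attaching map of a lower cell. -/
noncomputable def lowerMap (g : D.G) : C(bdry i, E) := (aff (D.vert g)).restrict _

/-- The space obtained by attaching the lower cells. -/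
abbrev Lower : Type u := Attach D.lowerMap

/-- The map on a face of an upper cell. -/
noncomputable def faceMap (r : D.R) (j : Fin (i + 2)) : C(Simp i, D.Lower) :=
  match D.faces r j with
  | none => (Attach.base D.lowerMap).comp (aff (D.rvert r ∘ j.succAbove))
  | some g => Attach.cell D.lowerMap g

theorem faceMap_of_none {r : D.R} {j : Fin (i + 2)} (h : D.faces r j = none) :
    D.faceMap r j = (Attach.base D.lowerMap).comp (aff (D.rvert r ∘ j.succAbove)) := by
  rw [faceMap, h]

theorem faceMap_of_some {r : D.R} {j : Fin (i + 2)} {g : D.G} (h : D.faces r j = some g) :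
    D.faceMap r j = Attach.cell D.lowerMap g := by
  rw [faceMap, h]

/-- On the boundary of a face it does not matter whether the face is a lower cell or an affine
simplex of the base: `vert_face` makes both equal to the affine map. This is why the faces fit
together. -/
theorem faceMap_bdry (r : D.R) (j : Fin (i + 2)) {p : Simp i} (hp : p ∈ bdry i) :
    D.faceMap r j p = Attach.base D.lowerMap (aff (D.rvert r ∘ j.succAbove) p) := by
  rcases h : D.faces r j with _ | g
  · rw [D.faceMap_of_none h]; rfl
  · rw [D.faceMap_of_some h, Attach.cell_of_mem g hp, ← D.vert_face r j g h]
    rfl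

end CellData

/-! ### Faces of the standard simplex -/

namespace Cell

/-- The point of a face of a simplex with the same coordinates. -/
def dropFace {i : ℕ} (j : Fin (i + 2)) (p : {p : Simp (i + 1) // p j = 0}) : Simp i :=
  ⟨fun l => p.1 (j.succAbove l), fun _ => p.1.2.1 _, by
    have := stdSimplex.sum_eq_one p.1
    rwa [Fin.sum_univ_succAbove _ j, p.2, zero_add] at this⟩

theorem continuous_dropFace {i : ℕ} (j : Fin (i + 2)) : Continuous (dropFace j) :=
  Continuous.subtype_mk (continuous_pi fun l =>
    (continuous_coord (j.succAbove l)).comp continuous_subtype_val) _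

theorem face_apply_self {i : ℕ} (j : Fin (i + 2)) (q : Simp i) : face (i + 1) j q j = 0 := by
  change stdSimplex.map j.succAbove q j = 0
  rw [stdSimplex.map_coe, FunOnFinite.linearMap_apply_apply]
  exact Finset.sum_eq_zero fun l hl => absurd (Finset.mem_filter.1 hl).2 (Fin.succAbove_ne j l)

theorem face_apply_succAbove {i : ℕ} (j : Fin (i + 2)) (q : Simp i) (l : Fin (i + 1)) :
    face (i + 1) j q (j.succAbove l) = q l := by
  change stdSimplex.map j.succAbove q (j.succAbove l) = q l
  rw [stdSimplex.map_coe, FunOnFinite.linearMap_apply_apply]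
  simp [Finset.filter_eq']

theorem dropFace_face {i : ℕ} (j : Fin (i + 2)) (q : Simp i) :
    dropFace j ⟨face (i + 1) j q, face_apply_self j q⟩ = q :=
  stdSimplex.ext (funext fun l => face_apply_succAbove j q l)

theorem face_dropFace {i : ℕ} (j : Fin (i + 2)) (p : {p : Simp (i + 1) // p j = 0}) :
    face (i + 1) j (dropFace j p) = p := by
  refine stdSimplex.ext (funext fun l => ?_)
  rcases Fin.eq_self_or_eq_succAbove j l with rfl | ⟨l, rfl⟩
  · exact (face_apply_self l _).trans p.2.symm
  · exact face_apply_succAbove j _ l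

end Cell

/-! ### The upper cells and the homology of the two-stage space -/

namespace CellData

variable {E : Type u} [NormedAddCommGroup E] [NormedSpace ℝ E] {i : ℕ} (D : CellData E i)

/-- A point on two different faces lies on the boundary of each, where both face maps are given by
the affine simplex on all vertices. -/
theorem faceMap_dropFace_eq (r : D.R) {j l : Fin (i + 2)} (p : Simp (i + 1)) (hj : p j = 0)
    (hl : p l = 0) : D.faceMap r j (dropFace j ⟨p, hj⟩) = D.faceMap r l (dropFace l ⟨p, hl⟩) := by
  by_cases hjl : j = l
  · subst hjl; rfl
  · have key : ∀ {j l : Fin (i + 2)} (hj : p j = 0) (_ : p l = 0) (_ : l ≠ j),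
        D.faceMap r j (dropFace j ⟨p, hj⟩) = Attach.base D.lowerMap (aff (D.rvert r) p) := by
      intro j l hj hl h
      obtain ⟨l', rfl⟩ := Fin.exists_succAbove_eq h
      rw [D.faceMap_bdry r j ((rad_eq_one_iff _).2 ⟨l', hl⟩), ← aff_comp_simplexMap,
        ContinuousMap.comp_apply]
      congr 2
      exact face_dropFace j ⟨p, hj⟩
    rw [key hj hl (Ne.symm hjl), key hl hj hjl]

/-- The attaching map of an upper cell. -/
noncomputable def upperMap (r : D.R) : C(bdry (i + 1), D.Lower) where
  toFun p := D.faceMap r ((rad_eq_one_iff _).1 p.2).choose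
    (dropFace _ ⟨p.1, ((rad_eq_one_iff _).1 p.2).choose_spec⟩)
  continuous_toFun := by
    -- The face chosen for a point is arbitrary, so continuity is checked on the finite closed cover
    -- by faces, on each of which the choice may be replaced by that face.
    refine (locallyFinite_of_finite fun j : Fin (i + 2) => {p : bdry (i + 1) | p.1 j = 0}).continuous
      (Set.iUnion_eq_univ_iff.2 fun p => (rad_eq_one_iff _).1 p.2) (fun j => ?_) fun j => ?_
    · exact isClosed_eq ((continuous_coord j).comp continuous_subtype_val) continuous_const
    · rw [continuousOn_iff_continuous_domRestrict]
      have : Continuous fun p : {p : bdry (i + 1) | p.1 j = 0} =>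
          D.faceMap r j (dropFace j ⟨p.1.1, p.2⟩) :=
        (D.faceMap r j).continuous.comp ((continuous_dropFace j).comp
          (Continuous.subtype_mk (continuous_subtype_val.comp continuous_subtype_val) _))
      convert this using 1
      funext p
      exact D.faceMap_dropFace_eq r _ _ p.2

theorem upperMap_face (r : D.R) (j : Fin (i + 2)) (q : Simp i)
    (h : face (i + 1) j q ∈ bdry (i + 1)) : D.upperMap r ⟨face (i + 1) j q, h⟩ = D.faceMap r j q := by
  refine (D.faceMap_dropFace_eq r _ _ (face_apply_self j q)).trans ?_
  rw [dropFace_face]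

/-- The space obtained by attaching both the lower and the upper cells. -/
abbrev Space : Type u := Attach D.upperMap

variable (k : Type*) [Field k]

/-- The spheres formed by the lower cells and the affine simplices with the same boundary. -/
noncomputable def sphere : (D.G →₀ k) →ₗ[k] SChain k (i + 1) D.Lower :=
  Finsupp.linearCombination k fun g => Finsupp.single (Attach.cell D.lowerMap g) 1 -
    SChain.map k (Attach.base D.lowerMap) (i + 1) (Finsupp.single (aff (D.vert g)) 1)

/-- The relation given by an upper cell. -/
noncomputable def relation (r : D.R) : D.G →₀ k :=
  ∑ j : Fin (i + 2), (-1 : k) ^ (j : ℕ) • (D.faces r j).elim 0 fun g => Finsupp.single g 1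

theorem sphere_single (g : D.G) (a : k) : D.sphere k (Finsupp.single g a) =
    a • (Finsupp.single (Attach.cell D.lowerMap g) 1 -
    SChain.map k (Attach.base D.lowerMap) (i + 1) (Finsupp.single (aff (D.vert g)) 1)) := by
  simp [sphere]

/-- A lower cell is attached along the boundary of the affine simplex with its vertices, so the two
boundaries cancel face by face. -/
theorem d_sphere (c : D.G →₀ k) : SChain.d k i (D.sphere k c) = 0 := by
  suffices h : SChain.d k i ∘ₗ D.sphere k = 0 from LinearMap.congr_fun h c
  refine Finsupp.lhom_ext fun g a => ?_
  rw [LinearMap.comp_apply, sphere_single, map_smul, map_sub, d_map, d_aff, d_single, map_sum,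
    ← Finset.sum_sub_distrib, Finset.sum_eq_zero, smul_zero, LinearMap.zero_apply]
  intro j _
  rw [map_smul, map_single, ← smul_sub, ← aff_comp_simplexMap]
  have : (Attach.cell D.lowerMap g).comp (face i j) =
      (Attach.base D.lowerMap).comp ((aff (D.vert g)).comp (simplexMap j.succAbove)) :=
    ContinuousMap.ext fun p => Attach.cell_of_mem g (Attach.rad_face_eq_one j p)
  rw [this, sub_self, smul_zero]

/-- A face that is a lower cell equals its sphere plus an affine simplex; an unlabelled face is an
affine simplex. So the boundary of an upper cell is the relation among spheres plus the boundary of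
an affine simplex of the base. -/
theorem d_upper (r : D.R) :
    SChain.d k (i + 1) (Finsupp.single (Attach.cell D.upperMap r) 1) =
      SChain.map k (Attach.base D.upperMap) (i + 1) (D.sphere k (D.relation k r) +
        SChain.map k (Attach.base D.lowerMap) (i + 1)
          (SChain.d k (i + 1) (Finsupp.single (aff (D.rvert r)) 1))) := by
  rw [d_single, d_aff, relation, map_sum, map_sum, ← Finset.sum_add_distrib, map_sum]
  refine Finset.sum_congr rfl fun j _ => ?_
  rw [map_smul, map_smul, ← smul_add, map_smul]
  congr 1
  have h1 : (Attach.cell D.upperMap r).comp (face (i + 1) j) =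
      (Attach.base D.upperMap).comp (D.faceMap r j) := by
    ext p
    rw [ContinuousMap.comp_apply, Attach.cell_of_mem r (Attach.rad_face_eq_one j p)]
    exact congrArg _ (D.upperMap_face r j p _)
  rw [h1, ← map_single]
  congr 1
  rcases h : D.faces r j with _ | g
  · rw [D.faceMap_of_none h, Option.elim_none, map_zero, zero_add, map_single]
  · rw [D.faceMap_of_some h, Option.elim_some, sphere_single, one_smul, D.vert_face r j g h,
      sub_add_cancel]

variable {k} {D}

/-- Subsets of the space whose homology is determined by the cells they contain. -/
structure Adapted (D : CellData E i) (S : Set D.Space) (BG : Set D.G) (BR : Set D.R) : Prop where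
  upper : Attach.Adapted S BR
  lower : Attach.Adapted (Attach.base D.upperMap ⁻¹' S) BG
  starConvex : ∃ e ∈ Attach.base D.lowerMap ⁻¹' (Attach.base D.upperMap ⁻¹' S),
    StarConvex ℝ e (Attach.base D.lowerMap ⁻¹' (Attach.base D.upperMap ⁻¹' S))
  aff_mem : ∀ g ∈ BG, ∀ p, aff (D.vert g) p ∈
    Attach.base D.lowerMap ⁻¹' (Attach.base D.upperMap ⁻¹' S)
  raff_mem : ∀ r ∈ BR, ∀ p, aff (D.rvert r) p ∈
    Attach.base D.lowerMap ⁻¹' (Attach.base D.upperMap ⁻¹' S)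
  face_mem : ∀ r ∈ BR, ∀ j g, D.faces r j = some g → g ∈ BG

variable {S : Set D.Space} {BG : Set D.G} {BR : Set D.R}

theorem cellSum_eq_sphere_add (c : D.G →₀ k) :
    Attach.cellSum D.lowerMap k (stdVertices (i + 1)) (i + 1) c = D.sphere k c +
      SChain.map k (Attach.base D.lowerMap) (i + 1)
        (Finsupp.linearCombination k (fun g => Finsupp.single (aff (D.vert g)) 1) c) := by
  suffices h : Attach.cellSum D.lowerMap k (stdVertices (i + 1)) (i + 1) = D.sphere k +
      SChain.map k (Attach.base D.lowerMap) (i + 1) ∘ₗ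
        Finsupp.linearCombination k (fun g => Finsupp.single (aff (D.vert g)) 1) by
    rw [h]; rfl
  refine Finsupp.lhom_ext fun g a => ?_
  rw [LinearMap.add_apply, LinearMap.comp_apply, Attach.cellSum_single,
    Attach.cellChain_stdVertices_self, map_single, sphere_single, Finsupp.linearCombination_single,
    map_smul, ← smul_add, sub_add_cancel]
  rfl

theorem Adapted.affSum_mem (h : D.Adapted S BG BR) {c : D.G →₀ k}
    (hc : c ∈ Finsupp.supported k k BG) :
    Finsupp.linearCombination k (fun g => (Finsupp.single (aff (D.vert g)) 1 :
      SChain k (i + 1) E)) c ∈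
      Ch k (Attach.base D.lowerMap ⁻¹' (Attach.base D.upperMap ⁻¹' S)) (i + 1) := by
  rw [Finsupp.linearCombination_apply]
  exact Submodule.sum_mem _ fun g hg => Submodule.smul_mem _ _
    (single_mem_Ch (h.aff_mem g (hc hg)) _)

theorem Adapted.sphere_mem (h : D.Adapted S BG BR) {c : D.G →₀ k}
    (hc : c ∈ Finsupp.supported k k BG) :
    D.sphere k c ∈ Ch k (Attach.base D.upperMap ⁻¹' S) (i + 1) := by
  rw [sphere, Finsupp.linearCombination_apply]
  refine Submodule.sum_mem _ fun g hg => Submodule.smul_mem _ _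
    (Submodule.sub_mem (Ch k _ _) ?_ ?_)
  · exact single_mem_Ch (k := k) (h.lower.cell_mem g (hc hg)) _
  · rw [map_single]
    exact single_mem_Ch (k := k) (S := Attach.base D.upperMap ⁻¹' S) (h.aff_mem g (hc hg)) _

/-- Every cycle is homologous to a combination of spheres. -/
theorem Adapted.exists_sphere (h : D.Adapted S BG BR) (hi : 1 ≤ i)
    {z : SChain k (i + 1) D.Space} (hz : z ∈ Ch k S (i + 1)) (hdz : SChain.d k i z = 0) :
    ∃ c ∈ Finsupp.supported k k BG, ∃ w ∈ Ch k S (i + 2),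
      z = SChain.map k (Attach.base D.upperMap) (i + 1) (D.sphere k c) + SChain.d k (i + 1) w := by
  obtain ⟨m, rfl⟩ := Nat.exists_eq_add_of_le' hi
  obtain ⟨a, ha, c', -, w, hw, hzeq⟩ := h.upper.exists_decomposition (k := k) (m := m) (by omega)
    hz (by rw [hdz]; exact Submodule.zero_mem _)
  -- The upper cells have dimension `i + 1`, so they contribute nothing to chains of degree `i`:
  -- their cell chain has the wrong number of vertices and is zero.
  have hc' : Attach.cellSum D.upperMap k (stdVertices (m + 1 + 1 + 1)) (m + 2) c' = 0 := by
    rw [Attach.cellSum, Finsupp.linearCombination_apply]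
    refine Finset.sum_eq_zero fun j _ => ?_
    dsimp only
    rw [cellChain_of_ne _ (by omega), map_zero, smul_zero]
  rw [hc', add_zero] at hzeq
  have hda : SChain.d k (m + 1) a = 0 := by
    refine map_injective k (Attach.base_injective (φ := D.upperMap)) _ ?_
    rw [← d_map, map_zero]
    have := hdz
    rwa [hzeq, map_add, d_d, add_zero] at this
  obtain ⟨a0, ha0, c, hc, w', hw', haeq⟩ := h.lower.exists_decomposition (k := k) (m := m) le_rfl
    ha (by rw [hda]; exact Submodule.zero_mem _)
  replace haeq : a = SChain.map k (Attach.base D.lowerMap) (m + 1 + 1) a0 +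
      Attach.cellSum D.lowerMap k (stdVertices (m + 1 + 1)) (m + 1 + 1) c +
      SChain.d k (m + 2) w' := haeq
  rw [cellSum_eq_sphere_add] at haeq
  set b := a0 + Finsupp.linearCombination k (fun g => Finsupp.single (aff (D.vert g)) 1) c with hb
  have hbm : b ∈ Ch k (Attach.base D.lowerMap ⁻¹' (Attach.base D.upperMap ⁻¹' S)) (m + 1 + 1) :=
    Submodule.add_mem _ ha0 (h.affSum_mem hc)
  have haeq' : a = SChain.map k (Attach.base D.lowerMap) (m + 1 + 1) b + D.sphere k c +
      SChain.d k (m + 2) w' := by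
    rw [haeq, hb, map_add]
    abel
  have hdb : SChain.d k (m + 1) b = 0 := by
    refine map_injective k (Attach.base_injective (φ := D.lowerMap)) _ ?_
    rw [← d_map, map_zero]
    have := hda
    rwa [haeq', map_add, map_add, d_d, add_zero, d_sphere, add_zero] at this
  -- What remains besides the spheres is a cycle in the base, which bounds because the base part of
  -- `S` is star-shaped.
  obtain ⟨e, he, hstar⟩ := h.starConvex
  obtain ⟨w0, hw0, hw0b⟩ := exists_d_eq_of_starConvex hstar he hbm hdb
  refine ⟨c, hc, w + SChain.map k (Attach.base D.upperMap) _
    (w' + SChain.map k (Attach.base D.lowerMap) _ w0), Submodule.add_mem _ hw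
      (map_mem_Ch (Set.mapsTo_preimage _ _) (Submodule.add_mem _ hw'
        (map_mem_Ch (Set.mapsTo_preimage _ _) hw0))), ?_⟩
  have hw0b' : SChain.d k (m + 2) w0 = b := hw0b
  have e1 : SChain.d k (m + 2) (w + SChain.map k (Attach.base D.upperMap) (m + 3)
      (w' + SChain.map k (Attach.base D.lowerMap) (m + 3) w0)) = SChain.d k (m + 2) w +
        (SChain.map k (Attach.base D.upperMap) (m + 2) (SChain.d k (m + 2) w') +
          SChain.map k (Attach.base D.upperMap) (m + 2)
            (SChain.map k (Attach.base D.lowerMap) (m + 2) b)) := by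
    rw [map_add, d_map, map_add, d_map, hw0b', map_add]
  refine Eq.trans ?_ (congrArg (SChain.map k (Attach.base D.upperMap) (m + 2) (D.sphere k c) + ·)
    e1.symm)
  rw [hzeq, haeq', map_add, map_add]
  abel

/-- A combination of spheres which is a boundary is a combination of relations. -/
theorem Adapted.mem_span_of_eq_d (h : D.Adapted S BG BR) (hi : 1 ≤ i) {c : D.G →₀ k}
    (hc : c ∈ Finsupp.supported k k BG) {w : SChain k (i + 2) D.Space} (hw : w ∈ Ch k S (i + 2))
    (hcw : SChain.map k (Attach.base D.upperMap) (i + 1) (D.sphere k c) = SChain.d k (i + 1) w) :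
    c ∈ Submodule.span k (D.relation k '' BR) := by
  -- The chain `w` is a cycle relative to the lower space, so it is a combination `c'` of upper
  -- cells up to lower chains and boundaries. The candidate combination of relations is `ρ`.
  obtain ⟨a, ha, c', hc', w', -, hweq⟩ := h.upper.exists_decomposition (k := k) (m := i) le_rfl
    hw (by rw [← hcw]; exact map_mem_Ch (Set.mapsTo_image _ _) (h.sphere_mem hc))
  set ρ := Finsupp.linearCombination k (D.relation k) c' with hρ
  set l : SChain k (i + 2) E :=
    Finsupp.linearCombination k (fun r => Finsupp.single (aff (D.rvert r)) 1) c' with hl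
  have hlm : l ∈ Ch k (Attach.base D.lowerMap ⁻¹' (Attach.base D.upperMap ⁻¹' S)) (i + 2) := by
    rw [hl, Finsupp.linearCombination_apply]
    exact Submodule.sum_mem _ fun r hr => Submodule.smul_mem _ _
      (single_mem_Ch (h.raff_mem r (hc' hr)) _)
  have hd : SChain.d k (i + 1) (Attach.cellSum D.upperMap k (stdVertices (i + 1 + 1)) (i + 2) c') =
      SChain.map k (Attach.base D.upperMap) (i + 1) (D.sphere k ρ +
        SChain.map k (Attach.base D.lowerMap) (i + 1) (SChain.d k (i + 1) l)) := by
    rw [Attach.cellSum, Finsupp.linearCombination_apply, hρ, hl, Finsupp.linearCombination_apply,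
      Finsupp.linearCombination_apply]
    simp only [Finsupp.sum, map_sum, map_smul, ← Finset.sum_add_distrib, ← smul_add]
    refine Finset.sum_congr rfl fun r _ => ?_
    change c' r • SChain.d k (i + 1) (SChain.map k (Attach.cell D.upperMap r) (i + 1 + 1)
      (cellChain k (stdVertices (i + 1 + 1)) (i + 1 + 1))) = _
    rw [Attach.cellChain_stdVertices_self, map_single]
    congr 1
    exact D.d_upper k r
  have hsub : D.sphere k (c - ρ) = SChain.d k (i + 1) a +
      SChain.map k (Attach.base D.lowerMap) (i + 1) (SChain.d k (i + 1) l) := by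
    refine map_injective k (Attach.base_injective (φ := D.upperMap)) _ ?_
    have := hcw
    rw [hweq, map_add, map_add, d_d, add_zero, hd, d_map, ← map_add] at this
    have h2 := map_injective k (Attach.base_injective (φ := D.upperMap)) _ this
    rw [map_sub, h2]
    congr 1
    abel
  have hρB : ρ ∈ Finsupp.supported k k BG := by
    rw [hρ, Finsupp.linearCombination_apply]
    refine Submodule.sum_mem _ fun r hr => Submodule.smul_mem _ _ ?_
    refine Submodule.sum_mem _ fun j _ => Submodule.smul_mem _ _ ?_
    rcases hf : D.faces r j with _ | g
    · exact Submodule.zero_mem _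
    · exact Finsupp.single_mem_supported k _ (h.face_mem r (hc' hr) j g hf)
  obtain ⟨m, rfl⟩ := Nat.exists_eq_add_of_le' hi
  -- The spheres of `c - ρ` bound modulo the base, and the lower cells are independent in relative
  -- homology.
  have h0 : c - ρ = 0 := by
    refine h.lower.eq_zero_of_mem (k := k) (m := m) rfl (Submodule.sub_mem _ hc hρB)
      (w := -a) (Submodule.neg_mem _ ha) ?_
    change Attach.cellSum D.lowerMap k (stdVertices (m + 1 + 1)) (m + 1 + 1) (c - ρ) +
      SChain.d k (m + 2) (-a) ∈ Ch k _ (m + 1 + 1)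
    rw [cellSum_eq_sphere_add, hsub, map_neg]
    have : ∀ x y z : SChain k (m + 1 + 1) D.Lower, x + y + z + -x = y + z := fun x y z => by abel
    rw [this, ← map_add]
    exact map_mem_Ch (Set.mapsTo_image _ _) (Submodule.add_mem _ (d_mem_Ch hlm)
      (h.affSum_mem (Submodule.sub_mem _ hc hρB)))
  rw [sub_eq_zero.1 h0, hρ, Finsupp.linearCombination_apply]
  exact Submodule.sum_mem _ fun r hr => Submodule.smul_mem _ _
    (Submodule.subset_span ⟨r, hc' hr, rfl⟩)

/-- The combination of spheres given by a relation is a boundary. -/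
theorem Adapted.exists_d_eq_relation (h : D.Adapted S BG BR) {r : D.R} (hr : r ∈ BR) :
    ∃ w ∈ Ch k S (i + 2), SChain.d k (i + 1) w =
      SChain.map k (Attach.base D.upperMap) (i + 1) (D.sphere k (D.relation k r)) := by
  refine ⟨Finsupp.single (Attach.cell D.upperMap r) 1 - SChain.map k (Attach.base D.upperMap) _
    (SChain.map k (Attach.base D.lowerMap) _ (Finsupp.single (aff (D.rvert r)) 1)),
    Submodule.sub_mem _ (single_mem_Ch (h.upper.cell_mem r hr) _) ?_, ?_⟩
  · rw [map_single, map_single]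
    exact single_mem_Ch (k := k) (S := S) (h.raff_mem r hr) _
  · rw [map_sub, d_upper, d_map, d_map, map_add, add_sub_cancel_right]

end CellData

/-! ### Comparison with the singular homology functor -/

namespace HomologicalComplex

variable {k : Type u} [Field k] (K : ChainComplex (ModuleCat.{u} k) ℕ) (m : ℕ)

/-- Elements of the kernel of the differential, as elements of the object of cycles. -/
noncomputable def cyclesOfKer :
    ModuleCat.of k (LinearMap.ker (K.d (m + 1) m).hom) ⟶ K.cycles (m + 1) :=
  K.liftCycles (ModuleCat.ofHom (Submodule.subtype _)) m ((ComplexShape.down ℕ).next_eq' rfl)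
    (by ext x; exact x.2)

theorem iCycles_injective : Function.Injective (K.iCycles m).hom :=
  (ModuleCat.mono_iff_injective (K.iCycles m)).1 inferInstance

theorem iCycles_cyclesOfKer (x : LinearMap.ker (K.d (m + 1) m).hom) :
    (K.iCycles (m + 1)).hom ((K.cyclesOfKer m).hom x) = x :=
  LinearMap.congr_fun (congrArg ModuleCat.Hom.hom (K.liftCycles_i
    (A := ModuleCat.of k (LinearMap.ker (K.d (m + 1) m).hom))
    (ModuleCat.ofHom (Submodule.subtype _)) m _ _)) x

/-- The homology class of a cycle, given as an element of the kernel of the differential. -/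
noncomputable def classMap : LinearMap.ker (K.d (m + 1) m).hom →ₗ[k] K.homology (m + 1) :=
  (K.homologyπ (m + 1)).hom ∘ₗ (K.cyclesOfKer m).hom

theorem classMap_surjective : Function.Surjective (K.classMap m) := by
  intro y
  obtain ⟨c, rfl⟩ := (ModuleCat.epi_iff_surjective (K.homologyπ (m + 1))).1 inferInstance y
  have hc : (K.iCycles (m + 1)).hom c ∈ LinearMap.ker (K.d (m + 1) m).hom :=
    LinearMap.congr_fun (congrArg ModuleCat.Hom.hom (K.iCycles_d (m + 1) m)) c
  exact ⟨⟨_, hc⟩, congrArg (K.homologyπ (m + 1)).hom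
    (K.iCycles_injective _ (K.iCycles_cyclesOfKer m ⟨_, hc⟩))⟩

theorem classMap_eq_zero_iff (x : LinearMap.ker (K.d (m + 1) m).hom) :
    K.classMap m x = 0 ↔ ∃ w : K.X (m + 2), (K.d (m + 2) (m + 1)).hom w = x := by
  have ht := fun w => LinearMap.congr_fun
    (congrArg ModuleCat.Hom.hom (K.toCycles_i (m + 2) (m + 1))) w
  constructor
  · intro h
    have hex := ShortComplex.exact_of_g_is_cokernel
      (ShortComplex.mk _ _ (K.toCycles_comp_homologyπ (m + 2) (m + 1)))
      (K.homologyIsCokernel (m + 2) (m + 1) ((ComplexShape.down ℕ).prev_eq' rfl))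
    obtain ⟨w, hw⟩ := (ShortComplex.moduleCat_exact_iff _).1 hex _ h
    refine ⟨w, ?_⟩
    rw [← ht w]
    exact (congrArg (K.iCycles (m + 1)).hom hw).trans (K.iCycles_cyclesOfKer m x)
  · rintro ⟨w, hw⟩
    have : (K.toCycles (m + 2) (m + 1)).hom w = (K.cyclesOfKer m).hom x :=
      K.iCycles_injective _ ((ht w).trans (hw.trans (K.iCycles_cyclesOfKer m x).symm))
    rw [classMap, LinearMap.comp_apply, ← this]
    exact LinearMap.congr_fun (congrArg ModuleCat.Hom.hom
      (K.toCycles_comp_homologyπ (m + 2) (m + 1))) w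

theorem homologyMap_classMap {K L : ChainComplex (ModuleCat.{u} k) ℕ} (f : K ⟶ L) (m : ℕ)
    (x : LinearMap.ker (K.d (m + 1) m).hom) (y : LinearMap.ker (L.d (m + 1) m).hom)
    (h : (f.f (m + 1)).hom x = y) :
    (homologyMap f (m + 1)).hom (K.classMap m x) = L.classMap m y := by
  refine (LinearMap.congr_fun (congrArg ModuleCat.Hom.hom
    (homologyπ_naturality f (m + 1))) _).trans (congrArg (L.homologyπ (m + 1)).hom ?_)
  apply L.iCycles_injective
  refine (LinearMap.congr_fun (congrArg ModuleCat.Hom.hom (cyclesMap_i f (m + 1))) _).trans ?_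
  exact (congrArg (f.f (m + 1)).hom (K.iCycles_cyclesOfKer m x)).trans
    (h.trans (L.iCycles_cyclesOfKer m y).symm)

end HomologicalComplex

namespace SChain

open HomologicalComplex

variable (k : Type u) [Field k]

/-- The singular chain complex of a space. -/
noncomputable abbrev complex (X : TopCat.{u}) : ChainComplex (ModuleCat.{u} k) ℕ :=
  (TopCat.toSSet.obj X).chainComplex (ModuleCat.of k k)

/-- The generator of the singular chain complex given by a singular simplex. -/
noncomputable def gen {X : TopCat.{u}} {m : ℕ} (σ : C(stdSimplex ℝ (Fin (m + 1)), X)) :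
    (complex k X).X m :=
  ((TopCat.toSSet.obj X).ιChainComplex (R := ModuleCat.of k k)
    ((X.toSSetObjEquiv (Opposite.op (SimplexCategory.mk m))).symm σ)).hom (1 : k)

/-- The comparison of singular chains with the singular chain complex. -/
noncomputable def comparison (X : TopCat.{u}) (m : ℕ) :
    SChain k (m + 1) X →ₗ[k] (complex k X).X m :=
  Finsupp.linearCombination k fun σ => gen k σ

/-- The inverse of the comparison map. -/
noncomputable def comparisonInv (X : TopCat.{u}) (m : ℕ) :
    (complex k X).X m →ₗ[k] SChain k (m + 1) X :=
  (((TopCat.toSSet.obj X).isColimitChainComplexXCofan (ModuleCat.of k k) m).desc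
    (Limits.Cofan.mk (ModuleCat.of k (SChain k (m + 1) X)) fun x =>
      ModuleCat.ofHom (Finsupp.lsingle
        (X.toSSetObjEquiv (Opposite.op (SimplexCategory.mk m)) x)))).hom

theorem ι_comparisonInv (X : TopCat.{u}) (m : ℕ)
    (x : (TopCat.toSSet.obj X).obj (Opposite.op (SimplexCategory.mk m))) (a : k) :
    comparisonInv k X m (((TopCat.toSSet.obj X).ιChainComplex (R := ModuleCat.of k k) x).hom a) =
      Finsupp.single (X.toSSetObjEquiv (Opposite.op (SimplexCategory.mk m)) x) a :=
  LinearMap.congr_fun (congrArg ModuleCat.Hom.hom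
    (((TopCat.toSSet.obj X).isColimitChainComplexXCofan (ModuleCat.of k k) m).fac
      (Limits.Cofan.mk (ModuleCat.of k (SChain k (m + 1) X)) fun x =>
      ModuleCat.ofHom (Finsupp.lsingle
        (X.toSSetObjEquiv (Opposite.op (SimplexCategory.mk m)) x))) ⟨x⟩)) a

theorem comparison_single (X : TopCat.{u}) (m : ℕ) (σ : C(stdSimplex ℝ (Fin (m + 1)), X)) :
    comparison k X m (Finsupp.single σ 1) = gen k σ := by
  rw [comparison, Finsupp.linearCombination_single, one_smul]

/-- The comparison of singular chains with the singular chain complex, as an equivalence. -/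
noncomputable def comparisonEquiv (X : TopCat.{u}) (m : ℕ) :
    SChain k (m + 1) X ≃ₗ[k] (complex k X).X m :=
  LinearEquiv.ofLinearMap (comparison k X m) (comparisonInv k X m)
    (by
      have : ModuleCat.ofHom (comparison k X m ∘ₗ comparisonInv k X m) =
          𝟙 ((complex k X).X m) := by
        refine SSet.chainComplex_hom_ext fun x => ?_
        ext
        change comparison k X m (comparisonInv k X m
          (((TopCat.toSSet.obj X).ιChainComplex (R := ModuleCat.of k k) x).hom 1)) =
            ((TopCat.toSSet.obj X).ιChainComplex (R := ModuleCat.of k k) x).hom (1 : k)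
        rw [ι_comparisonInv, comparison_single, gen, Equiv.symm_apply_apply]
      exact congrArg ModuleCat.Hom.hom this)
    (by
      refine FormalChain.linearMap_ext_single fun σ => ?_
      rw [LinearMap.comp_apply, comparison_single, gen, ι_comparisonInv, Equiv.apply_symm_apply]
      rfl)

/-- Degree `m` corresponds to `m + 1` vertices. The augmentation `d k 0` has no counterpart in the
unaugmented complex, so homology is compared in positive degrees only. -/
theorem d_comparison (X : TopCat.{u}) (m : ℕ) (c : SChain k (m + 2) X) :
    ((complex k X).d (m + 1) m).hom (comparison k X (m + 1) c) =
      comparison k X m (d k (m + 1) c) := by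
  suffices h : ((complex k X).d (m + 1) m).hom ∘ₗ comparison k X (m + 1) =
      comparison k X m ∘ₗ d k (m + 1) from LinearMap.congr_fun h c
  refine FormalChain.linearMap_ext_single fun σ => ?_
  rw [LinearMap.comp_apply, LinearMap.comp_apply, comparison_single, d_single, map_sum]
  refine (LinearMap.congr_fun (congrArg ModuleCat.Hom.hom ((TopCat.toSSet.obj X).ιChainComplex_d
    (R := ModuleCat.of k k)
    ((X.toSSetObjEquiv (Opposite.op (SimplexCategory.mk (m + 1)))).symm σ))) (1 : k)).trans ?_
  rw [ModuleCat.hom_sum, LinearMap.sum_apply]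
  refine Finset.sum_congr rfl fun j _ => ?_
  rw [map_smul, comparison_single, ModuleCat.hom_zsmul, LinearMap.smul_apply, ← Int.cast_smul_eq_zsmul k]
  push_cast
  rfl

theorem map_comparison {X Y : TopCat.{u}} (f : X ⟶ Y) (m : ℕ) (c : SChain k (m + 1) X) :
    ((SSet.chainComplexMap (TopCat.toSSet.map f) (ModuleCat.of k k)).f m).hom
      (comparison k X m c) = comparison k Y m (map k f.hom (m + 1) c) := by
  suffices h : ((SSet.chainComplexMap (TopCat.toSSet.map f) (ModuleCat.of k k)).f m).hom ∘ₗ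
      comparison k X m = comparison k Y m ∘ₗ map k f.hom (m + 1) from LinearMap.congr_fun h c
  refine FormalChain.linearMap_ext_single fun σ => ?_
  rw [LinearMap.comp_apply, LinearMap.comp_apply, comparison_single, map_single, comparison_single]
  exact LinearMap.congr_fun (congrArg ModuleCat.Hom.hom
    (SSet.ι_chainComplexMap_f _ _ (TopCat.toSSet.map f) (ModuleCat.of k k)
      ((X.toSSetObjEquiv (Opposite.op (SimplexCategory.mk m))).symm σ))) (1 : k)

/-- The homology class of a singular cycle. -/
noncomputable def homologyClass (X : TopCat.{u}) (m : ℕ) :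
    LinearMap.ker (d k (m + 1) : SChain k (m + 2) X →ₗ[k] SChain k (m + 1) X) →ₗ[k]
      (singularHomology k (m + 1)).obj X :=
  (complex k X).classMap m ∘ₗ LinearMap.restrict (comparison k X (m + 1)) fun c hc => by
    rw [LinearMap.mem_ker] at hc ⊢
    rw [d_comparison, hc, map_zero]

theorem homologyClass_surjective (X : TopCat.{u}) (m : ℕ) :
    Function.Surjective (homologyClass k X m) := by
  refine ((complex k X).classMap_surjective m).comp fun y => ?_
  refine ⟨⟨(comparisonEquiv k X (m + 1)).symm y, ?_⟩, Subtype.ext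
    ((comparisonEquiv k X (m + 1)).apply_symm_apply y)⟩
  rw [LinearMap.mem_ker]
  apply (comparisonEquiv k X m).injective
  rw [map_zero]
  refine (d_comparison k X m _).symm.trans ?_
  exact (congrArg ((complex k X).d (m + 1) m).hom
    ((comparisonEquiv k X (m + 1)).apply_symm_apply y)).trans y.2

theorem homologyClass_eq_zero_iff (X : TopCat.{u}) (m : ℕ)
    (z : LinearMap.ker (d k (m + 1) : SChain k (m + 2) X →ₗ[k] SChain k (m + 1) X)) :
    homologyClass k X m z = 0 ↔ ∃ w, d k (m + 2) w = z.1 := by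
  refine ((complex k X).classMap_eq_zero_iff m _).trans ⟨?_, ?_⟩
  · rintro ⟨w, hw⟩
    refine ⟨(comparisonEquiv k X (m + 2)).symm w, (comparisonEquiv k X (m + 1)).injective ?_⟩
    refine (d_comparison k X (m + 1) _).symm.trans ?_
    exact (congrArg ((complex k X).d (m + 2) (m + 1)).hom
      ((comparisonEquiv k X (m + 2)).apply_symm_apply w)).trans hw
  · rintro ⟨w, hw⟩
    exact ⟨comparison k X (m + 2) w, (d_comparison k X (m + 1) w).trans
      (congrArg (comparison k X (m + 1)) hw)⟩

theorem map_homologyClass {X Y : TopCat.{u}} (f : X ⟶ Y) (m : ℕ)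
    (z : LinearMap.ker (d k (m + 1) : SChain k (m + 2) X →ₗ[k] SChain k (m + 1) X))
    (z' : LinearMap.ker (d k (m + 1) : SChain k (m + 2) Y →ₗ[k] SChain k (m + 1) Y))
    (h : map k f.hom (m + 2) z.1 = z'.1) :
    ((singularHomology k (m + 1)).map f).hom (homologyClass k X m z) = homologyClass k Y m z' :=
  homologyMap_classMap _ m _ _
    ((map_comparison k f (m + 1) z.1).trans (congrArg (comparison k Y (m + 1)) h))

/-! ### Homology of subspaces -/

/-- The cycles in a subspace. -/
noncomputable def cyc {X : Type*} [TopologicalSpace X] (S : Set X) (m : ℕ) :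
    Submodule k (SChain k (m + 1) X) := Ch k S (m + 1) ⊓ LinearMap.ker (d k m)

variable {X : TopCat.{u}} {n : ℕ} (γ : X → Fin n → ℝ)

/-- The inclusion of a sublevel set. -/
def sublevelIncl (b : Grade n) : C((sublevelFiltration X γ).obj b, X) :=
  ⟨Subtype.val, continuous_subtype_val⟩

theorem isEmbedding_sublevelIncl (b : Grade n) : Topology.IsEmbedding (sublevelIncl γ b) :=
  Topology.IsEmbedding.subtypeVal

/-- Cycles of a sublevel set, as cycles of the space. -/
noncomputable def cycIncl (b : Grade n) (m : ℕ) :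
    LinearMap.ker (d k (m + 1) : SChain k (m + 2) ((sublevelFiltration X γ).obj b) →ₗ[k] _) →ₗ[k]
      cyc k {x | γ x ≤ b} (m + 1) :=
  LinearMap.restrict (map k (sublevelIncl γ b) (m + 2)) fun c hc =>
    ⟨map_mem_Ch (S := Set.univ) (fun x _ => x.2) (mem_Ch_univ c), by
      change d k (m + 1) _ = 0
      rw [d_map, LinearMap.mem_ker.1 hc, map_zero]⟩

theorem exists_map_sublevelIncl_eq (b : Grade n) {m : ℕ} {c : SChain k m X}
    (hc : c ∈ Ch k {x | γ x ≤ b} m) : ∃ c', map k (sublevelIncl γ b) m c' = c := by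
  obtain ⟨c', -, h⟩ := exists_map_eq_of_mem_Ch (S := Set.univ) (isEmbedding_sublevelIncl γ b)
    (Ch_weaken hc fun x hx => ⟨⟨x, hx⟩, trivial, rfl⟩)
  exact ⟨c', h⟩

theorem cycIncl_bijective (b : Grade n) (m : ℕ) : Function.Bijective (cycIncl k γ b m) := by
  have hinj : ∀ m, Function.Injective (map k (sublevelIncl γ b) m) :=
    map_injective k (isEmbedding_sublevelIncl γ b).injective
  refine ⟨fun x y h => Subtype.ext (hinj _ (congrArg Subtype.val h)), fun z => ?_⟩
  obtain ⟨c, hc⟩ := exists_map_sublevelIncl_eq k γ b z.2.1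
  refine ⟨⟨c, ?_⟩, Subtype.ext hc⟩
  rw [LinearMap.mem_ker]
  apply hinj
  rw [← d_map, hc, map_zero]
  exact z.2.2

/-- The homology class of a cycle of a sublevel set. -/
noncomputable def sublevelClass (b : Grade n) (m : ℕ) :
    cyc k {x | γ x ≤ b} (m + 1) →ₗ[k] (sublevelHomology k (m + 1) X γ).obj b :=
  homologyClass k ((sublevelFiltration X γ).obj b) m ∘ₗ
    (LinearEquiv.ofBijective _ (cycIncl_bijective k γ b m)).symm.toLinearMap

theorem sublevelClass_cycIncl (b : Grade n) (m : ℕ) (z) :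
    sublevelClass k γ b m (cycIncl k γ b m z) = homologyClass k _ m z :=
  congrArg (homologyClass k ((sublevelFiltration X γ).obj b) m)
    ((LinearEquiv.ofBijective _ (cycIncl_bijective k γ b m)).symm_apply_apply z)

theorem sublevelClass_surjective (b : Grade n) (m : ℕ) :
    Function.Surjective (sublevelClass k γ b m) :=
  (homologyClass_surjective k _ m).comp (LinearEquiv.surjective _)

theorem sublevelClass_eq_zero_iff (b : Grade n) (m : ℕ) (z : cyc k {x | γ x ≤ b} (m + 1)) :
    sublevelClass k γ b m z = 0 ↔ ∃ w ∈ Ch k {x | γ x ≤ b} (m + 3), d k (m + 2) w = z.1 := by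
  obtain ⟨z, rfl⟩ := (cycIncl_bijective k γ b m).2 z
  rw [sublevelClass_cycIncl]
  refine (homologyClass_eq_zero_iff k _ m z).trans ⟨?_, ?_⟩
  · rintro ⟨w, hw⟩
    exact ⟨map k (sublevelIncl γ b) (m + 3) w,
      map_mem_Ch (S := Set.univ) (fun x _ => x.2) (mem_Ch_univ w), by rw [d_map, hw]; rfl⟩
  · rintro ⟨w, hw, hd⟩
    obtain ⟨w', rfl⟩ := exists_map_sublevelIncl_eq k γ b hw
    refine ⟨w', map_injective k (isEmbedding_sublevelIncl γ b).injective _ ?_⟩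
    rw [← d_map, hd]
    rfl

theorem map_sublevelClass {a b : Grade n} (h : a ≤ b) (m : ℕ)
    (z : cyc k {x | γ x ≤ a} (m + 1)) (z' : cyc k {x | γ x ≤ b} (m + 1)) (hz : z.1 = z'.1) :
    ((sublevelHomology k (m + 1) X γ).map (homOfLE h)).hom (sublevelClass k γ a m z) =
      sublevelClass k γ b m z' := by
  obtain ⟨z, rfl⟩ := (cycIncl_bijective k γ a m).2 z
  obtain ⟨z', rfl⟩ := (cycIncl_bijective k γ b m).2 z'
  rw [sublevelClass_cycIncl, sublevelClass_cycIncl]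
  refine map_homologyClass k _ m z z' (map_injective k (isEmbedding_sublevelIncl γ b).injective _ ?_)
  rw [map_map]
  exact hz

end SChain

/-! ### Additive maps over prime fields -/

section PrimeField

variable {k : Type*} [Field k]

/-- Over `ℚ` clear the denominator; over `ZMod p` each scalar is the image of a natural number. This
is the sole use of the hypothesis on the field: it lets relations with signs `±1` present a vector
space. -/
theorem AddMonoidHom.map_smul_of_primeField
    (hk : Nonempty (k ≃+* ℚ) ∨ ∃ p : ℕ, p.Prime ∧ Nonempty (k ≃+* ZMod p))
    {V W : Type*} [AddCommGroup V] [Module k V] [AddCommGroup W] [Module k W] (f : V →+ W)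
    (c : k) (v : V) : f (c • v) = c • f v := by
  have hn : ∀ (m : ℕ) (v : V), f ((m : k) • v) = (m : k) • f v := fun m v => by
    rw [Nat.cast_smul_eq_nsmul, Nat.cast_smul_eq_nsmul, map_nsmul]
  have hz : ∀ (m : ℤ) (v : V), f ((m : k) • v) = (m : k) • f v := fun m v => by
    rw [Int.cast_smul_eq_zsmul, Int.cast_smul_eq_zsmul, map_zsmul]
  rcases hk with ⟨⟨e⟩⟩ | ⟨p, hp, ⟨e⟩⟩
  · have hden : ((e c).den : k) ≠ 0 := by
      intro h
      have := congrArg e h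
      rw [map_natCast, map_zero, Nat.cast_eq_zero] at this
      exact (e c).den_ne_zero this
    have hc : ((e c).den : k) * c = ((e c).num : k) := by
      apply e.injective
      rw [map_mul, map_natCast, map_intCast, mul_comm, Rat.mul_den_eq_num]
    have h : ((e c).den : k) • f (c • v) = ((e c).den : k) • (c • f v) := by
      rw [← hn, smul_smul, hc, hz, smul_smul, hc]
    exact smul_right_injective W hden h
  · have := Fact.mk hp
    obtain ⟨m, hm⟩ := ZMod.natCast_zmod_surjective (e c)
    have hc : c = (m : k) := by
      apply e.injective
      rw [map_natCast, hm]
    rw [hc, hn]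

end PrimeField

/-! ### Presentations of persistence modules -/

section Presentation

variable {k : Type u} [Field k] {n : ℕ} {E : Type u} {lo : E → Grade n} {i : ℕ}

/-- A family of homogeneous elements of an `n`-module which contains every homogeneous element;
`lo` is a lower bound for the grades. -/
structure Presentation (P : NModule k n) {E : Type u} (lo : E → Grade n) where
  gr : E → Grade n
  lo_le : ∀ e, lo e ≤ gr e
  ev : ∀ b, E → P.obj b
  map_ev : ∀ e {b c} (h : b ≤ c), gr e ≤ b → (P.map (homOfLE h)).hom (ev b e) = ev c e
  ins : ∀ a, P.obj a → E
  gr_ins : ∀ a x, gr (ins a x) ≤ a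
  ev_ins : ∀ a x, ev a (ins a x) = x

/-- A tuple of integers whose entries are bounded by `lo e`. -/
def IsLow (lo : E → Grade n) {m : ℕ} (e : E) (t : Fin m → ℤ) : Prop := ∀ l j, (t l : ℝ) ≤ lo e j

/-- A label consists of an element and the integral vertices of a simplex. -/
abbrev Label (lo : E → Grade n) (i : ℕ) := {x : E × (Fin (i + 1) → ℤ) // IsLow lo x.1 x.2}

theorem exists_isLow (a : Grade n) (a' : Grade n) : ∃ s : ℤ, (∀ j, (s : ℝ) ≤ a j) ∧
    ∀ j, (s : ℝ) ≤ a' j := by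
  obtain ⟨c, hc⟩ := (Set.finite_range (Sum.elim a a')).bddBelow
  refine ⟨⌊c⌋, fun j => ?_, fun j => ?_⟩
  · exact (Int.floor_le c).trans (hc ⟨Sum.inl j, rfl⟩)
  · exact (Int.floor_le c).trans (hc ⟨Sum.inr j, rfl⟩)

namespace Presentation

variable {P : NModule k n} (p : Presentation P lo)

/-- A relator: elements of grade at most `a` whose alternating sum is zero in grade `a`, placed at
the faces of a simplex with integral vertices. -/
structure Relator (i : ℕ) where
  a : Grade n
  x : Fin (i + 2) → Option E
  t : Fin (i + 2) → ℤ
  t_le : ∀ l j, (t l : ℝ) ≤ a j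
  gr_le : ∀ j e, x j = some e → p.gr e ≤ a
  isLow : ∀ j e, x j = some e → IsLow lo e t
  sum_eq_zero : ∑ j : Fin (i + 2), (-1 : k) ^ (j : ℕ) • (x j).elim 0 (p.ev a) = 0

variable {p}

/-- The labels of the faces of a relator. -/
def Relator.faces (r : p.Relator i) (j : Fin (i + 2)) : Option (Label lo i) :=
  (r.x j).pmap (fun e (h : IsLow lo e r.t) => ⟨(e, r.t ∘ j.succAbove), fun _ => h _⟩)
    fun e h => r.isLow j e h

theorem Relator.faces_eq_some {r : p.Relator i} {j : Fin (i + 2)} {g : Label lo i}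
    (h : r.faces j = some g) : r.x j = some g.1.1 ∧ g.1.2 = r.t ∘ j.succAbove := by
  obtain ⟨e, he, hx, rfl⟩ := Option.pmap_eq_some_iff.1 h
  exact ⟨hx, rfl⟩

variable (k) in
/-- The combination of labels given by a relator. -/
noncomputable def Relator.vec (r : p.Relator i) : Label lo i →₀ k :=
  ∑ j : Fin (i + 2), (-1 : k) ^ (j : ℕ) • (r.faces j).elim 0 fun g => Finsupp.single g 1

variable (k lo) in
open Classical in
/-- A label as a vector, or zero for tuples which do not form a label. -/
noncomputable def lab (e : E) (t : Fin (i + 1) → ℤ) : Label lo i →₀ k :=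
  if h : IsLow lo e t then Finsupp.single ⟨(e, t), h⟩ 1 else 0

theorem lab_label (g : Label lo i) : lab k lo g.1.1 g.1.2 = Finsupp.single g 1 :=
  dif_pos g.2

theorem Relator.faces_elim (r : p.Relator i) (j : Fin (i + 2)) :
    (r.faces j).elim 0 (fun g => Finsupp.single g (1 : k)) =
      (r.x j).elim 0 fun e => lab k lo e (r.t ∘ j.succAbove) := by
  rcases h : r.faces j with _ | g
  · have : r.x j = none := Option.pmap_eq_none_iff.1 h
    rw [this]; rfl
  · obtain ⟨h1, h2⟩ := r.faces_eq_some h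
    rw [h1, Option.elim_some, Option.elim_some, ← h2, lab_label]

variable (p) in
/-- The submodule spanned by the relators of grade at most `b`. -/
noncomputable def relSpan (i : ℕ) (b : Grade n) : Submodule k (Label lo i →₀ k) :=
  Submodule.span k (Relator.vec k '' {r : p.Relator i | r.a ≤ b})

theorem mem_relSpan {b : Grade n} (x : Fin (i + 2) → Option E) (t : Fin (i + 2) → ℤ)
    (ht : ∀ l j, (t l : ℝ) ≤ b j) (hgr : ∀ j e, x j = some e → p.gr e ≤ b)
    (hlow : ∀ j e, x j = some e → IsLow lo e t)
    (hsum : ∑ j : Fin (i + 2), (-1 : k) ^ (j : ℕ) • (x j).elim 0 (p.ev b) = 0) :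
    ∑ j : Fin (i + 2), (-1 : k) ^ (j : ℕ) • (x j).elim 0 (fun e => lab k lo e (t ∘ j.succAbove)) ∈
      p.relSpan i b := by
  let r : p.Relator i := ⟨b, x, t, ht, hgr, hlow, hsum⟩
  have : r.vec k ∈ p.relSpan i b := Submodule.subset_span ⟨r, le_refl b, rfl⟩
  rw [Relator.vec] at this
  simpa only [Relator.faces_elim] using this

theorem isLow_le {b : Grade n} {e : E} {m : ℕ} {t : Fin m → ℤ} (h : IsLow lo e t)
    (he : p.gr e ≤ b) (l : Fin m) (j : Fin n) : (t l : ℝ) ≤ b j :=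
  (h l j).trans ((p.lo_le e j).trans (he j))

theorem insertNth_comp_succ_succAbove (t : Fin (i + 1) → ℤ) (s : ℤ) (q : Fin (i + 1)) :
    (Fin.insertNth q.castSucc s t : Fin (i + 2) → ℤ) ∘ q.succ.succAbove =
      Function.update t q s := by
  funext l
  rw [Function.comp_apply]
  rcases lt_trichotomy l q with h | rfl | h
  · rw [Function.update_of_ne h.ne, Fin.succAbove_of_castSucc_lt _ _ (by
      exact lt_trans (Fin.castSucc_lt_castSucc_iff.2 h) (Fin.castSucc_lt_succ))]
    rw [← Fin.succAbove_of_castSucc_lt q.castSucc l (Fin.castSucc_lt_castSucc_iff.2 h),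
      Fin.insertNth_apply_succAbove]
  · rw [Function.update_self, Fin.succAbove_of_castSucc_lt _ _ Fin.castSucc_lt_succ,
      Fin.insertNth_apply_same]
  · rw [Function.update_of_ne h.ne', Fin.succAbove_of_le_castSucc _ _ (by
      exact Fin.succ_le_castSucc_iff.2 h)]
    rw [← Fin.succAbove_of_le_castSucc q.castSucc l (Fin.castSucc_le_castSucc_iff.2 h.le),
      Fin.insertNth_apply_succAbove]

/-- Insert `s` just before the vertex `t q`. The face omitting `s` has vertices `t`, and the next
one, which omits `t q`, has `s` in its place. Their signs are opposite, so placing `e` and `e'` on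
them gives a relator. -/
theorem lab_sub_lab_update_mem {b : Grade n} {e e' : E} (he : p.gr e ≤ b) (he' : p.gr e' ≤ b)
    (h : p.ev b e = p.ev b e') {t : Fin (i + 1) → ℤ} (ht : IsLow lo e t) (ht' : IsLow lo e' t)
    {s : ℤ} (hs : ∀ j, (s : ℝ) ≤ lo e j) (hs' : ∀ j, (s : ℝ) ≤ lo e' j) (q : Fin (i + 1)) :
    lab k lo e t - lab k lo e' (Function.update t q s) ∈ p.relSpan i b := by
  set t' : Fin (i + 2) → ℤ := Fin.insertNth q.castSucc s t with ht'def
  have hlow : ∀ {e}, IsLow lo e t → (∀ j, (s : ℝ) ≤ lo e j) → IsLow lo e t' := by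
    intro e ht hs l j
    rcases Fin.eq_self_or_eq_succAbove q.castSucc l with rfl | ⟨l, rfl⟩
    · rw [ht'def, Fin.insertNth_apply_same]; exact hs j
    · rw [ht'def, Fin.insertNth_apply_succAbove]; exact ht l j
  have hne : q.castSucc ≠ q.succ := Fin.castSucc_lt_succ.ne
  let x : Fin (i + 2) → Option E := fun j =>
    if j = q.castSucc then some e else if j = q.succ then some e' else none
  have hx : ∀ j e'', x j = some e'' → e'' = e ∨ e'' = e' := by
    intro j e'' h
    simp only [x] at h
    split_ifs at h
    · exact Or.inl (Option.some.inj h).symm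
    · exact Or.inr (Option.some.inj h).symm
  have hsum : ∀ {W : Type u} [AddCommGroup W] [Module k W] (L : Fin (i + 2) → E → W),
      ∑ j : Fin (i + 2), (-1 : k) ^ (j : ℕ) • (x j).elim 0 (L j) =
        (-1 : k) ^ (q : ℕ) • (L q.castSucc e - L q.succ e') := by
    intro W _ _ L
    rw [Finset.sum_eq_add q.castSucc q.succ hne (fun j _ hj => by simp [x, hj.1, hj.2])
      (by simp) (by simp), smul_sub, sub_eq_add_neg]
    simp only [x, if_true, if_neg hne.symm, Option.elim_some, Fin.val_castSucc, Fin.val_succ,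
      pow_succ, mul_neg, mul_one, neg_smul]
  have := p.mem_relSpan (i := i) x t' (isLow_le (hlow ht hs) he)
    (fun j e'' h => (hx j e'' h).elim (fun h => h ▸ he) (fun h => h ▸ he'))
    (fun j e'' h => (hx j e'' h).elim (fun h => h ▸ hlow ht hs) (fun h => h ▸ hlow ht' hs'))
    (by rw [hsum fun _ => p.ev b, h, sub_self, smul_zero])
  rw [hsum, ht'def, insertNth_comp_succ_succAbove] at this
  have h1 : (Fin.insertNth q.castSucc s t : Fin (i + 2) → ℤ) ∘ q.castSucc.succAbove = t :=
    funext fun l => Fin.insertNth_apply_succAbove _ _ _ _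
  rw [h1] at this
  exact (Submodule.smul_mem_iff _ (pow_ne_zero _ (neg_ne_zero.2 one_ne_zero))).1 this

/-- Exchange the vertices one at a time; the class of a label does not depend on its position in the
line. -/
theorem lab_sub_lab_mem_of_isLow {b : Grade n} {e : E} (he : p.gr e ≤ b) {t t' : Fin (i + 1) → ℤ}
    (ht : IsLow lo e t) (ht' : IsLow lo e t') : lab k lo e t - lab k lo e t' ∈ p.relSpan i b := by
  suffices h : ∀ F : Finset (Fin (i + 1)),
      lab k lo e t - lab k lo e (F.piecewise t' t) ∈ p.relSpan i b by
    simpa using h Finset.univ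
  intro F
  induction F using Finset.induction_on with
  | empty => simp
  | insert q F _ ih =>
    rw [Finset.piecewise_insert, ← sub_add_sub_cancel _ (lab k lo e (F.piecewise t' t))]
    have hlow : IsLow lo e (F.piecewise t' t) := by
      intro l j
      by_cases hl : l ∈ F
      · rw [Finset.piecewise_eq_of_mem _ _ _ hl]; exact ht' l j
      · rw [Finset.piecewise_eq_of_notMem _ _ _ hl]; exact ht l j
    exact Submodule.add_mem _ ih
      (lab_sub_lab_update_mem he he rfl hlow hlow (ht' q) (ht' q) q)

/-- Both labels are moved to a constant tuple below `lo e` and `lo e'`, where the elements can be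
exchanged. -/
theorem lab_sub_lab_mem {b : Grade n} {e e' : E} (he : p.gr e ≤ b) (he' : p.gr e' ≤ b)
    (h : p.ev b e = p.ev b e') {t t' : Fin (i + 1) → ℤ} (ht : IsLow lo e t)
    (ht' : IsLow lo e' t') : lab k lo e t - lab k lo e' t' ∈ p.relSpan i b := by
  obtain ⟨s, hs, hs'⟩ := exists_isLow (lo e) (lo e')
  have h1 : lab k lo e t - lab k lo e (fun _ => s) ∈ p.relSpan i b :=
    lab_sub_lab_mem_of_isLow he ht fun _ => hs
  have h2 : lab k lo e (fun _ => s) - lab k lo e' (fun _ => s) ∈ p.relSpan i b := by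
    have := p.lab_sub_lab_update_mem (i := i) (t := fun _ => s) he he' h (fun _ => hs)
      (fun _ => hs') hs hs' 0
    rwa [Function.update_eq_self_iff.2 rfl] at this
  have h3 : lab k lo e' (fun _ => s) - lab k lo e' t' ∈ p.relSpan i b :=
    lab_sub_lab_mem_of_isLow he' (fun _ => hs') ht'
  simpa using Submodule.add_mem _ (Submodule.add_mem _ h1 h2) h3

/-- The relator has all vertices at `s`, so the labels of its faces share one tuple. The middle face
has the negative sign and carries the sum `e''`; `1 ≤ i` ensures that there are three faces. -/
theorem lab_add_sub_mem {b : Grade n} {e e' e'' : E} (he : p.gr e ≤ b) (he' : p.gr e' ≤ b)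
    (he'' : p.gr e'' ≤ b) (h : p.ev b e + p.ev b e' = p.ev b e'') {s : ℤ}
    (hs : ∀ j, (s : ℝ) ≤ lo e j) (hs' : ∀ j, (s : ℝ) ≤ lo e' j) (hs'' : ∀ j, (s : ℝ) ≤ lo e'' j)
    (hi : 1 ≤ i) :
    (lab k lo e (fun _ => s) + lab k lo e' (fun _ => s) - lab k lo e'' (fun _ => s) :
      Label lo i →₀ k) ∈ p.relSpan i b := by
  obtain ⟨m, rfl⟩ := Nat.exists_eq_add_of_le' hi
  let x : Fin (m + 1 + 2) → Option E :=
    Fin.cons (some e) (Fin.cons (some e'') (Fin.cons (some e') fun _ => none))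
  have hx : ∀ j a, x j = some a → a = e ∨ a = e' ∨ a = e'' := by
    intro j a
    refine Fin.cases (fun h => ?_) (fun j => ?_) j
    · exact Or.inl (Option.some.inj h).symm
    · refine Fin.cases (fun h => ?_) (fun j => ?_) j
      · exact Or.inr (Or.inr (Option.some.inj h).symm)
      · refine Fin.cases (fun h => ?_) (fun j h => ?_) j
        · exact Or.inr (Or.inl (Option.some.inj h).symm)
        · exact absurd h (by simp [x])
  have hsum : ∀ {W : Type u} [AddCommGroup W] [Module k W] (L : E → W),
      ∑ j : Fin (m + 1 + 2), (-1 : k) ^ (j : ℕ) • (x j).elim 0 L = L e + L e' - L e'' := by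
    intro W _ _ L
    rw [Fin.sum_univ_succ, Fin.sum_univ_succ, Fin.sum_univ_succ]
    have e0 : x 0 = some e := rfl
    have e1 : x (Fin.succ 0) = some e'' := rfl
    have e2 : x (Fin.succ (Fin.succ 0)) = some e' := rfl
    have e3 : ∀ j : Fin m, x (Fin.succ (Fin.succ (Fin.succ j))) = none := fun _ => rfl
    simp only [e0, e1, e2, e3, Option.elim_some, Option.elim_none, smul_zero,
      Finset.sum_const_zero, Fin.val_zero, Fin.val_succ, zero_add, pow_zero, pow_one, one_smul,
      add_zero, neg_smul]
    have h2 : (-1 : k) ^ (1 + 1) = 1 := by norm_num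
    rw [h2, one_smul]
    abel
  have hcases : ∀ {C : E → Prop}, C e → C e' → C e'' → ∀ j a, x j = some a → C a := by
    intro C h1 h2 h3 j a ha
    rcases hx j a ha with rfl | rfl | rfl <;> assumption
  have := p.mem_relSpan (i := m + 1) x (fun _ => s) (isLow_le (fun _ => hs) he)
    (hcases he he' he'') (hcases (fun _ => hs) (fun _ => hs') (fun _ => hs''))
    (by rw [hsum, h, sub_self])
  exact (hsum fun a => lab k lo a (fun _ => s)) ▸ this

variable (p) in
-- An inverse to the evaluation of labels: send `v` to the class of its own label, at any low tuple.
-- Independence of the tuple and of the representative, and additivity, are the relators above;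
-- linearity comes from the prime field.
theorem exists_section
    (hk : Nonempty (k ≃+* ℚ) ∨ ∃ p : ℕ, p.Prime ∧ Nonempty (k ≃+* ZMod p)) (hi : 1 ≤ i)
    (b : Grade n) : ∃ σ : P.obj b →ₗ[k] (Label lo i →₀ k) ⧸ p.relSpan i b,
      ∀ e, p.gr e ≤ b → ∀ t, IsLow lo e t →
        Submodule.Quotient.mk (lab k lo e t) = σ (p.ev b e) := by
  choose s hs _ using fun v : P.obj b => exists_isLow (lo (p.ins b v)) (lo (p.ins b v))
  let f : P.obj b → (Label lo i →₀ k) ⧸ p.relSpan i b := fun v =>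
    Submodule.Quotient.mk (lab k lo (p.ins b v) fun _ => s v)
  have hf : ∀ e, p.gr e ≤ b → ∀ t, IsLow lo e t →
      Submodule.Quotient.mk (lab k lo e t) = f (p.ev b e) := fun e he t ht =>
    (Submodule.Quotient.eq _).2 (lab_sub_lab_mem he (p.gr_ins _ _) (p.ev_ins _ _).symm ht
      fun _ => hs _)
  have hadd : ∀ v w, f (v + w) = f v + f w := by
    intro v w
    obtain ⟨r, hr, hr'⟩ := exists_isLow (lo (p.ins b v)) (lo (p.ins b w))
    obtain ⟨r', hr1, hr2⟩ := exists_isLow (lo (p.ins b (v + w))) (lo (p.ins b (v + w)))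
    have e1 := fun u => (hf (p.ins b u) (p.gr_ins b u) (fun _ => min r r')) 
    simp only [p.ev_ins] at e1
    have m1 : ((min r r' : ℤ) : ℝ) ≤ r := by exact_mod_cast min_le_left r r'
    have m2 : ((min r r' : ℤ) : ℝ) ≤ r' := by exact_mod_cast min_le_right r r'
    rw [← e1 v fun _ j => m1.trans (hr j), ← e1 w fun _ j => m1.trans (hr' j),
      ← e1 (v + w) fun _ j => m2.trans (hr1 j), ← Submodule.Quotient.mk_add, eq_comm,
      Submodule.Quotient.eq]
    exact lab_add_sub_mem (p.gr_ins _ _) (p.gr_ins _ _) (p.gr_ins _ _)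
      (by rw [p.ev_ins, p.ev_ins, p.ev_ins]) (fun j => m1.trans (hr j))
      (fun j => m1.trans (hr' j)) (fun j => m2.trans (hr1 j)) hi
  let F : P.obj b →+ (Label lo i →₀ k) ⧸ p.relSpan i b := AddMonoidHom.mk' f hadd
  exact ⟨{ F with map_smul' := F.map_smul_of_primeField hk }, hf⟩

variable (p) in
/-- The evaluation of combinations of labels. -/
noncomputable def evLabel (i : ℕ) (b : Grade n) : (Label lo i →₀ k) →ₗ[k] P.obj b :=
  Finsupp.linearCombination k fun g => p.ev b g.1.1

/-- The labels of grade at most `b`. -/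
def labels (p : Presentation P lo) (i : ℕ) (b : Grade n) : Set (Label lo i) :=
  {g | p.gr g.1.1 ≤ b}

/-- The linear map `σ` recovers the class of `c` from its evaluation, so the relators generate all
linear relations. -/
theorem mem_relSpan_of_evLabel_eq_zero
    (hk : Nonempty (k ≃+* ℚ) ∨ ∃ p : ℕ, p.Prime ∧ Nonempty (k ≃+* ZMod p)) (hi : 1 ≤ i)
    {b : Grade n} {c : Label lo i →₀ k} (hc : c ∈ Finsupp.supported k k (p.labels i b))
    (h0 : p.evLabel i b c = 0) : c ∈ p.relSpan i b := by
  obtain ⟨σ, hσ⟩ := p.exists_section hk hi b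
  rw [← Submodule.Quotient.mk_eq_zero, ← map_zero σ, ← h0, evLabel,
    Finsupp.linearCombination_apply, Finsupp.sum, map_sum]
  conv_lhs => rw [← Finsupp.sum_single c, Finsupp.sum]
  rw [← Submodule.mkQ_apply, map_sum]
  refine Finset.sum_congr rfl fun g hg => ?_
  rw [map_smul, ← hσ g.1.1 (hc hg) g.1.2 g.2, lab_label, ← Submodule.mkQ_apply, ← map_smul,
    Finsupp.smul_single_one]

/-- The second presentation `q` and the map `φ` allow relators of one module to be evaluated in
another, as needed when two modules share a space. -/
theorem evLabel_vec_eq_zero {Q : NModule k n} (q : Presentation Q lo) {r : p.Relator i}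
    {b : Grade n} (φ : P.obj r.a →ₗ[k] Q.obj b)
    (hφ : ∀ e, p.gr e ≤ r.a → φ (p.ev r.a e) = q.ev b e) : q.evLabel i b (r.vec k) = 0 := by
  have h1 := congrArg φ r.sum_eq_zero
  rw [map_sum, map_zero] at h1
  rw [Relator.vec, map_sum, ← h1]
  refine Finset.sum_congr rfl fun j _ => ?_
  rw [map_smul, map_smul, r.faces_elim]
  congr 1
  rcases hx : r.x j with _ | e
  · simp
  · rw [Option.elim_some, Option.elim_some, hφ e (r.gr_le j e hx), lab,
      dif_pos (show IsLow lo e (r.t ∘ j.succAbove) from fun _ => r.isLow j e hx _), evLabel,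
      Finsupp.linearCombination_single, one_smul]

theorem evLabel_surjOn (b : Grade n) (v : P.obj b) :
    ∃ c ∈ Finsupp.supported k k (p.labels i b), p.evLabel i b c = v := by
  obtain ⟨s, hs, -⟩ := exists_isLow (lo (p.ins b v)) (lo (p.ins b v))
  refine ⟨Finsupp.single ⟨(p.ins b v, fun _ => s), fun _ => hs⟩ 1,
    Finsupp.single_mem_supported k _ (p.gr_ins b v), ?_⟩
  rw [evLabel, Finsupp.linearCombination_single, one_smul, p.ev_ins]

theorem map_evLabel {b b' : Grade n} (h : b ≤ b') {c : Label lo i →₀ k}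
    (hc : c ∈ Finsupp.supported k k (p.labels i b)) :
    (P.map (homOfLE h)).hom (p.evLabel i b c) = p.evLabel i b' c := by
  rw [evLabel, evLabel, Finsupp.linearCombination_apply, Finsupp.linearCombination_apply,
    Finsupp.sum, Finsupp.sum, map_sum]
  refine Finset.sum_congr rfl fun g hg => ?_
  rw [map_smul, p.map_ev _ h (hc hg)]

end Presentation

end Presentation

/-- Two `n`-modules which are quotients of the same family of vector spaces by the same
subspaces are isomorphic. -/
theorem NModule.nonempty_iso_of_ker_eq {k : Type u} [Field k] {n : ℕ} (H P : NModule k n)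
    {V : Type u} [AddCommGroup V] [Module k V] {F : Grade n → Submodule k V} (hF : Monotone F)
    (p : ∀ b, F b →ₗ[k] H.obj b) (q : ∀ b, F b →ₗ[k] P.obj b)
    (hp : ∀ b, Function.Surjective (p b)) (hq : ∀ b, Function.Surjective (q b))
    (hpq : ∀ b x, p b x = 0 ↔ q b x = 0)
    (hpn : ∀ a b (h : a ≤ b) x, (H.map (homOfLE h)).hom (p a x) = p b ⟨x, hF h x.2⟩)
    (hqn : ∀ a b (h : a ≤ b) x, (P.map (homOfLE h)).hom (q a x) = q b ⟨x, hF h x.2⟩) :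
    Nonempty (H ≅ P) := by
  have hker : ∀ b, LinearMap.ker (p b) = LinearMap.ker (q b) := fun b => Submodule.ext (hpq b)
  let e : ∀ b, H.obj b ≃ₗ[k] P.obj b := fun b =>
    ((p b).quotKerEquivOfSurjective (hp b)).symm.trans
      ((Submodule.quotEquivOfEq _ _ (hker b)).trans ((q b).quotKerEquivOfSurjective (hq b)))
  have he : ∀ b x, e b (p b x) = q b x := by
    intro b x
    have : ((p b).quotKerEquivOfSurjective (hp b)).symm (p b x) = Submodule.Quotient.mk x := by
      rw [LinearEquiv.symm_apply_eq]
      rfl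
    exact congrArg (fun y => (q b).quotKerEquivOfSurjective (hq b)
      (Submodule.quotEquivOfEq _ _ (hker b) y)) this
  refine ⟨NatIso.ofComponents (fun b => (e b).toModuleIso) fun {a b} h => ?_⟩
  ext y
  obtain ⟨x, rfl⟩ := hp a y
  change e b ((H.map (homOfLE (leOfHom h))).hom (p a x)) =
    (P.map (homOfLE (leOfHom h))).hom (e a (p a x))
  rw [hpn, he, he, hqn]

/-! ### The space realizing a pair of presentations -/

/-- The real line, in an arbitrary universe. -/
abbrev Line : Type u := ULift.{u} ℝ

theorem convex_setOf_down_le (c : ℝ) : Convex ℝ {x : Line.{u} | x.down ≤ c} :=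
  convex_halfSpace_le ⟨fun _ _ => rfl, fun _ _ => rfl⟩ c

theorem aff_down_le {m : ℕ} {v : Fin m → Line.{u}} {c : ℝ} (h : ∀ l, (v l).down ≤ c)
    (p : stdSimplex ℝ (Fin m)) : (aff v p).down ≤ c :=
  aff_mem (convex_setOf_down_le c) h p

/-- A family of relators between labels. -/
structure LabelComplex {n : ℕ} {E : Type u} (lo : E → Grade n) (i : ℕ) where
  R : Type u
  faces : R → Fin (i + 2) → Option (Label lo i)
  t : R → Fin (i + 2) → ℤ
  face_eq : ∀ r j g, faces r j = some g → g.1.2 = t r ∘ j.succAbove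

namespace LabelComplex

variable {k : Type u} [Field k] {n : ℕ} {E : Type u} {lo : E → Grade n} {i : ℕ}
  (C : LabelComplex lo i)

/-- The cells of the space realizing a family of relators. -/
abbrev cells : CellData Line.{u} i where
  G := Label lo i
  R := C.R
  vert g l := ULift.up (g.1.2 l : ℝ)
  faces := C.faces
  rvert r l := ULift.up (C.t r l : ℝ)
  vert_face r j g h := by rw [C.face_eq r j g h]; rfl

/-- The diagonal function on the line. -/
def lineHeight (n : ℕ) : C(Line.{u}, Fin n → ℝ) :=
  ⟨fun x _ => x.down, continuous_pi fun _ => continuous_uliftDown⟩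

/-- The function on the lower cells given by the grades of the labels. -/
noncomputable def lowerHeight (gr : E → Grade n) : C(C.cells.Lower, Fin n → ℝ) :=
  Attach.height (lineHeight n) fun g : Label lo i => gr g.1.1

/-- The function on the space given by the grades of the labels and the relators. -/
noncomputable def height (gr : E → Grade n) (rgr : C.R → Grade n) : C(C.cells.Space, Fin n → ℝ) :=
  Attach.height (C.lowerHeight gr) rgr

variable {gr : E → Grade n} {rgr : C.R → Grade n}

theorem lineHeight_vert_le (hlo : ∀ e, lo e ≤ gr e) (g : Label lo i)
    (p : stdSimplex ℝ (Fin (i + 1))) :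
    lineHeight n (aff (C.cells.vert g) p) ≤ gr g.1.1 := fun j =>
  aff_down_le (v := C.cells.vert g) (fun l => (g.2 l j).trans (hlo _ j)) p

theorem lineHeight_rvert_le (ht : ∀ r l j, (C.t r l : ℝ) ≤ rgr r j) (r : C.R) {m : ℕ}
    (f : Fin m → Fin (i + 2)) (p : stdSimplex ℝ (Fin m)) :
    lineHeight n (aff (C.cells.rvert r ∘ f) p) ≤ rgr r := fun j =>
  aff_down_le (v := C.cells.rvert r ∘ f) (fun l => ht r (f l) j) p

theorem lowerHeight_cell_le (hlo : ∀ e, lo e ≤ gr e) (g : Label lo i) (p : Simp i) :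
    C.lowerHeight gr (Attach.cell C.cells.lowerMap g p) ≤ gr g.1.1 := by
  exact (Attach.height_cell _ _).trans_le
    (Cell.height_le (fun q => C.lineHeight_vert_le hlo g q.1) p)

theorem lowerHeight_upperMap_le (hlo : ∀ e, lo e ≤ gr e)
    (ht : ∀ r l j, (C.t r l : ℝ) ≤ rgr r j)
    (hface : ∀ r j g, C.faces r j = some g → gr g.1.1 ≤ rgr r) (r : C.R) (p : bdry (i + 1)) :
    C.lowerHeight gr (C.cells.upperMap r p) ≤ rgr r := by
  obtain ⟨p, hp⟩ := p
  obtain ⟨j, hj⟩ := (rad_eq_one_iff p).1 hp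
  obtain ⟨q, rfl⟩ : ∃ q, face (i + 1) j q = p := ⟨_, face_dropFace j ⟨p, hj⟩⟩
  rw [C.cells.upperMap_face r j q hp]
  rcases h : C.faces r j with _ | g
  · rw [C.cells.faceMap_of_none h]
    exact C.lineHeight_rvert_le ht r j.succAbove q
  · rw [C.cells.faceMap_of_some h]
    exact (C.lowerHeight_cell_le hlo g q).trans (hface r j g h)

theorem adapted (hlo : ∀ e, lo e ≤ gr e) (ht : ∀ r l j, (C.t r l : ℝ) ≤ rgr r j)
    (hface : ∀ r j g, C.faces r j = some g → gr g.1.1 ≤ rgr r) (b : Grade n) :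
    C.cells.Adapted {x | C.height gr rgr x ≤ b} {g : Label lo i | gr g.1.1 ≤ b}
      {r : C.R | rgr r ≤ b} where
  upper := Attach.adapted_height (C.lowerHeight_upperMap_le hlo ht hface) b
  lower := Attach.adapted_height (fun g p => C.lineHeight_vert_le hlo g p.1) b
  starConvex := by
    -- The sublevel sets of the line are convex and contain all sufficiently small integers, so
    -- there is a base point in every grade.
    obtain ⟨s, hs, -⟩ := exists_isLow b b
    have hconv : Convex ℝ {x : Line.{u} | ∀ j, x.down ≤ b j} := by
      rw [Set.ofPred_forall]
      exact convex_iInter fun j => convex_setOf_down_le (b j)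
    exact ⟨ULift.up (s : ℝ), hs, hconv.starConvex (x := ULift.up (s : ℝ)) hs⟩
  aff_mem g hg p := (C.lineHeight_vert_le hlo g p).trans hg
  raff_mem r hr p := (C.lineHeight_rvert_le ht r id p).trans hr
  face_mem r hr j g h := (hface r j g h).trans hr

/-- The combinations of spheres, as chains in the space. -/
noncomputable def spheres : (Label lo i →₀ k) →ₗ[k] SChain k (i + 1) C.cells.Space :=
  SChain.map k (Attach.base C.cells.upperMap) (i + 1) ∘ₗ C.cells.sphere k

variable {P : NModule k n} {p : Presentation P lo}

theorem spheres_mem {b : Grade n}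
    (hA : C.cells.Adapted {x | C.height p.gr rgr x ≤ b} (p.labels i b) {r : C.R | rgr r ≤ b})
    {c : Label lo i →₀ k} (hc : c ∈ Finsupp.supported k k (p.labels i b)) :
    C.spheres c ∈ cyc k {x | C.height p.gr rgr x ≤ b} i :=
  ⟨map_mem_Ch (Set.mapsTo_preimage _ _) (hA.sphere_mem hc), by
    change SChain.d k i (SChain.map k _ (i + 1) _) = 0
    rw [d_map, C.cells.d_sphere, map_zero]⟩

/-- The space may have more upper cells than `p` has relators. `hzero` says that the extra ones
impose no new relation, and `hex` that every relator of `p` occurs by its own grade. -/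
theorem spheres_eq_d_iff {b : Grade n}
    (hA : C.cells.Adapted {x | C.height p.gr rgr x ≤ b} (p.labels i b) {r : C.R | rgr r ≤ b})
    (hk : Nonempty (k ≃+* ℚ) ∨ ∃ p : ℕ, p.Prime ∧ Nonempty (k ≃+* ZMod p)) (hi : 1 ≤ i)
    (hzero : ∀ r, rgr r ≤ b → p.evLabel i b (C.cells.relation k r) = 0)
    (hex : ∀ r : p.Relator i, ∃ r', rgr r' ≤ r.a ∧ C.cells.relation k r' = r.vec k)
    {c : Label lo i →₀ k} (hc : c ∈ Finsupp.supported k k (p.labels i b)) :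
    (∃ w ∈ Ch k {x | C.height p.gr rgr x ≤ b} (i + 2), SChain.d k (i + 1) w = C.spheres c) ↔
      p.evLabel i b c = 0 := by
  constructor
  · rintro ⟨w, hw, hwc⟩
    have hspan := hA.mem_span_of_eq_d hi hc hw hwc.symm
    have hle : Submodule.span k (C.cells.relation k '' {r : C.R | rgr r ≤ b}) ≤
        LinearMap.ker (p.evLabel i b) := by
      rw [Submodule.span_le]
      rintro _ ⟨r, hr, rfl⟩
      exact hzero r hr
    exact hle hspan
  · intro h0
    have hle : p.relSpan i b ≤ ((Ch k {x | C.height p.gr rgr x ≤ b} (i + 2)).map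
        (SChain.d k (i + 1))).comap C.spheres := by
      rw [Presentation.relSpan, Submodule.span_le]
      rintro _ ⟨r, hr, rfl⟩
      obtain ⟨r', hr', e⟩ := hex r
      rw [← e]
      exact hA.exists_d_eq_relation (hr'.trans hr)
    exact hle (Presentation.mem_relSpan_of_evLabel_eq_zero hk hi hc h0)

/-- The homology class of a combination of spheres. -/
noncomputable def spheresClass {m : ℕ} (C : LabelComplex lo (m + 1)) (p : Presentation P lo)
    (rgr : C.R → Grade n) (hA : ∀ b : Grade n, C.cells.Adapted {x | C.height p.gr rgr x ≤ b}
      (p.labels (m + 1) b) {r : C.R | rgr r ≤ b}) (b : Grade n) :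
    Finsupp.supported k k (p.labels (m + 1) b) →ₗ[k]
      (sublevelHomology k (m + 1) (TopCat.of C.cells.Space) (C.height p.gr rgr)).obj b :=
  sublevelClass k (X := TopCat.of C.cells.Space) (C.height p.gr rgr) b m ∘ₗ
    C.spheres.restrict fun _ => C.spheres_mem (hA b)

theorem spheresClass_surjective {m : ℕ} (C : LabelComplex lo (m + 1)) (p : Presentation P lo)
    (rgr : C.R → Grade n) (hA : ∀ b : Grade n, C.cells.Adapted {x | C.height p.gr rgr x ≤ b}
      (p.labels (m + 1) b) {r : C.R | rgr r ≤ b}) (b : Grade n) :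
    Function.Surjective (C.spheresClass p rgr hA b) := by
  intro y
  obtain ⟨z, rfl⟩ := sublevelClass_surjective k (X := TopCat.of C.cells.Space)
    (C.height p.gr rgr) b m y
  obtain ⟨c, hc, w, hw, e⟩ := (hA b).exists_sphere (k := k) (Nat.le_add_left 1 m) z.2.1 z.2.2
  refine ⟨⟨c, hc⟩, ?_⟩
  rw [eq_comm, ← sub_eq_zero, spheresClass, LinearMap.comp_apply, ← map_sub]
  exact (sublevelClass_eq_zero_iff k _ b m _).2 ⟨w, hw, (sub_eq_of_eq_add' e).symm⟩

/-- The homology of the space is the module given by a presentation. -/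
theorem nonempty_iso (p : Presentation P lo) {rgr : C.R → Grade n}
    (hk : Nonempty (k ≃+* ℚ) ∨ ∃ p : ℕ, p.Prime ∧ Nonempty (k ≃+* ZMod p)) (hi : 1 ≤ i)
    (ht : ∀ r l j, (C.t r l : ℝ) ≤ rgr r j)
    (hface : ∀ r j g, C.faces r j = some g → p.gr g.1.1 ≤ rgr r)
    (hzero : ∀ r b, rgr r ≤ b → p.evLabel i b (C.cells.relation k r) = 0)
    (hex : ∀ r : p.Relator i, ∃ r', rgr r' ≤ r.a ∧ C.cells.relation k r' = r.vec k) :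
    Nonempty (sublevelHomology k i (TopCat.of C.cells.Space) (C.height p.gr rgr) ≅ P) := by
  obtain ⟨m, rfl⟩ := Nat.exists_eq_add_of_le' hi
  have hA : ∀ b : Grade n, C.cells.Adapted {x | C.height p.gr rgr x ≤ b} (p.labels (m + 1) b)
    {r : C.R | rgr r ≤ b} := C.adapted p.lo_le ht hface
  have hF : Monotone fun b => Finsupp.supported k k (p.labels (m + 1) b) :=
    fun a b h => Finsupp.supported_mono fun g hg => le_trans hg h
  refine NModule.nonempty_iso_of_ker_eq _ P hF (C.spheresClass p rgr hA)
    (fun b => p.evLabel (m + 1) b ∘ₗ Submodule.subtype _) (C.spheresClass_surjective p rgr hA)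
    (fun b v => ?_) (fun b x => ?_) (fun a b h x => ?_) (fun a b h x => ?_)
  · obtain ⟨c, hc, e⟩ := p.evLabel_surjOn (i := m + 1) b v
    exact ⟨⟨c, hc⟩, e⟩
  · exact (sublevelClass_eq_zero_iff k _ b m _).trans
      (C.spheres_eq_d_iff (hA b) hk hi (fun r => hzero r b) hex x.2)
  · exact map_sublevelClass k _ h m _ _ rfl
  · exact p.map_evLabel h x.2

end LabelComplex

/-! ### The presentations of a pair of interleaved modules -/

namespace Presentation

variable {k : Type u} [Field k] {n : ℕ} {E : Type u} {lo : E → Grade n}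

open Classical in
/-- The presentation given by a family of homogeneous elements. -/
noncomputable def ofVal {P : NModule k n} (gr : E → Grade n) (val : ∀ e, P.obj (gr e))
    (lo_le : ∀ e, lo e ≤ gr e) (ins : ∀ a, P.obj a → E)
    (h : ∀ a x, ∃ h : gr (ins a x) ≤ a, (P.map (homOfLE h)).hom (val (ins a x)) = x) :
    Presentation P lo where
  gr := gr
  lo_le := lo_le
  ev b e := if h : gr e ≤ b then (P.map (homOfLE h)).hom (val e) else 0
  map_ev e b c hbc hb := by
    rw [dif_pos hb, dif_pos (hb.trans hbc), ← LinearMap.comp_apply, ← ModuleCat.hom_comp,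
      ← P.map_comp, homOfLE_comp]
  ins := ins
  gr_ins a x := (h a x).1
  ev_ins a x := by
    obtain ⟨h1, h2⟩ := h a x
    rw [dif_pos h1, h2]

theorem ofVal_ev {P : NModule k n} {gr : E → Grade n} {val : ∀ e, P.obj (gr e)}
    {lo_le : ∀ e, lo e ≤ gr e} {ins : ∀ a, P.obj a → E}
    {h : ∀ a x, ∃ h : gr (ins a x) ≤ a, (P.map (homOfLE h)).hom (val (ins a x)) = x}
    {b : Grade n} {e : E} (hb : gr e ≤ b) :
    (ofVal (lo := lo) gr val lo_le ins h).ev b e = (P.map (homOfLE hb)).hom (val e) :=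
  dif_pos hb

end Presentation

namespace NModule

variable {k : Type u} [Field k] {n : ℕ} {M N : NModule k n}

theorem map_id_apply (P : NModule k n) (a : Grade n) (h : a ≤ a) (x : P.obj a) :
    (P.map (homOfLE h)).hom x = x := by
  rw [show homOfLE h = 𝟙 a from rfl, P.map_id]
  rfl

theorem map_map_apply (P : NModule k n) {a b c : Grade n} (h : a ≤ b) (h' : b ≤ c) (x : P.obj a) :
    (P.map (homOfLE h')).hom ((P.map (homOfLE h)).hom x) = (P.map (homOfLE (h.trans h'))).hom x := by
  rw [← LinearMap.comp_apply, ← ModuleCat.hom_comp, ← P.map_comp, homOfLE_comp]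

theorem shift_naturality {ε : ℝ} (f : M ⟶ N.shift ε) {a b : Grade n} (h : a ≤ b) (x : M.obj a) :
    (f.app b).hom ((M.map (homOfLE h)).hom x) =
      (N.map (homOfLE (Grade.add_mono ε h))).hom ((f.app a).hom x) :=
  LinearMap.congr_fun (congrArg ModuleCat.Hom.hom (f.naturality (homOfLE h))) x

variable (M N) in
/-- The homogeneous elements of a pair of modules. -/
abbrev PairElt : Type u := (Σ a : Grade n, M.obj a) ⊕ (Σ a : Grade n, N.obj a)

variable (M N) in
/-- The grade of a homogeneous element of a pair of modules. -/
def pairLo : PairElt M N → Grade n := Sum.elim Sigma.fst Sigma.fst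

/-- The elements of a pair of modules as elements of the first module. -/
def leftVal {ε : ℝ} (g : N ⟶ M.shift ε) :
    ∀ e : PairElt M N, M.obj (Sum.elim Sigma.fst (fun y => y.1.add ε) e)
  | Sum.inl x => x.2
  | Sum.inr y => (g.app y.1).hom y.2

/-- The elements of a pair of modules as elements of the second module. -/
def rightVal {ε : ℝ} (f : M ⟶ N.shift ε) :
    ∀ e : PairElt M N, N.obj (Sum.elim (fun x => x.1.add ε) Sigma.fst e)
  | Sum.inl x => (f.app x.1).hom x.2
  | Sum.inr y => y.2

/-- The presentation of the first module of a pair. -/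
noncomputable def leftPresentation {ε : ℝ} (hε : 0 ≤ ε) (g : N ⟶ M.shift ε) :
    Presentation M (pairLo M N) :=
  Presentation.ofVal _ (leftVal g)
    (by
      rintro (x | y)
      · exact le_refl _
      · exact y.1.le_add hε)
    (fun a x => Sum.inl ⟨a, x⟩) fun a x => ⟨le_refl a, M.map_id_apply a _ x⟩

/-- The presentation of the second module of a pair. -/
noncomputable def rightPresentation {ε : ℝ} (hε : 0 ≤ ε) (f : M ⟶ N.shift ε) :
    Presentation N (pairLo M N) :=
  Presentation.ofVal _ (rightVal f)
    (by
      rintro (x | y)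
      · exact x.1.le_add hε
      · exact le_refl _)
    (fun a x => Sum.inr ⟨a, x⟩) fun a x => ⟨le_refl a, N.map_id_apply a _ x⟩

variable {ε : ℝ} {hε : 0 ≤ ε} {f : M ⟶ N.shift ε} {g : N ⟶ M.shift ε}

theorem left_gr_le {a : Grade n} {e : PairElt M N} (h : (rightPresentation hε f).gr e ≤ a) :
    (leftPresentation hε g).gr e ≤ a.add ε := by
  rcases e with x | y
  · exact ((x.1.le_add hε).trans h).trans (a.le_add hε)
  · exact Grade.add_mono ε h

theorem right_gr_le {a : Grade n} {e : PairElt M N} (h : (leftPresentation hε g).gr e ≤ a) :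
    (rightPresentation hε f).gr e ≤ a.add ε := by
  rcases e with x | y
  · exact Grade.add_mono ε h
  · exact ((y.1.le_add hε).trans h).trans (a.le_add hε)

/-- Evaluating in `N` and applying `g` is evaluating in `M`, shifted by `ε`. For an element of `N`
this is the definition of `leftVal`; for one of `M` it is the interleaving identity. -/
theorem app_right_ev (hfg : ∀ a : Grade n, f.app a ≫ g.app (a.add ε) =
      M.map (homOfLE (a.le_add_add hε))) {a : Grade n} {e : PairElt M N}
    (h : (rightPresentation hε f).gr e ≤ a) :
    (g.app a).hom ((rightPresentation hε f).ev a e) =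
      (leftPresentation hε g).ev (a.add ε) e := by
  refine (congrArg (g.app a).hom (Presentation.ofVal_ev h)).trans
    (Eq.trans ?_ (Presentation.ofVal_ev (left_gr_le (g := g) h)).symm)
  refine (shift_naturality g h (rightVal f e)).trans ?_
  rcases e with x | y
  · have := LinearMap.congr_fun (congrArg ModuleCat.Hom.hom (hfg x.1)) x.2
    refine (congrArg (M.map (homOfLE (Grade.add_mono ε h))).hom this).trans ?_
    exact M.map_map_apply _ _ _
  · rfl

theorem app_left_ev (hgf : ∀ a : Grade n, g.app a ≫ f.app (a.add ε) =
      N.map (homOfLE (a.le_add_add hε))) {a : Grade n} {e : PairElt M N}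
    (h : (leftPresentation hε g).gr e ≤ a) :
    (f.app a).hom ((leftPresentation hε g).ev a e) =
      (rightPresentation hε f).ev (a.add ε) e := by
  refine (congrArg (f.app a).hom (Presentation.ofVal_ev h)).trans
    (Eq.trans ?_ (Presentation.ofVal_ev (right_gr_le (f := f) h)).symm)
  refine (shift_naturality f h (leftVal g e)).trans ?_
  rcases e with x | y
  · rfl
  · have := LinearMap.congr_fun (congrArg ModuleCat.Hom.hom (hgf y.1)) y.2
    refine (congrArg (N.map (homOfLE (Grade.add_mono ε h))).hom this).trans ?_
    exact N.map_map_apply _ _ _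

variable (hε f g) in
/-- The relators of both modules. -/
noncomputable def pairComplex (i : ℕ) : LabelComplex (pairLo M N) i where
  R := (leftPresentation hε g).Relator i ⊕ (rightPresentation hε f).Relator i
  faces := Sum.elim (fun r => r.faces) fun r => r.faces
  t := Sum.elim (fun r => r.t) fun r => r.t
  face_eq := by
    rintro (r | r) j x h
    · exact (r.faces_eq_some h).2
    · exact (r.faces_eq_some h).2

variable (hε f g) in
/-- The grades of the relators in the first module. -/
def leftGrade {i : ℕ} : (pairComplex hε f g i).R → Grade n := Sum.elim (fun r => r.a) fun r => r.a.add ε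

variable (hε f g) in
/-- The grades of the relators in the second module. -/
def rightGrade {i : ℕ} : (pairComplex hε f g i).R → Grade n := Sum.elim (fun r => r.a.add ε) fun r => r.a

/-- Relators of `M` keep their grade. A relator of `N` of grade `a` becomes valid in `M` in grade
`a.add ε` on applying `g`, so its cells add no relation to the homology. -/
theorem nonempty_iso_left {i : ℕ} (hi : 1 ≤ i)
    (hk : Nonempty (k ≃+* ℚ) ∨ ∃ p : ℕ, p.Prime ∧ Nonempty (k ≃+* ZMod p))
    (hfg : ∀ a : Grade n, f.app a ≫ g.app (a.add ε) = M.map (homOfLE (a.le_add_add hε))) :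
    Nonempty (sublevelHomology k i (TopCat.of (pairComplex hε f g i).cells.Space)
      ((pairComplex hε f g i).height (leftPresentation hε g).gr (leftGrade hε f g)) ≅ M) := by
  refine LabelComplex.nonempty_iso _ (leftPresentation hε g) hk hi ?_ ?_ ?_ ?_
  · rintro (r | r) l j
    · exact r.t_le l j
    · exact (r.t_le l j).trans (r.a.le_add hε j)
  · rintro (r | r) j x h
    · exact r.gr_le j _ (r.faces_eq_some h).1
    · exact left_gr_le (r.gr_le j _ (r.faces_eq_some h).1)
  · rintro (r | r) b h
    · exact Presentation.evLabel_vec_eq_zero (leftPresentation hε g) (r := r)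
        (M.map (homOfLE h)).hom fun e he => (leftPresentation hε g).map_ev e h he
    · refine Presentation.evLabel_vec_eq_zero (leftPresentation hε g) (r := r)
        ((M.map (homOfLE h)).hom ∘ₗ (g.app r.a).hom) fun e he => ?_
      exact (congrArg (M.map (homOfLE h)).hom (app_right_ev hfg he)).trans
        ((leftPresentation hε g).map_ev e h (left_gr_le he))
  · exact fun r => ⟨Sum.inl r, le_refl _, rfl⟩

theorem nonempty_iso_right {i : ℕ} (hi : 1 ≤ i)
    (hk : Nonempty (k ≃+* ℚ) ∨ ∃ p : ℕ, p.Prime ∧ Nonempty (k ≃+* ZMod p))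
    (hgf : ∀ a : Grade n, g.app a ≫ f.app (a.add ε) = N.map (homOfLE (a.le_add_add hε))) :
    Nonempty (sublevelHomology k i (TopCat.of (pairComplex hε f g i).cells.Space)
      ((pairComplex hε f g i).height (rightPresentation hε f).gr (rightGrade hε f g)) ≅ N) := by
  refine LabelComplex.nonempty_iso _ (rightPresentation hε f) hk hi ?_ ?_ ?_ ?_
  · rintro (r | r) l j
    · exact (r.t_le l j).trans (r.a.le_add hε j)
    · exact r.t_le l j
  · rintro (r | r) j x h
    · exact right_gr_le (r.gr_le j _ (r.faces_eq_some h).1)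
    · exact r.gr_le j _ (r.faces_eq_some h).1
  · rintro (r | r) b h
    · refine Presentation.evLabel_vec_eq_zero (rightPresentation hε f) (r := r)
        ((N.map (homOfLE h)).hom ∘ₗ (f.app r.a).hom) fun e he => ?_
      exact (congrArg (N.map (homOfLE h)).hom (app_left_ev hgf he)).trans
        ((rightPresentation hε f).map_ev e h (right_gr_le he))
    · exact Presentation.evLabel_vec_eq_zero (rightPresentation hε f) (r := r)
        (N.map (homOfLE h)).hom fun e he => (rightPresentation hε f).map_ev e h he
  · exact fun r => ⟨Sum.inr r, le_refl _, rfl⟩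

/-! ### The distance of the two functions -/

theorem norm_sub_eq_of_eq_add {a a' : Fin n → ℝ} (hn : 1 ≤ n) (hε : 0 ≤ ε)
    (h : ∀ j, a' j = a j + ε) : ‖a - a'‖ = ε := by
  have : Nonempty (Fin n) := ⟨⟨0, hn⟩⟩
  have h : a - a' = fun _ => -ε := funext fun j => by rw [Pi.sub_apply, h]; ring
  rw [h, pi_norm_const, norm_neg, Real.norm_of_nonneg hε]

/-- The functions agree on the line, and all central values differ by `ε` in every coordinate, so
interpolation gives the bound at both stages. It is attained at the centre of the cell labelled by
the zero element of `M` in grade `0`; `1 ≤ n` makes the norm of the constant vector equal to `ε`. -/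
theorem isLUB_norm_height_sub {i : ℕ} (hn : 1 ≤ n) :
    IsLUB (Set.range fun x : TopCat.of (pairComplex hε f g i).cells.Space =>
      ‖(pairComplex hε f g i).height (leftPresentation hε g).gr (leftGrade hε f g) x -
        (pairComplex hε f g i).height (rightPresentation hε f).gr (rightGrade hε f g) x‖) ε := by
  refine IsGreatest.isLUB ⟨?_, ?_⟩
  · obtain ⟨s, hs, -⟩ := exists_isLow (0 : Fin n → ℝ) (0 : Fin n → ℝ)
    let x : Label (pairLo M N) i := ⟨(Sum.inl ⟨(0 : Fin n → ℝ), 0⟩, fun _ => s), fun _ => hs⟩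
    refine ⟨Attach.base (pairComplex hε f g i).cells.upperMap (Attach.cell (pairComplex hε f g i).cells.lowerMap x
      stdSimplex.barycenter), ?_⟩
    have h1 : ∀ gr rgr, (pairComplex hε f g i).height gr rgr
        (Attach.base (pairComplex hε f g i).cells.upperMap
          (Attach.cell (pairComplex hε f g i).cells.lowerMap x stdSimplex.barycenter)) =
            gr x.1.1 := fun gr rgr => Attach.height_center _
    dsimp only
    rw [h1, h1]
    exact norm_sub_eq_of_eq_add hn hε fun _ => rfl
  · rintro _ ⟨x, rfl⟩
    refine Attach.norm_height_sub_le (fun a => Attach.norm_height_sub_le (fun z => ?_)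
      (fun y => ?_) a) (fun r => ?_) x
    · rw [sub_self, norm_zero]; exact hε
    · rcases y with ⟨⟨y | y, t⟩, h⟩
      · exact (norm_sub_eq_of_eq_add hn hε fun _ => rfl).le
      · exact ((norm_sub_rev _ _).trans (norm_sub_eq_of_eq_add hn hε fun _ => rfl)).le
    · rcases r with r | r
      · exact (norm_sub_eq_of_eq_add hn hε fun _ => rfl).le
      · exact ((norm_sub_rev _ _).trans (norm_sub_eq_of_eq_add hn hε fun _ => rfl)).le

end NModule

open CategoryTheory.Limits

/-! ### Attaching cells in a category -/

section

universe v w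

variable {K : Type w} [Category.{v} K]

/-- The morphism `f` is the attachment of copies of the morphism `b`, indexed by a type in the
universe of the morphisms. -/
def AttachesCells {S D Z Z' : K} (b : S ⟶ D) (f : Z ⟶ Z') : Prop :=
  ∃ (J : Type v) (φ : J → (S ⟶ Z)) (χ : J → (D ⟶ Z')), (∀ j, b ≫ χ j = φ j ≫ f) ∧
    ∀ (T : K) (h : Z ⟶ T) (c : J → (D ⟶ T)), (∀ j, b ≫ c j = φ j ≫ h) →
      ∃! g : Z' ⟶ T, f ≫ g = h ∧ ∀ j, χ j ≫ g = c j

namespace AttachesCells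

variable {S D Z Z' Z'' : K} {b : S ⟶ D}

theorem id (Z : K) : AttachesCells b (𝟙 Z) :=
  ⟨PEmpty, PEmpty.elim, PEmpty.elim, fun j => j.elim, fun _ h _ _ =>
    ⟨h, ⟨Category.id_comp _, fun j => j.elim⟩, fun g hg => by simpa using hg.1⟩⟩

/-- Attachments of cells of the same kind compose, if the attaching maps of the second one factor
through the source of the first one. -/
theorem comp {f : Z ⟶ Z'} {f' : Z' ⟶ Z''} (hf : AttachesCells b f) {J : Type v}
    (φ : J → (S ⟶ Z)) (χ : J → (D ⟶ Z'')) (hχ : ∀ j, b ≫ χ j = φ j ≫ f ≫ f')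
    (huniv : ∀ (T : K) (h : Z' ⟶ T) (c : J → (D ⟶ T)), (∀ j, b ≫ c j = φ j ≫ f ≫ h) →
      ∃! g : Z'' ⟶ T, f' ≫ g = h ∧ ∀ j, χ j ≫ g = c j) : AttachesCells b (f ≫ f') := by
  obtain ⟨J₀, φ₀, χ₀, hχ₀, huniv₀⟩ := hf
  refine ⟨J₀ ⊕ J, Sum.elim φ₀ φ, Sum.elim (fun j => χ₀ j ≫ f') χ, ?_, fun T h c hc => ?_⟩
  · rintro (j | j)
    · simp [reassoc_of% hχ₀ j]
    · exact hχ j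
  · obtain ⟨g₀, ⟨hg₀, hg₀'⟩, hu₀⟩ := huniv₀ T h (fun j => c (.inl j)) fun j => hc (.inl j)
    obtain ⟨g, ⟨hg, hg'⟩, hu⟩ := huniv T g₀ (fun j => c (.inr j)) fun j =>
      (hc (.inr j)).trans (by rw [hg₀]; rfl)
    refine ⟨g, ⟨by rw [Category.assoc, hg, hg₀], ?_⟩, fun g' hg'' => hu g' ⟨hu₀ _ ⟨?_, ?_⟩, ?_⟩⟩
    · rintro (j | j)
      · simp [hg, hg₀']
      · exact hg' j
    · rw [← hg''.1, Category.assoc]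
    · exact fun j => (Category.assoc _ _ _).symm.trans (hg''.2 (.inl j))
    · exact fun j => hg''.2 (.inr j)

/-- The universal property over all cells at once is that of a pushout along a coproduct of copies
of `b`. -/
theorem nonempty_attachCells [HasCoproducts.{v} K] {f : Z ⟶ Z'} (hf : AttachesCells b f) :
    Nonempty (HomotopicalAlgebra.AttachCells.{v} (fun _ : Unit => b) f) := by
  obtain ⟨J, φ, χ, hχ, huniv⟩ := hf
  have hw : ∀ j, Sigma.ι (fun _ : J => S) j ≫ Limits.Sigma.map (fun _ : J => b) =
      b ≫ Sigma.ι (fun _ : J => D) j := fun j => Sigma.ι_map _ _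
  have hdesc : ∀ s : PushoutCocone (Sigma.desc φ) (Limits.Sigma.map fun _ : J => b),
      ∃! g : Z' ⟶ s.pt, f ≫ g = s.inl ∧ ∀ j, χ j ≫ g = Sigma.ι (fun _ : J => D) j ≫ s.inr :=
    fun s => huniv s.pt s.inl _ fun j => by
      simpa using (congrArg (Sigma.ι (fun _ : J => S) j ≫ ·) s.condition).symm
  choose desc hdesc hu using hdesc
  refine ⟨{
    ι := J
    π := fun _ => ()
    cofan₁ := Cofan.mk _ (Sigma.ι fun _ : J => S)
    cofan₂ := Cofan.mk _ (Sigma.ι fun _ : J => D)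
    isColimit₁ := coproductIsCoproduct _
    isColimit₂ := coproductIsCoproduct _
    m := Limits.Sigma.map fun _ => b
    hm := hw
    g₁ := Sigma.desc φ
    g₂ := Sigma.desc χ
    isPushout := ⟨⟨?_⟩, ⟨PushoutCocone.IsColimit.mk _
      desc (fun s => (hdesc s).1) (fun s => Sigma.hom_ext _ _ fun j => ?_)
      (fun s m hm hm' => hu s m ⟨hm, fun j => by simp [← hm']⟩)⟩⟩ }⟩
  · exact Sigma.hom_ext _ _ fun j => by simp [hχ]
  · simpa using (hdesc s).2 j

end AttachesCells

end

/-! ### Towers of attachments -/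

open TopCat in
/-- The space `X` is obtained from `Z` by attaching disks of dimensions `n`, `n + 1`, … in this
order, and finitely many steps suffice. -/
def HasTower (n : ℕ) (Z X : TopCat.{u}) : Prop :=
  ∃ (F : ℕ → TopCat.{u}) (s : ∀ m, F m ⟶ F (m + 1)) (leg : ∀ m, F m ⟶ X) (N : ℕ), F 0 = Z ∧
    (∀ m, s m ≫ leg (m + 1) = leg m) ∧ (∀ m, N ≤ m → IsIso (leg m)) ∧
    ∀ m, AttachesCells (diskBoundaryInclusion (n + m)) (s m)

namespace HasTower

theorem refl (n : ℕ) (X : TopCat.{u}) : HasTower n X X :=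
  ⟨fun _ => X, fun _ => 𝟙 X, fun _ => 𝟙 X, 0, rfl, fun _ => Category.id_comp _,
    fun _ _ => inferInstance, fun _ => AttachesCells.id X⟩

theorem cons {n : ℕ} {Z Z' X : TopCat.{u}} (h : HasTower (n + 1) Z' X) (f : Z ⟶ Z')
    (hf : AttachesCells (TopCat.diskBoundaryInclusion n) f) : HasTower n Z X := by
  obtain ⟨F, s, leg, N, rfl, hs, hN, hatt⟩ := h
  let F' : ℕ → TopCat.{u} := fun m => Nat.casesOn m Z F
  let s' : ∀ m, F' m ⟶ F' (m + 1) := fun m => Nat.casesOn m f s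
  let leg' : ∀ m, F' m ⟶ X := fun m => Nat.casesOn m (f ≫ leg 0) leg
  refine ⟨F', s', leg', N + 1, rfl, ?_, ?_, ?_⟩
  · rintro (_ | m)
    · rfl
    · exact hs m
  · rintro (_ | m) hm
    · omega
    · exact hN m (by omega)
  · rintro (_ | m)
    · exact hf
    · rw [show n + (m + 1) = n + 1 + m by omega]
      exact hatt m

/-- Dimensions without cells are filled with identity stages. -/
theorem mono {m n : ℕ} {Z X : TopCat.{u}} (h : HasTower n Z X) (hmn : m ≤ n) : HasTower m Z X :=
  Nat.decreasingInduction (motive := fun m _ => HasTower m Z X)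
    (fun _ _ h => h.cons (𝟙 Z) (AttachesCells.id Z)) h hmn

/-- The legs are isomorphisms from stage `N` on, so `X` is the colimit of the tower: a cocone
descends through the inverse of the leg at `N`. -/
theorem nonempty_cwComplex {X : TopCat.{u}} (h : HasTower 0 (TopCat.of PEmpty) X) :
    Nonempty (TopCat.CWComplex X) := by
  obtain ⟨F, s, leg, N, h0, hs, hN, hatt⟩ := h
  have hinit : IsInitial (F 0) := h0 ▸ TopCat.isInitialPEmpty
  let t : Functor.ofSequence s ⟶ (Functor.const ℕ).obj X :=
    NatTrans.ofSequence leg fun m => by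
      rw [Functor.ofSequence_map_homOfLE_succ]
      exact (hs m).trans (Category.comp_id _).symm
  have hmap : ∀ {m n : ℕ}, m ≤ n → ∃ τ : F m ⟶ F n, τ ≫ leg n = leg m ∧
      ∀ c : Cocone (Functor.ofSequence s), τ ≫ c.ι.app n = c.ι.app m := fun hmn =>
    ⟨(Functor.ofSequence s).map (homOfLE hmn),
      (t.naturality (homOfLE hmn)).trans (Category.comp_id _), fun c => c.w _⟩
  have := hN N le_rfl
  refine ⟨{
    F := Functor.ofSequence s
    isoBot := hinit.uniqueUpToIso initialIsInitial
    incl := t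
    isColimit :=
      { desc := fun c => inv (leg N) ≫ c.ι.app N
        fac := fun c m => ?_
        uniq := fun c g hg => ?_ }
    fac := initialIsInitial.hom_ext _ _
    attachCells := fun m _ => ?_ }⟩
  · let q : ∀ m, F m ⟶ c.pt := c.ι.app
    change leg m ≫ inv (leg N) ≫ q N = q m
    rcases le_total m N with h | h
    · obtain ⟨τ, h₁, h₂⟩ := hmap h
      rw [← h₁, Category.assoc, IsIso.hom_inv_id_assoc]
      exact h₂ c
    · obtain ⟨τ, h₁, h₂⟩ := hmap h
      have := hN m h
      have h₃ : inv (leg N) ≫ τ = inv (leg m) := by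
        rw [IsIso.inv_comp_eq, ← h₁, Category.assoc, IsIso.hom_inv_id, Category.comp_id]
      rw [← (show τ ≫ q m = q N from h₂ c), reassoc_of% h₃, IsIso.hom_inv_id_assoc]
  · rw [← hg N]
    change g = inv (leg N) ≫ leg N ≫ g
    simp
  · have := hatt m
    rw [zero_add] at this
    have h2 : (Functor.ofSequence s).map (homOfLE (Order.le_succ m)) = s m :=
      Functor.ofSequence_map_homOfLE_succ s m
    rw [h2]
    exact this.nonempty_attachCells.some

end HasTower

open Cell

/-! ### Simplices and disks -/

/-- The barycentric coordinates with respect to the corner simplex. -/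
def cornerCoord (d : ℕ) (x : EuclideanSpace ℝ (Fin d)) : Fin (d + 1) → ℝ :=
  Fin.cons (1 - ∑ j, x j) x

theorem continuous_cornerCoord (d : ℕ) : Continuous (cornerCoord d) := by
  refine continuous_pi fun j => ?_
  induction j using Fin.cases with
  | zero => simp only [cornerCoord, Fin.cons_zero]; fun_prop
  | succ j => simp only [cornerCoord, Fin.cons_succ]; fun_prop

/-- The simplex spanned by the origin and the coordinate vectors. -/
def cornerSimplex (d : ℕ) : Set (EuclideanSpace ℝ (Fin d)) := {x | ∀ j, 0 ≤ cornerCoord d x j}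

theorem cornerCoord_mem (d : ℕ) {x : EuclideanSpace ℝ (Fin d)} (hx : x ∈ cornerSimplex d) :
    cornerCoord d x ∈ stdSimplex ℝ (Fin (d + 1)) :=
  ⟨hx, by simp [cornerCoord, Fin.sum_univ_succ]⟩

/-- The standard simplex and the corner simplex are homeomorphic. -/
def cornerHomeomorph (d : ℕ) : Simp d ≃ₜ cornerSimplex d where
  toFun p := ⟨WithLp.toLp 2 fun j => p j.succ, fun j => by
    have h := p.2.2
    rw [Fin.sum_univ_succ] at h
    induction j using Fin.cases with
    | zero =>
      have : cornerCoord d (WithLp.toLp 2 fun j => p j.succ) 0 = p 0 := by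
        simp only [cornerCoord, Fin.cons_zero]
        linarith [h, show (p.1 0 : ℝ) = p 0 from rfl, show (∑ j : Fin d, p.1 j.succ) =
          ∑ j : Fin d, p j.succ from rfl]
      exact this ▸ p.2.1 0
    | succ j => exact p.2.1 j.succ⟩
  invFun x := ⟨cornerCoord d x.1, cornerCoord_mem d x.2⟩
  left_inv p := by
    have h := p.2.2
    rw [Fin.sum_univ_succ] at h
    refine Subtype.ext (funext fun j => ?_)
    induction j using Fin.cases with
    | zero => exact (eq_sub_of_add_eq h).symm
    | succ j => rfl
  right_inv x := rfl
  continuous_toFun := Continuous.subtype_mk ((PiLp.continuous_toLp 2 _).comp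
    (continuous_pi fun j : Fin d => continuous_coord j.succ)) _
  continuous_invFun := Continuous.subtype_mk
    ((continuous_cornerCoord d).comp continuous_subtype_val) _

theorem cornerCoord_cornerHomeomorph {d : ℕ} (p : Simp d) (j : Fin (d + 1)) :
    cornerCoord d (cornerHomeomorph d p) j = p j :=
  congrFun (congrArg Subtype.val ((cornerHomeomorph d).symm_apply_apply p)) j

theorem isClosed_cornerSimplex (d : ℕ) : IsClosed (cornerSimplex d) := by
  simp only [cornerSimplex, Set.ofPred_forall]
  exact isClosed_iInter fun j =>
    isClosed_le continuous_const ((continuous_apply j).comp (continuous_cornerCoord d))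

theorem isOpen_setOf_cornerCoord_pos (d : ℕ) : IsOpen {x | ∀ j, 0 < cornerCoord d x j} := by
  simp only [Set.ofPred_forall]
  exact isOpen_iInter_of_finite fun j =>
    isOpen_lt continuous_const ((continuous_apply j).comp (continuous_cornerCoord d))

theorem isOpenMap_cornerCoord {d : ℕ} (hd : d ≠ 0) (j : Fin (d + 1)) :
    IsOpenMap fun x => cornerCoord d x j := by
  induction j using Fin.cases with
  | zero =>
    let L : EuclideanSpace ℝ (Fin d) →ₗ[ℝ] ℝ := ∑ j, (EuclideanSpace.proj j).toLinearMap
    have hL : ∀ x, L x = ∑ j, x j := fun x => by simp [L]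
    have hsurj : Function.Surjective L := fun c => by
      refine ⟨EuclideanSpace.single ⟨0, Nat.pos_of_ne_zero hd⟩ c, ?_⟩
      rw [hL]
      simp
    have h := (Homeomorph.subLeft (1 : ℝ)).isOpenMap.comp
      (L.isOpenMap_of_finiteDimensional hsurj)
    convert h using 2 with x
    simp [cornerCoord, hL]
  | succ j =>
    refine (EuclideanSpace.proj (𝕜 := ℝ) j).toLinearMap.isOpenMap_of_finiteDimensional fun c =>
      ⟨EuclideanSpace.single j c, by simp⟩

/-- For `d ≠ 0` the coordinates are nonconstant affine functions, hence open, and take the interior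
into the positive reals. For `d = 0` the only coordinate is the constant `1`. -/
theorem interior_cornerSimplex (d : ℕ) :
    interior (cornerSimplex d) = {x | ∀ j, 0 < cornerCoord d x j} := by
  refine (Set.Subset.antisymm ?_ (interior_maximal (fun x hx j => (hx j).le)
    (isOpen_setOf_cornerCoord_pos d)))
  intro x hx j
  rcases eq_or_ne d 0 with rfl | hd
  · obtain rfl : j = 0 := Fin.ext (by omega)
    simp [cornerCoord]
  · have h : (fun x => cornerCoord d x j) '' interior (cornerSimplex d) ⊆ interior (Set.Ici 0) :=
      interior_maximal (Set.image_subset_iff.2 fun y hy => interior_subset hy j)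
        (isOpenMap_cornerCoord hd j _ isOpen_interior)
    rw [interior_Ici] at h
    exact h ⟨x, hx, rfl⟩

theorem convex_cornerSimplex (d : ℕ) : Convex ℝ (cornerSimplex d) := by
  intro x hx y hy a b ha hb hab j
  have h : cornerCoord d (a • x + b • y) j = a * cornerCoord d x j + b * cornerCoord d y j := by
    induction j using Fin.cases with
    | zero =>
      simp only [cornerCoord, Fin.cons_zero, PiLp.add_apply, PiLp.smul_apply, smul_eq_mul,
        Finset.sum_add_distrib, ← Finset.mul_sum]
      linear_combination -hab
    | succ j => simp [cornerCoord]
  rw [h]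
  exact add_nonneg (mul_nonneg ha (hx j)) (mul_nonneg hb (hy j))

/-- A simplex is homeomorphic to a disk, and the boundaries correspond. -/
theorem exists_homeomorph_closedBall (d : ℕ) :
    ∃ e : Simp d ≃ₜ Metric.closedBall (0 : EuclideanSpace ℝ (Fin d)) 1,
      ∀ p, p ∈ bdry d ↔ (e p : EuclideanSpace ℝ (Fin d)) ∈ Metric.sphere 0 1 := by
  have hcompact : IsCompact (cornerSimplex d) := by
    have := (cornerHomeomorph d).compactSpace
    exact isCompact_iff_compactSpace.2 this
  have hne : (interior (cornerSimplex d)).Nonempty := by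
    rw [interior_cornerSimplex]
    refine ⟨WithLp.toLp 2 fun _ => 1 / (d + 1), fun j => ?_⟩
    have hd : (0 : ℝ) < d + 1 := by positivity
    induction j using Fin.cases with
    | zero =>
      simp only [cornerCoord, Fin.cons_zero, Finset.sum_const, Finset.card_univ, Fintype.card_fin,
        nsmul_eq_mul, mul_one_div, sub_pos, div_lt_one hd]
      linarith
    | succ j => simp only [cornerCoord, Fin.cons_succ]; positivity
  -- A bounded convex set with nonempty interior is carried to the unit ball by a homeomorphism of
  -- the whole space. The standard simplex has empty interior in its ambient space when `d > 0`,
  -- hence the passage to the corner simplex.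
  obtain ⟨h, -, hcl, hfr⟩ := exists_homeomorph_image_interior_closure_frontier_eq_unitBall
    (convex_cornerSimplex d) hne hcompact.isBounded
  rw [(isClosed_cornerSimplex d).closure_eq] at hcl
  rw [(isClosed_cornerSimplex d).frontier_eq] at hfr
  refine ⟨(cornerHomeomorph d).trans ((h.image _).trans (Homeomorph.setCongr hcl)), fun p => ?_⟩
  change rad p = 1 ↔ h (cornerHomeomorph d p) ∈ _
  rw [← hfr, h.injective.mem_set_image, interior_cornerSimplex]
  simp only [Set.mem_sdiff, (cornerHomeomorph d p).2, true_and, Set.mem_ofPred_eq,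
    cornerCoord_cornerHomeomorph, ← rad_lt_one_iff]
  exact (rad_le_one p).lt_iff_ne.not_left.symm

/-- The inclusion of the boundary of the standard simplex. -/
def simplexBoundaryInclusion (d : ℕ) :
    TopCat.of (ULift.{u} (bdry d)) ⟶ TopCat.of (ULift.{u} (Simp d)) :=
  TopCat.ofHom ⟨fun p => ⟨p.down.1⟩,
    continuous_uliftUp.comp (continuous_subtype_val.comp continuous_uliftDown)⟩

theorem AttachesCells.of_iso {K : Type*} [Category* K] {S D S' D' Z Z' : K} {b : S ⟶ D}
    {b' : S' ⟶ D'} {f : Z ⟶ Z'} (h : AttachesCells b f) (α : S' ≅ S) (β : D' ≅ D)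
    (w : b' ≫ β.hom = α.hom ≫ b) : AttachesCells b' f := by
  obtain ⟨J, φ, χ, hχ, huniv⟩ := h
  have w' : b ≫ β.inv = α.inv ≫ b' := by
    rw [Iso.comp_inv_eq, Category.assoc, w, Iso.inv_hom_id_assoc]
  refine ⟨J, fun j => α.hom ≫ φ j, fun j => β.hom ≫ χ j, fun j => ?_, fun T h c hc => ?_⟩
  · rw [reassoc_of% w, hχ, Category.assoc]
  · obtain ⟨g, ⟨hg, hg'⟩, hu⟩ := huniv T h (fun j => β.inv ≫ c j) fun j => by
      rw [reassoc_of% w', hc]; simp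
    exact ⟨g, ⟨hg, fun j => by simp [hg']⟩, fun g' h' => hu g' ⟨h'.1, fun j => by simp [← h'.2]⟩⟩

theorem AttachesCells.disk {d : ℕ} {Z Z' : TopCat.{u}} {f : Z ⟶ Z'}
    (h : AttachesCells (simplexBoundaryInclusion d) f) :
    AttachesCells (TopCat.diskBoundaryInclusion d) f := by
  obtain ⟨e, he⟩ := exists_homeomorph_closedBall d
  let e' : Metric.sphere (0 : EuclideanSpace ℝ (Fin d)) 1 ≃ₜ bdry d :=
    { toFun := fun x => ⟨e.symm ⟨x, Metric.sphere_subset_closedBall x.2⟩, (he _).2 (by simp)⟩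
      invFun := fun p => ⟨e p, (he _).1 p.2⟩
      left_inv := fun x => by simp
      right_inv := fun p => by simp
      continuous_toFun := by fun_prop
      continuous_invFun := by fun_prop }
  exact h.of_iso (TopCat.isoOfHomeo (Homeomorph.ulift.trans (e'.trans Homeomorph.ulift.symm)))
    (TopCat.isoOfHomeo (Homeomorph.ulift.trans (e.symm.trans Homeomorph.ulift.symm))) rfl

/-! ### The CW structure -/

/-- The morphism of spaces defined by a continuous map on a space of the lowest universe. -/
abbrev ofULift {P : Type} [TopologicalSpace P] {A : Type u} [TopologicalSpace A] (c : C(P, A)) :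
    TopCat.of (ULift.{u} P) ⟶ TopCat.of A :=
  TopCat.ofHom (c.comp ⟨ULift.down, continuous_uliftDown⟩)

namespace Attach

variable {A : Type u} [TopologicalSpace A] {J : Type u} {d : ℕ} (φ : J → C(bdry d, A))

theorem simplexBoundaryInclusion_comp_cell (j : J) :
    simplexBoundaryInclusion d ≫ ofULift (cell φ j) = ofULift (φ j) ≫ TopCat.ofHom (base φ) :=
  TopCat.hom_ext (ContinuousMap.ext fun p => cell_of_mem j p.down.2)

theorem existsUnique_desc (T : TopCat.{u}) (h : TopCat.of A ⟶ T)
    (c : J → (TopCat.of (ULift.{u} (Simp d)) ⟶ T))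
    (hc : ∀ j, simplexBoundaryInclusion d ≫ c j = ofULift (φ j) ≫ h) :
    ∃! g : TopCat.of (Attach φ) ⟶ T,
      TopCat.ofHom (base φ) ≫ g = h ∧ ∀ j, ofULift (cell φ j) ≫ g = c j := by
  have hc' : ∀ j (p : bdry d), c j ⟨p.1⟩ = h (φ j p) := fun j p =>
    ConcreteCategory.congr_hom (hc j) ⟨p⟩
  refine ⟨TopCat.ofHom (desc h.hom
    (fun j => (c j).hom.comp ⟨ULift.up, continuous_uliftUp⟩) hc'), ⟨?_, fun j => ?_⟩, fun g hg => ?_⟩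
  · exact TopCat.hom_ext (ContinuousMap.ext fun a => rfl)
  · exact TopCat.hom_ext (ContinuousMap.ext fun p => desc_cell _ _ hc' _ _)
  · refine TopCat.hom_ext (hom_ext (fun a => ?_) fun j p => ?_)
    · exact ConcreteCategory.congr_hom hg.1 a
    · exact (ConcreteCategory.congr_hom (hg.2 j) ⟨p⟩).trans (desc_cell h.hom
        (fun j => (c j).hom.comp ⟨ULift.up, continuous_uliftUp⟩) hc' j p).symm

theorem attachesCells : AttachesCells (simplexBoundaryInclusion d) (TopCat.ofHom (base φ)) :=
  ⟨J, _, _, simplexBoundaryInclusion_comp_cell φ, existsUnique_desc φ⟩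

end Attach

/-- The `0`-simplex is a point with empty boundary, so attaching copies of it to the empty space
gives a discrete space. -/
theorem attachesCells_discrete (A : Type u) [TopologicalSpace A] [DiscreteTopology A] :
    AttachesCells (simplexBoundaryInclusion 0)
      (TopCat.isInitialPEmpty.to (TopCat.of A)) := by
  have hb : IsEmpty (bdry 0) := ⟨fun p => by
    obtain ⟨j, hj⟩ := (rad_eq_one_iff p.1).1 p.2
    have h := p.1.2.2
    obtain rfl : j = 0 := Fin.ext (by omega)
    rw [Fin.sum_univ_succ, Finset.univ_eq_empty, Finset.sum_empty, add_zero] at h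
    exact zero_ne_one (hj.symm.trans h)⟩
  have hs : Subsingleton (Simp 0) := inferInstanceAs (Subsingleton (stdSimplex ℝ (Fin 1)))
  let pt : Simp 0 := default
  have hS : ∀ {T : TopCat.{u}} (f g : TopCat.of (ULift.{u} (bdry 0)) ⟶ T), f = g := fun f g =>
    TopCat.hom_ext (ContinuousMap.ext fun p => (hb.false p.down).elim)
  have hP : ∀ {T : TopCat.{u}} (f g : TopCat.of PEmpty.{u + 1} ⟶ T), f = g := fun f g =>
    TopCat.isInitialPEmpty.hom_ext f g
  refine ⟨A, fun _ => TopCat.ofHom ⟨fun p => (hb.false p.down).elim,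
    continuous_of_const fun p => (hb.false p.down).elim⟩,
    fun a => TopCat.ofHom (ContinuousMap.const _ a), fun _ => hS _ _, fun T h c _ => ?_⟩
  refine ⟨TopCat.ofHom ⟨fun a => c a ⟨pt⟩, continuous_of_discreteTopology⟩,
    ⟨hP _ _, fun a => TopCat.hom_ext (ContinuousMap.ext fun p => ?_)⟩, fun g hg =>
    TopCat.hom_ext (ContinuousMap.ext fun a => ConcreteCategory.congr_hom (hg.2 a) ⟨pt⟩)⟩
  exact congrArg (c a) (congrArg ULift.up (Subsingleton.elim pt p.down))

/-! ### The line -/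

/-- The integers inside the line. -/
def intInclusion : C(ULift.{u} ℤ, Line.{u}) :=
  ⟨fun z => ⟨(z.down : ℝ)⟩, continuous_of_discreteTopology⟩

theorem aff_down {m : ℕ} (v : Fin m → ℝ) (p : stdSimplex ℝ (Fin m)) :
    (aff (fun l => (⟨v l⟩ : Line.{u})) p).down = ∑ l, p l * v l :=
  map_sum (AddEquiv.ulift : Line.{u} ≃+ ℝ) _ _

/-- The boundary of a segment consists of its two ends, which go to the integral vertices. Thus
`1`-cells with integral vertices are attached to the `0`-skeleton. -/
theorem exists_lift_bdry_one (v : Fin 2 → ℤ) :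
    ∃ ψ : C(bdry 1, ULift.{u} ℤ),
      ∀ p, intInclusion (ψ p) = aff (fun l => (⟨(v l : ℝ)⟩ : Line.{u})) p.1 := by
  have h : ∀ p : bdry 1, ∃ z : ULift.{u} ℤ,
      intInclusion z = aff (fun l => (⟨(v l : ℝ)⟩ : Line.{u})) p.1 := by
    intro p
    obtain ⟨j, hj⟩ := (rad_eq_one_iff p.1).1 p.2
    have hs := p.1.2.2
    rw [Fin.sum_univ_two] at hs
    change p.1 0 + p.1 1 = 1 at hs
    fin_cases j
    · refine ⟨⟨v 1⟩, ULift.ext _ _ ?_⟩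
      rw [aff_down, Fin.sum_univ_two]
      have hj : p.1 0 = 0 := hj
      rw [show p.1 1 = 1 by linarith, hj]
      simp [intInclusion]
    · refine ⟨⟨v 0⟩, ULift.ext _ _ ?_⟩
      rw [aff_down, Fin.sum_univ_two]
      have hj : p.1 1 = 0 := hj
      rw [show p.1 0 = 1 by linarith, hj]
      simp [intInclusion]
  choose ψ hψ using h
  refine ⟨⟨ψ, ?_⟩, hψ⟩
  have hind : Topology.IsInducing (fun z : ULift.{u} ℤ => (z.down : ℝ)) :=
    Int.isClosedEmbedding_coe_real.isInducing.comp Homeomorph.ulift.isInducing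
  rw [hind.continuous_iff]
  have : (fun z : ULift.{u} ℤ => (z.down : ℝ)) ∘ ψ =
      fun p => (aff (fun l => (⟨(v l : ℝ)⟩ : Line.{u})) p.1).down :=
    funext fun p => congrArg ULift.down (hψ p)
  rw [this]
  exact continuous_uliftDown.comp ((aff _).continuous.comp continuous_subtype_val)

/-- The point of the segment with a given second coordinate, clamped to the unit interval. -/
noncomputable def segPoint : C(ℝ, Simp 1) :=
  ⟨fun t => stdSimplexHomeomorphUnitInterval.symm (Set.projIcc 0 1 zero_le_one t),
    stdSimplexHomeomorphUnitInterval.symm.continuous.comp continuous_projIcc⟩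

theorem segPoint_one {t : ℝ} (ht : t ∈ Set.Icc (0 : ℝ) 1) : segPoint t 1 = t := by
  change (Set.projIcc (0 : ℝ) 1 zero_le_one t : ℝ) = t
  rw [Set.projIcc_of_mem _ ht]

theorem segPoint_zero {t : ℝ} (ht : t ∈ Set.Icc (0 : ℝ) 1) : segPoint t 0 = 1 - t := by
  change 1 - (Set.projIcc (0 : ℝ) 1 zero_le_one t : ℝ) = 1 - t
  rw [Set.projIcc_of_mem _ ht]

theorem segPoint_self (p : Simp 1) : segPoint (p 1) = p := by
  have h : Set.projIcc 0 1 zero_le_one (p 1) = stdSimplexHomeomorphUnitInterval p :=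
    Set.projIcc_of_mem _ (stdSimplexHomeomorphUnitInterval p).2
  change stdSimplexHomeomorphUnitInterval.symm _ = p
  rw [h, Homeomorph.symm_apply_apply]

/-- The unit segment of the line starting at an integer. -/
noncomputable def unitSegment (z : ULift.{u} ℤ) : C(Simp 1, Line.{u}) :=
  aff fun l => ⟨((![z.down, z.down + 1] l : ℤ) : ℝ)⟩

theorem unitSegment_down (z : ULift.{u} ℤ) (p : Simp 1) :
    (unitSegment z p).down = z.down + p 1 := by
  have h := p.2.2
  rw [Fin.sum_univ_two] at h
  change p 0 + p 1 = 1 at h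
  rw [unitSegment, aff_down, Fin.sum_univ_two]
  simp only [Matrix.cons_val_zero, Matrix.cons_val_one, Int.cast_add, Int.cast_one]
  linear_combination (z.down : ℝ) * h

theorem locallyFinite_Icc_int : LocallyFinite fun z : ℤ => Set.Icc (z : ℝ) (z + 1) := by
  intro x
  refine ⟨Set.Ioo (x - 1) (x + 1), Ioo_mem_nhds (by linarith) (by linarith),
    (Set.finite_Icc (⌊x⌋ - 2) (⌊x⌋ + 2)).subset ?_⟩
  rintro z ⟨y, ⟨h1, h2⟩, h3, h4⟩
  have := Int.floor_le x
  have := Int.lt_floor_add_one x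
  constructor
  · have : ((⌊x⌋ - 2 : ℤ) : ℝ) ≤ z := by push_cast; linarith
    exact_mod_cast this
  · have : (z : ℝ) ≤ ((⌊x⌋ + 2 : ℤ) : ℝ) := by push_cast; linarith
    exact_mod_cast this

/-- The line is glued from the segments between consecutive integers. The closed segments are
locally finite, so a map that is continuous on each and well defined at the integers is continuous.
-/
theorem attachesCells_intInclusion :
    AttachesCells (simplexBoundaryInclusion 1) (TopCat.ofHom intInclusion.{u}) := by
  choose ψ hψ using fun z : ULift.{u} ℤ => exists_lift_bdry_one.{u} ![z.down, z.down + 1]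
  have hseg : ∀ x : Line.{u}, x = unitSegment ⟨⌊x.down⌋⟩ (segPoint (x.down - ⌊x.down⌋)) := by
    intro x
    refine ULift.ext _ _ ?_
    rw [unitSegment_down, segPoint_one ⟨by linarith [Int.floor_le x.down],
      by linarith [Int.lt_floor_add_one x.down]⟩]
    ring
  have hmem : ∀ t : ℝ, t = 0 ∨ t = 1 → segPoint t ∈ bdry 1 := by
    rintro t (rfl | rfl)
    · exact (rad_eq_one_iff _).2 ⟨1, segPoint_one (by simp)⟩
    · exact (rad_eq_one_iff _).2 ⟨0, (segPoint_zero (by simp)).trans (sub_self 1)⟩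
  have hψ' : ∀ (z : ULift.{u} ℤ) (p : bdry 1), ((ψ z p).down : ℝ) = z.down + p.1 1 :=
    fun z p => (congrArg ULift.down (hψ z p)).trans (unitSegment_down z p.1)
  refine ⟨ULift.{u} ℤ, fun z => ofULift (ψ z), fun z => ofULift (unitSegment z), fun z => ?_,
    fun T h c hc => ?_⟩
  · exact TopCat.hom_ext (ContinuousMap.ext fun p => (hψ z p.down).symm)
  have hc' : ∀ z (p : bdry 1), c z ⟨p.1⟩ = h (ψ z p) := fun z p =>
    ConcreteCategory.congr_hom (hc z) ⟨p⟩
  have hc₀ : ∀ z, c z ⟨segPoint 0⟩ = h z := fun z => by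
    refine (hc' z ⟨_, hmem 0 (.inl rfl)⟩).trans (congrArg h (ULift.ext _ _ ?_))
    have := hψ' z ⟨_, hmem 0 (.inl rfl)⟩
    rw [segPoint_one (by simp), add_zero] at this
    exact_mod_cast this
  have hc₁ : ∀ z, c z ⟨segPoint 1⟩ = h ⟨z.down + 1⟩ := fun z => by
    refine (hc' z ⟨_, hmem 1 (.inr rfl)⟩).trans (congrArg h (ULift.ext _ _ ?_))
    have := hψ' z ⟨_, hmem 1 (.inr rfl)⟩
    rw [segPoint_one (by simp)] at this
    exact_mod_cast this
  -- The floor function selects one segment for each point. At an integer the previous segment would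
  -- do as well, by `hc₀` and `hc₁`; this gives the formula `hG` on closed segments.
  let G : ℝ → T := fun x => c ⟨⌊x⌋⟩ ⟨segPoint (x - ⌊x⌋)⟩
  have hG : ∀ (z : ℤ), ∀ x ∈ Set.Icc (z : ℝ) (z + 1), G x = c ⟨z⟩ ⟨segPoint (x - z)⟩ := by
    intro z x hx
    rcases hx.2.lt_or_eq with h1 | h1
    · have : ⌊x⌋ = z := Int.floor_eq_iff.2 ⟨hx.1, h1⟩
      simp only [G, this]
    · have hf : ⌊x⌋ = z + 1 := by rw [h1]; simp
      simp only [G, hf]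
      rw [show x - ((z + 1 : ℤ) : ℝ) = 0 by push_cast; linarith, show x - z = 1 by linarith,
        hc₀, hc₁]
  have hcont : Continuous G := by
    refine locallyFinite_Icc_int.continuous (Set.eq_univ_of_forall fun x => ?_)
      (fun z => isClosed_Icc) fun z => ?_
    · exact Set.mem_iUnion.2 ⟨⌊x⌋, Int.floor_le x, (Int.lt_floor_add_one x).le⟩
    · refine ContinuousOn.congr (Continuous.continuousOn ?_) (hG z)
      exact (c ⟨z⟩).hom.continuous.comp (continuous_uliftUp.comp
        (segPoint.continuous.comp (continuous_id.sub continuous_const)))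
  refine ⟨TopCat.ofHom ⟨fun x => G x.down, hcont.comp continuous_uliftDown⟩,
    ⟨TopCat.hom_ext (ContinuousMap.ext fun z => ?_),
      fun z => TopCat.hom_ext (ContinuousMap.ext fun p => ?_)⟩,
    fun g hg => TopCat.hom_ext (ContinuousMap.ext fun x => ?_)⟩
  · change G (z.down : ℝ) = h z
    rw [hG z.down _ ⟨le_rfl, by linarith⟩, sub_self]
    exact hc₀ z
  · change G (unitSegment z p.down).down = c z p
    have h1 : p.down 1 ≤ 1 := (stdSimplexHomeomorphUnitInterval p.down).2.2
    rw [unitSegment_down, hG z.down _ ⟨by linarith [p.down.2.1 1, show p.down.1 1 = p.down 1 from rfl],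
      by linarith⟩, add_sub_cancel_left, segPoint_self]
  · change g x = G x.down
    conv_lhs => rw [hseg x]
    exact ConcreteCategory.congr_hom (hg.2 ⟨⌊x.down⌋⟩) ⟨segPoint (x.down - ⌊x.down⌋)⟩

/-- The space of a family of relators is a CW complex. -/
theorem LabelComplex.nonempty_cwComplex {n : ℕ} {E : Type u} {lo : E → Grade n} {i : ℕ}
    (hi : 1 ≤ i) (C : LabelComplex lo i) :
    Nonempty (TopCat.CWComplex (TopCat.of C.cells.Space)) := by
  have hX : HasTower (i + 1) (TopCat.of C.cells.Lower) (TopCat.of C.cells.Space) :=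
    (HasTower.refl _ _).cons _ (Attach.attachesCells C.cells.upperMap).disk
  have hZ : HasTower 1 (TopCat.of (ULift.{u} ℤ)) (TopCat.of C.cells.Space) := by
    -- For `i = 1` the lower cells have the dimension of the unit segments, so both families form
    -- one stage, and the lower cells must be attached to the integers. For larger `i` the line is
    -- completed first and empty stages fill any gap.
    rcases hi.eq_or_lt with rfl | hi
    · choose ψ hψ using fun g : C.cells.G => exists_lift_bdry_one.{u} g.1.2
      have hψ' : ∀ g, ofULift (ψ g) ≫ TopCat.ofHom intInclusion.{u} =
          ofULift (C.cells.lowerMap g) := fun g =>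
        TopCat.hom_ext (ContinuousMap.ext fun p => hψ g p.down)
      refine hX.cons _ (attachesCells_intInclusion.comp (fun g => ofULift (ψ g))
        (fun g => ofULift (Attach.cell C.cells.lowerMap g)) (f' := TopCat.ofHom
          (Attach.base C.cells.lowerMap)) (fun g => ?_) fun T h c hc => ?_).disk
      · rw [reassoc_of% hψ']
        exact Attach.simplexBoundaryInclusion_comp_cell _ g
      · exact Attach.existsUnique_desc _ T h c fun g => by
          rw [hc, reassoc_of% hψ']
    · have hA : HasTower i (TopCat.of Line.{u}) (TopCat.of C.cells.Space) :=
        hX.cons _ (Attach.attachesCells C.cells.lowerMap).disk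
      exact (hA.mono hi).cons _ attachesCells_intInclusion.disk
  exact (hZ.cons _ (attachesCells_discrete _).disk).nonempty_cwComplex

theorem mainTheorem2 (k : Type u) [Field k]
    (hk : Nonempty (k ≃+* ℚ) ∨ ∃ p : ℕ, p.Prime ∧ Nonempty (k ≃+* ZMod p))
    (n : ℕ) (hn : 1 ≤ n) (i : ℕ) (hi : 1 ≤ i)
    (ε : ℝ) (hε : 0 ≤ ε) (M N : NModule k n) (hMN : M.Interleaved N hε) :
    ∃ (X : TopCat.{u}) (_ : Nonempty (TopCat.CWComplex X)) (γM γN : C(X, Fin n → ℝ)),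
      Nonempty (sublevelHomology k i X γM ≅ M) ∧
      Nonempty (sublevelHomology k i X γN ≅ N) ∧
      IsLUB (Set.range fun x : X => ‖γM x - γN x‖) ε := by
  obtain ⟨f, g, hfg, hgf⟩ := hMN
  exact ⟨TopCat.of (NModule.pairComplex hε f g i).cells.Space,
    LabelComplex.nonempty_cwComplex hi _, _, _,
    NModule.nonempty_iso_left hi hk hfg, NModule.nonempty_iso_right hi hk hgf,
    NModule.isLUB_norm_height_sub hn⟩
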